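/- **Setting.** Let $m\ge 1$, $n\ge 0$, $d\ge 1$ be integers and let $\boldsymbol a_1,\dots,\boldsymbol a_m\in\mathbb Z_{\ge0}^n$, $\boldsymbol a_j=(a_{1j},\dots,a_{nj})$, with $|\boldsymbol a_j|=a_{1j}+\cdots+a_{nj}=d$ (the exponents of the Fermat deformation $\sum_{j} z_j\boldsymbol x^{\boldsymbol a_j}+z_{m+1}x_1^d+\cdots+z_{m+n}x_n^d$). Put $A=[\boldsymbol a_1\cdots\boldsymbol a_m\ d\boldsymbol e_1\cdots d\boldsymbol e_n]$ and $L_A=\ker(A:\mathbb Z^{m+n}\to\mathbb Z^n)$, and assume that the vectors $(d\boldsymbol e_j,-\boldsymbol a_j)$, $1\le j\le m$, form a $\mathbb Z$-basis of $L_A$. For $\boldsymbol w\in\mathbb R^{m+n}$ let $S(\boldsymbol w)$ be the regular polyhedral subdivision: $\sigma\in S(\boldsymbol w)$ iff there is $\boldsymbol\nu\in(\mathbb R^n)^*$ such that the $j$-th column $A_j$ of $A$ satisfies $\boldsymbol\nu\cdot A_j=w_j$ for $j\in\sigma$ and $\boldsymbol\nu\cdot A_j<w_j$ for $j\notin\sigma$.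 Let $\boldsymbol w$ be a perturbation of the generalized Dwork family $D(z_1,z_{m+1},\dots,z_{m+n};\boldsymbol a_1)$, that is, $w_1d<\sum_k w_{m+k}a_{k1}$ and $(a_{j\ell}w_1-a_{j1}w_\ell)d<\sum_k w_{m+k}(a_{j\ell}a_{k1}-a_{j1}a_{k\ell})$ for all $2\le\ell\le m$ and all $j$ with $a_{j1}\ne0$. Let $T(\mathrm{Fer})$ be the triangulation with the single maximal simplex $\{m+1,\dots,m+n\}$ and $T(\boldsymbol a_1)$ the one with the maximal simplices $\sigma_i=\{1,m+1,\dots,m+n\}\setminus\{m+i\}$, $a_{i1}\neq0$. For $\boldsymbol\gamma\in\mathbb C^{m+n}$ let $\varphi(\boldsymbol\gamma;\boldsymbol z)=\sum_{\boldsymbol u\in L_A}\boldsymbol z^{\boldsymbol u+\boldsymbol\gamma}/\Gamma(1+\boldsymbol u+\boldsymbol\gamma)$, where $\Gamma$ of a vector is the product of the values at its coordinates. For $T=T(\mathrm{Fer})$ or $T(\boldsymbol a_1)$ let $U_T\subset(\mathbb C^\times)^{m+n}$ be the interior of the set of points where all the series $\varphi(\boldsymbol\gamma;\boldsymbol z)$,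 with $\boldsymbol\gamma$ integral outside some maximal simplex $\sigma$ of $T$, converge absolutely. A vector $\boldsymbol c\in\mathbb C^n$ is very generic if, for all maximal $\sigma\in T(\boldsymbol a_1)$ and all $\boldsymbol\gamma$ with $A\boldsymbol\gamma=-\boldsymbol c$ and $\gamma_j\in\mathbb Z$ for $j\notin\sigma$, one has $\gamma_j\notin\mathbb Z$ for all $j\in\sigma$. For $\boldsymbol p,\boldsymbol q\in\mathbb Z^m$ and $i$ with $a_{i1}\ne0$ let $\boldsymbol\gamma^{\boldsymbol c}_{\boldsymbol p}=(\boldsymbol p,-\frac1d(\boldsymbol c+\sum_kp_k\boldsymbol a_k))$ and let $\boldsymbol\gamma^{\boldsymbol c}_{\boldsymbol q}(\boldsymbol a_1,i)$ be the unique $\boldsymbol\gamma$ with $A\boldsymbol\gamma=-\boldsymbol c$, $\gamma_k=q_k$ for $2\le k\le m$, and $\gamma_{m+i}=q_1$. With $\boldsymbol\gamma=\boldsymbol\gamma^{\boldsymbol c}_{\boldsymbol q}(\boldsymbol a_1,i)$ and $\gamma_1$ its first coordinate, put $$ \begin{aligned}C(\boldsymbol a_1,i,\boldsymbol p,\boldsymbol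 q,\boldsymbol c)=&\frac{(-1)^{p_2+\cdots+p_m}2^{d-1}}{a_{i1}}\prod_{j=1}^n\sin\frac{\pi}{d}\Bigl(c_j+\sum_{k=1}^mp_ka_{jk}\Bigr)\times\frac{(-1)^{n+q_1+\cdots+q_m}}{\sin\pi\gamma_1\prod_{j\ne i}\sin\pi\gamma_{m+j}}\\&\times\prod_{j=1}^{d-1}\sin\frac{\pi}{d}(\gamma_1-p_1+j)\;\exp\Bigl\{\frac{\pi\sqrt{-1}}{d}\bigl((d-1)\gamma_1+p_1\bigr)\Bigr\}.\end{aligned} $$ Let $M=\mathbb Z/d\times\cdots\times\mathbb Z\times\cdots\times\mathbb Z/d$ with $\mathbb Z$ as the $i$-th factor, $M_1=M/\mathbb Z\bar{\boldsymbol a}_1$, and $h:\mathbb Z^m\to M_1$, $h(\boldsymbol t)=t_1d\boldsymbol e_i+\sum_{k=2}^m(p_k+t_kd)\boldsymbol a_k$. Choose one $\boldsymbol t$ in each nonempty fibre of $h$, say $\boldsymbol t_1,\dots,\boldsymbol t_{r_i}$ (there are finitely many fibres), and put $\boldsymbol q_r(\boldsymbol p,i)=(t_1,p_2+t_2d,\dots,p_m+t_md)$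 for $\boldsymbol t=\boldsymbol t_r$. **Theorem 5.6.** The maximal elements of $S(\boldsymbol w)$ are exactly the $\sigma_i$, $a_{i1}\neq 0$, so that $S(\boldsymbol w)$ is the triangulation $T(\boldsymbol a_1)$. There is a path in $(\mathbb C^\times)^{m+n}$, with a continuous choice of $\log z_1,\dots,\log z_{m+n}$ along it, from a point of $U_{T(\mathrm{Fer})}$ to a point of $U_{T(\boldsymbol a_1)}$, which depends neither on $\boldsymbol c$ nor on $\boldsymbol p$, such that the following holds for all $\boldsymbol p\in\mathbb Z^m$ and all choices of the representatives. 1. If $\boldsymbol c\in\mathbb C^n$ is very generic, then the analytic continuation of $\varphi(\boldsymbol\gamma^{\boldsymbol c}_{\boldsymbol p};\boldsymbol z)$ along the path exists and equals $$\sum_{i;\,a_{i1}\ne0}\ \sum_{r=1}^{r_i}C(\boldsymbol a_1,i,\boldsymbol p,\boldsymbol q_r(\boldsymbol p,i),\boldsymbol c)\,\varphi(\boldsymbol\gamma^{\boldsymbol c}_{\boldsymbol q_r(\boldsymbol p,i)}(\boldsymbol a_1,i);\boldsymbol z)\qquad(*)$$ near the end point of the path. 2. If $\boldsymbol c\in\mathbb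 C^n$ is arbitrary, the formula holds as an SST-limit: for every $\boldsymbol c'\in\mathbb C^n$ such that $\boldsymbol c+\varepsilon\boldsymbol c'$ is very generic for all sufficiently small $\varepsilon\in\mathbb C\setminus\{0\}$, the coefficients $C(\boldsymbol a_1,i,\boldsymbol p,\boldsymbol q_r(\boldsymbol p,i),\boldsymbol c+\varepsilon\boldsymbol c')$ are meromorphic at $\varepsilon=0$, the expression $(*)$ for $\boldsymbol c+\varepsilon\boldsymbol c'$ converges, as $\varepsilon\to0$, uniformly in a neighbourhood of the end point, and its limit is the analytic continuation of $\varphi(\boldsymbol\gamma^{\boldsymbol c}_{\boldsymbol p};\boldsymbol z)$ along the path. -/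

import Mathlib

open Filter Topology

namespace DworkGKZ

noncomputable section

/-! ### GKZ data of an integer matrix

`A` is an integer matrix whose columns, indexed by `J`, are the vectors `𝐚_j`. -/

section GKZ

variable {I J : Type*} [Fintype I] [Fintype J]

/-- The lattice `L_A = Ker (A : ℤ^J → ℤ^I)`. -/
def lattice (A : Matrix I J ℤ) : Submodule ℤ (J → ℤ) :=
  LinearMap.ker A.mulVecLin

/-- The term of index `u` of the Gamma series `φ(γ; z)`, written in logarithmic coordinates
`z_j = exp (x_j)`, so that `z ^ (u + γ) = exp ⟨u + γ, x⟩` is single valued.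
(Mathlib's `Complex.Gamma` vanishes at its poles, so `(Gamma s)⁻¹` is the entire function `1/Γ`.) -/
def gammaTerm (γ x : J → ℂ) (u : J → ℤ) : ℂ :=
  ∏ j, Complex.exp (((u j : ℂ) + γ j) * x j) * (Complex.Gamma (1 + (u j : ℂ) + γ j))⁻¹

/-- The Gamma series `φ(γ; z) = ∑_{u ∈ L_A} z ^ (u + γ) / Γ(1 + u + γ)` at `z = exp x`. -/
def gammaSeries (A : Matrix I J ℤ) (γ x : J → ℂ) : ℂ :=
  ∑' u : lattice A, gammaTerm γ x u

/-- The regular polyhedral subdivision `S(w)` defined by a weight vector `w`. -/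
def regularSubdivision (A : Matrix I J ℤ) (w : J → ℝ) : Set (Finset J) :=
  {σ | ∃ ν : I → ℝ, (∀ j ∈ σ, ∑ i, ν i * (A i j : ℝ) = w j) ∧
    ∀ j, j ∉ σ → ∑ i, ν i * (A i j : ℝ) < w j}

/-- The maximal elements (for inclusion) of `S(w)`. -/
def maximalCells (A : Matrix I J ℤ) (w : J → ℝ) : Set (Finset J) :=
  {σ | Maximal (· ∈ regularSubdivision A w) σ}

/-- `γ` has integral coordinates outside `σ`, that is, `γ` is one of the exponents
`γ^c_{σ,p}`, `p ∈ ℤ^{J ∖ σ}`, of the GKZ system with parameter `c = -Aγ`. -/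
def IntegralOff (σ : Finset J) (γ : J → ℂ) : Prop :=
  ∀ j, j ∉ σ → ∃ k : ℤ, γ j = k

/-- `c` is very generic with respect to the triangulation with set `T` of maximal simplices:
for all `σ ∈ T` and all `p`, no coordinate of `γ^c_{σ,p}` with index in `σ` is an integer. -/
def VeryGeneric (A : Matrix I J ℤ) (T : Set (Finset J)) (c : I → ℂ) : Prop :=
  ∀ σ ∈ T, ∀ γ : J → ℂ, (∀ i, ∑ j, (A i j : ℂ) * γ j = -c i) → IntegralOff σ γ →
    ∀ j ∈ σ, ∀ k : ℤ, γ j ≠ k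

/-- The open set `U_T ⊆ (ℂ^×)^J`: the interior of the set of points at which all the series
`φ(γ^c_{σ,p}; z)`, for all `σ ∈ T`, all `p` and all parameters `c`, converge absolutely (with
respect to any branch `x` of `log z`). -/
def convergenceDomain (A : Matrix I J ℤ) (T : Set (Finset J)) : Set (J → ℂ) :=
  interior {z | (∀ j, z j ≠ 0) ∧ ∀ x : J → ℂ, (∀ j, Complex.exp (x j) = z j) →
    ∀ σ ∈ T, ∀ γ : J → ℂ, IntegralOff σ γ →
      Summable (fun u : lattice A => gammaTerm γ x u)}

end GKZ

/-- The germ of `f` at the starting point of the path `ℓ` can be analytically continued along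
`ℓ`, and the result is the germ of `g` at the end point. -/
def ContinuesAlong {E : Type*} [NormedAddCommGroup E] [NormedSpace ℂ E]
    (ℓ : C(unitInterval, E)) (f g : E → ℂ) : Prop :=
  ∃ F : unitInterval → E → ℂ,
    (∀ t, AnalyticAt ℂ (F t) (ℓ t)) ∧
    (∀ t, ∀ᶠ s in 𝓝 t, F s =ᶠ[𝓝 (ℓ s)] F t) ∧
    F 0 =ᶠ[𝓝 (ℓ 0)] f ∧ F 1 =ᶠ[𝓝 (ℓ 1)] g

/-! ### Fermat deformations

`a i j = a_{ij}` is the `i`-th entry of `𝐚_j`, for `1 ≤ i ≤ n` and `1 ≤ j ≤ m`; the vector `𝐚_1`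
has the index `0 : Fin m`. The indices `1, …, m` and `m+1, …, m+n` of the coordinates `z` are
`Sum.inl j` and `Sum.inr i`. -/

section Fermat

variable {m n : ℕ}

/-- `A = [𝐚_1 ⋯ 𝐚_m  d𝐞_1 ⋯ d𝐞_n]`. -/
def fermatA (d : ℕ) (a : Matrix (Fin n) (Fin m) ℕ) : Matrix (Fin n) (Fin m ⊕ Fin n) ℤ :=
  Matrix.fromCols (Matrix.of fun i j => (a i j : ℤ)) (Matrix.diagonal fun _ => (d : ℤ))

/-- The columns of the matrix `B`, that is `b_j = (d 𝐞_j, -𝐚_j)`. -/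
def fermatB (d : ℕ) (a : Matrix (Fin n) (Fin m) ℕ) (j : Fin m) : Fin m ⊕ Fin n → ℤ :=
  Sum.elim (Pi.single j (d : ℤ)) (fun i => -(a i j : ℤ))

/-- The set of maximal simplices of `T(Fer)`: the single simplex `{m+1, …, m+n}`. -/
def cellsFer (m n : ℕ) : Set (Finset (Fin m ⊕ Fin n)) :=
  {Finset.univ.image Sum.inr}

variable [NeZero m]

/-- `w` is a perturbation of the generalized Dwork family `D(z_1, z_{m+1}, …, z_{m+n}; 𝐚_1)`. -/
def IsDworkPerturbation (d : ℕ) (a : Matrix (Fin n) (Fin m) ℕ) (w : Fin m ⊕ Fin n → ℝ) : Prop :=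
  w (.inl 0) * d < ∑ k, w (.inr k) * a k 0 ∧
  ∀ l : Fin m, l ≠ 0 → ∀ j : Fin n, a j 0 ≠ 0 →
    (a j l * w (.inl 0) - a j 0 * w (.inl l)) * d <
      ∑ k, w (.inr k) * ((a j l : ℝ) * a k 0 - (a j 0 : ℝ) * a k l)

/-- The set of maximal simplices of `T(𝐚_1)`: the sets `{1, m+1, …, m+n} ∖ {m+i}`, `a_{i1} ≠ 0`. -/
def cellsDwork (a : Matrix (Fin n) (Fin m) ℕ) : Set (Finset (Fin m ⊕ Fin n)) :=
  {σ | ∃ i : Fin n, a i 0 ≠ 0 ∧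
    σ = insert (Sum.inl 0) ((Finset.univ.erase i).image Sum.inr)}

/-- The exponent `γ^c_p` of `T(Fer)`. -/
def expFer (d : ℕ) (a : Matrix (Fin n) (Fin m) ℕ) (c : Fin n → ℂ) (p : Fin m → ℤ) :
    Fin m ⊕ Fin n → ℂ :=
  Sum.elim (fun k => (p k : ℂ)) (fun j => -(c j + ∑ k, (p k : ℂ) * a j k) / d)

/-- The number `c_i + q_1 d + ∑_{k ≥ 2} q_k a_{ik}`. -/
def numDwork (d : ℕ) (a : Matrix (Fin n) (Fin m) ℕ) (c : Fin n → ℂ) (q : Fin m → ℤ)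
    (i : Fin n) : ℂ :=
  c i + q 0 * d + ∑ k with k ≠ 0, (q k : ℂ) * a i k

/-- The exponent `γ = γ^c_q(𝐚_1, i)` of `T(𝐚_1)`: the solution of `Aγ = -c` such that
`γ_k = q_k` for `2 ≤ k ≤ m` and `γ_{m+i} = q_1` (where `a_{i1} ≠ 0`). -/
def expDwork (d : ℕ) (a : Matrix (Fin n) (Fin m) ℕ) (c : Fin n → ℂ) (q : Fin m → ℤ)
    (i : Fin n) : Fin m ⊕ Fin n → ℂ :=
  Sum.elim
    (fun k => if k = 0 then -(numDwork d a c q i) / a i 0 else (q k : ℂ))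
    (fun j => if j = i then (q 0 : ℂ) else
      ((a j 0 : ℂ) / a i 0 * numDwork d a c q i - c j - ∑ k with k ≠ 0, (q k : ℂ) * a j k) / d)

/-- The coefficient `C(𝐚_1, i, p, q, c)`. -/
def coeffDwork (d : ℕ) (a : Matrix (Fin n) (Fin m) ℕ) (i : Fin n) (p q : Fin m → ℤ)
    (c : Fin n → ℂ) : ℂ :=
  ((-1) ^ (∑ k with k ≠ 0, p k) * 2 ^ (d - 1) / (a i 0 : ℂ) *
    ∏ j, Complex.sin (Real.pi / d * (c j + ∑ k, (p k : ℂ) * a j k))) *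
  ((-1) ^ n * (-1) ^ (∑ k, q k) /
    (Complex.sin (Real.pi * expDwork d a c q i (.inl 0)) *
      ∏ j with j ≠ i, Complex.sin (Real.pi * expDwork d a c q i (.inr j)))) *
  ((∏ j ∈ Finset.Icc 1 (d - 1),
      Complex.sin (Real.pi / d * (expDwork d a c q i (.inl 0) - p 0 + j))) *
    Complex.exp (((d - 1) * expDwork d a c q i (.inl 0) + p 0) * Real.pi * Complex.I / d))

/-- The group `M = ℤ/d × ⋯ × ℤ × ⋯ × ℤ/d`, with `ℤ = ZMod 0` as its `i`-th factor. -/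
abbrev groupM (n d : ℕ) (i : Fin n) : Type :=
  (j : Fin n) → ZMod (if j = i then 0 else d)

/-- The class in `M` of an integer vector. -/
def classM (d : ℕ) (i : Fin n) (v : Fin n → ℤ) : groupM n d i := fun j => (v j : ZMod _)

/-- The vector `q = (t_1, p_2 + t_2 d, …, p_m + t_m d)`. -/
def qVec (d : ℕ) (p t : Fin m → ℤ) : Fin m → ℤ :=
  fun k => if k = 0 then t 0 else p k + t k * d

/-- The map `h : t ↦ t_1 d 𝐞_i + ∑_{k ≥ 2} (p_k + t_k d) 𝐚_k` from `ℤ^m` to `M_1 = M / ℤ 𝐚_1`. -/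
def mapH (d : ℕ) (a : Matrix (Fin n) (Fin m) ℕ) (p : Fin m → ℤ) (i : Fin n) (t : Fin m → ℤ) :
    groupM n d i ⧸ AddSubgroup.zmultiples (classM d i fun j => (a j 0 : ℤ)) :=
  QuotientAddGroup.mk (classM d i fun j =>
    (if j = i then t 0 * d else 0) + ∑ k with k ≠ 0, (p k + t k * d) * (a j k : ℤ))

/-- For every `i` with `a_{i1} ≠ 0`, the set `R i ⊆ ℤ^m` contains exactly one element of each
(nonempty) fibre of `h`. -/
def IsRepSystem (d : ℕ) (a : Matrix (Fin n) (Fin m) ℕ) (p : Fin m → ℤ)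
    (R : Fin n → Finset (Fin m → ℤ)) : Prop :=
  ∀ i, a i 0 ≠ 0 → Set.BijOn (mapH d a p i) (R i) (Set.range (mapH d a p i))

/-- `∑_{i, a_{i1} ≠ 0} ∑_r C(𝐚_1, i, p, q_r, c) φ(γ^c_{q_r}(𝐚_1, i); z)` at `z = exp x`. -/
def continuedSeries (d : ℕ) (a : Matrix (Fin n) (Fin m) ℕ) (p : Fin m → ℤ)
    (R : Fin n → Finset (Fin m → ℤ)) (c : Fin n → ℂ) (x : Fin m ⊕ Fin n → ℂ) : ℂ :=
  ∑ i with a i 0 ≠ 0, ∑ t ∈ R i, coeffDwork d a i p (qVec d p t) c *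
    gammaSeries (fermatA d a) (expDwork d a c (qVec d p t) i) x

end Fermat

end

end DworkGKZ

open DworkGKZ

/-!
The continuation is carried out by a Mellin–Barnes integral in one variable. By the hypothesis on
the basis, `L_A` is parametrized by `t = (t_1, t')`, and for fixed `t' = (t_2, …, t_m)` the terms of
`φ(γ^c_p; z)` are the residues, at the points `s = p_1 + d t_1`, of a kernel `mbKernel`: the factors
`1 / Γ(1 - u_j)`, where `u_j = (c_j + s a_{j1} + ∑_{k ≥ 2} (p_k + t_k d) a_{jk}) / d`, are replaced
by `Γ(u_j) sin (π u_j) / π` with the sine evaluated at `s = p_1` (it only changes by a sign from one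
residue point to the next), and the remaining trigonometric factor, proportional to
`exp (π √-1 (d - 1) s / d) / sin (π (s - p_1) / d)`, supplies the poles. This kernel decays
exponentially in vertical directions as long as `z_1` is close to the ray of argument `-π (d - 1) / d`
(`exists_norm_mbGamma_le` and `exists_isLarge`; the key fact is that `|Γ(u)| / Γ(Re u)` is
supermultiplicative, by the Beta integral). Along the path `dworkPath`, which runs on this ray from
`|z_1| = exp (-T)` to `|z_1| = exp T` with `z_2, …, z_m` small, the function `mbFun`, which consists
of finitely many slices of the series and of the sum over `t'` of the integrals over a line
`Re s = mbLine d p_1 N`, is therefore analytic in `z` and jointly continuous in `(c, z)`.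

* Near the start, moving the line to the right collects the residues at `p_1 + d t_1`, and `mbFun`
  is the Gamma series (`mbFun_eq_gammaSeries`). This holds for every `c`.
* Near the end, moving the line to the left collects the poles of the factors `Γ(u_i)`,
  `a_{i1} ≠ 0`, which are simple when `c` is very generic. The residue is the term of `(*)` with the
  coefficient `C(𝐚_1, i, p, q, c)` (`tendsto_residue_dwork`, a calculation with the reflection
  formula and the multiplication formula of the sine). The poles of `Γ(u_i)`, for all `t'`, are the
  pairs of a fibre of `h` and an element of `L_A`, and the coefficient is constant on the fibres
  (`mapH_eq_iff`, `coeffDwork_add`). So `mbFun` is the expression `(*)`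
  (`mbFun_eq_continuedSeries`).

That the integrals over the moving lines tend to zero follows from the recursion of the kernel under
`s ↦ s + d`, whose coefficient is a rational function of degree `0` times `z_1 ^ d ∏ z_{m+j} ^ (-a_{j1})`.
The limit statement for arbitrary `c` is the joint continuity of `mbFun` on a compact
neighbourhood of the end point. The statement on `S(w)` is elementary: for a linear form `ν` as
in the definition of a cell, some `i` with `a_{i1} ≠ 0` has `d ν_i < w_{m+i}` by the first inequality,
and by the other ones the cell contains none of `2, …, m`, so that it lies in `σ_i`
(`maximalCells_eq_cellsDwork`).
-/

/-! ### Estimates for the Gamma function -/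

/-- `(u⁻)! / (u⁺)!`: the size of `1 / Γ(1 + u)` up to factors of geometric growth, with the zeros
at the negative integers ignored. -/
noncomputable def factWeight (u : ℤ) : ℝ := ((-u).toNat.factorial : ℝ) / (u.toNat.factorial : ℝ)

lemma factWeight_nonneg (u : ℤ) : 0 ≤ factWeight u := by unfold factWeight; positivity

lemma factorial_add_le (a b : ℕ) : (a + b).factorial ≤ 2 ^ (a + b) * (a.factorial * b.factorial) := by
  rw [← Nat.add_choose_mul_factorial_mul_factorial a b, mul_assoc]
  exact Nat.mul_le_mul_right _ (Nat.choose_le_two_pow _ _)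

lemma factorial_shift_le (r : ℕ) (N : ℤ) (h : 0 ≤ r + N) :
    ((r + N).toNat.factorial : ℝ) ≤ (r.factorial * 2 ^ r) * 2 ^ N.natAbs * factWeight (-N) := by
  unfold factWeight
  obtain ⟨k, rfl | rfl⟩ := N.eq_nat_or_neg
  · have := factorial_add_le r k
    have h2 : ((r + k).factorial : ℝ) ≤ 2 ^ (r + k) * (r.factorial * k.factorial) := by
      exact_mod_cast this
    have e : ((r : ℤ) + k).toNat = r + k := by omega
    simp only [e, neg_neg, Int.toNat_natCast, Int.natAbs_natCast]
    have e2 : (-(k : ℤ)).toNat = 0 := by omega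
    rw [e2]
    simp only [Nat.factorial_zero, Nat.cast_one, div_one]
    calc _ ≤ _ := h2
      _ = _ := by rw [pow_add]; ring
  · have hk : k ≤ r := by omega
    have e : ((r : ℤ) + -k).toNat = r - k := by omega
    have e2 : (-(- -(k : ℤ))).toNat = 0 := by omega
    have e3 : (- -(k : ℤ)).toNat = k := by omega
    rw [e, e2, e3]
    simp only [Nat.factorial_zero, Nat.cast_one, Int.natAbs_neg, Int.natAbs_natCast, one_div]
    rw [← div_eq_mul_inv, le_div_iff₀ (by positivity)]
    have h1 : k.factorial * (r - k).factorial ≤ r.factorial :=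
      Nat.le_of_dvd (Nat.factorial_pos _) (Nat.factorial_mul_factorial_dvd_factorial hk)
    have h2 : ((r - k).factorial : ℝ) * k.factorial ≤ r.factorial := by
      rw [mul_comm]; exact_mod_cast h1
    have h3 : (1 : ℝ) ≤ 2 ^ r * 2 ^ k := one_le_mul_of_one_le_of_one_le
      (one_le_pow₀ (by norm_num)) (one_le_pow₀ (by norm_num))
    calc _ ≤ (r.factorial : ℝ) := h2
      _ ≤ r.factorial * (2 ^ r * 2 ^ k) := le_mul_of_one_le_right (by positivity) h3
      _ = _ := by ring

lemma factorial_sum_le {J : Type*} (S : Finset J) (f : J → ℕ) :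
    (∑ j ∈ S, f j).factorial ≤ (2 ^ S.card) ^ (∑ j ∈ S, f j) * ∏ j ∈ S, (f j).factorial := by
  classical
  induction S using Finset.induction_on with
  | empty => simp
  | insert a S ha ih =>
    rw [Finset.sum_insert ha, Finset.prod_insert ha, Finset.card_insert_of_notMem ha]
    calc _ ≤ _ := factorial_add_le _ _
      _ ≤ 2 ^ (f a + ∑ j ∈ S, f j) * ((f a).factorial *
          ((2 ^ S.card) ^ (f a + ∑ j ∈ S, f j) * ∏ j ∈ S, (f j).factorial)) := by
          gcongr
          refine ih.trans ?_
          gcongr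
          · exact Nat.one_le_two_pow
          · omega
      _ = _ := by rw [pow_succ, mul_pow]; ring

/-- The multinomial theorem bounds the weights of an integer vector with coordinate sum zero by a
geometric factor. -/
lemma prod_factWeight_le {J : Type*} [Fintype J] (u : J → ℤ) (hu : ∑ j, u j = 0) :
    ∏ j, factWeight (u j) ≤ (2 ^ Fintype.card J) ^ (∑ j, (u j).natAbs) := by
  unfold factWeight
  rw [Finset.prod_div_distrib]
  have hsum : ∑ j, (-u j).toNat = ∑ j, (u j).toNat := by
    have h : ∑ j, ((u j).toNat : ℤ) - ∑ j, ((-u j).toNat : ℤ) = ∑ j, u j := by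
      rw [← Finset.sum_sub_distrib]
      exact Finset.sum_congr rfl fun j _ => by omega
    rw [hu] at h
    have : (∑ j, ((-u j).toNat : ℤ)) = ∑ j, ((u j).toNat : ℤ) := by linarith
    exact_mod_cast this
  rw [div_le_iff₀ (by positivity)]
  have h1 : ∏ j, (-u j).toNat.factorial ≤ (∑ j, (-u j).toNat).factorial :=
    Nat.le_of_dvd (Nat.factorial_pos _) (Nat.prod_factorial_dvd_factorial_sum _ _)
  rw [hsum] at h1
  have h2 := h1.trans (factorial_sum_le Finset.univ fun j => (u j).toNat)
  have h3 : ∏ j, (-u j).toNat.factorial ≤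
      (2 ^ Fintype.card J) ^ (∑ j, (u j).natAbs) * ∏ j, (u j).toNat.factorial := by
    refine h2.trans ?_
    rw [Finset.card_univ]
    gcongr
    · exact Nat.one_le_two_pow
    · omega
  exact_mod_cast h3

lemma inv_Gamma_eq (z : ℂ) : (Complex.Gamma z)⁻¹ = z * (Complex.Gamma (z + 1))⁻¹ :=
  Complex.one_div_Gamma_eq_self_mul_one_div_Gamma_add_one z

lemma exists_norm_inv_Gamma_le (R : ℝ) :
    ∃ C > 0, ∀ z : ℂ, ‖z‖ ≤ R → ‖(Complex.Gamma z)⁻¹‖ ≤ C := by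
  have hc : ContinuousOn (fun z : ℂ => (Complex.Gamma z)⁻¹) (Metric.closedBall 0 R) :=
    Complex.differentiable_one_div_Gamma.continuous.continuousOn
  obtain ⟨C, hC⟩ := (isCompact_closedBall (0 : ℂ) R).exists_bound_of_continuousOn hc
  exact ⟨max C 1, by positivity, fun z hz => (hC z (by simpa using hz)).trans (le_max_left _ _)⟩

/-- The values of `1 / Γ` at integral translates of a bounded set. -/
lemma exists_norm_inv_Gamma_add_int_le (ρ : ℝ) :
    ∃ C > 0, ∀ γ : ℂ, ‖γ‖ ≤ ρ → ∀ u : ℤ,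
      ‖(Complex.Gamma (1 + u + γ))⁻¹‖ ≤ C * 2 ^ u.natAbs * factWeight u := by
  obtain ⟨r, hr⟩ := exists_nat_ge ρ
  obtain ⟨C, hC0, hC⟩ := exists_norm_inv_Gamma_le (1 + (r + r))
  have up : ∀ γ : ℂ, 0 ≤ γ.re → ‖γ‖ ≤ r + r → ∀ U : ℕ,
      ‖(Complex.Gamma (1 + U + γ))⁻¹‖ ≤ C / U.factorial := by
    intro γ h0 h1 U
    induction U with
    | zero =>
      simp only [Nat.cast_zero, add_zero, Nat.factorial_zero, Nat.cast_one, div_one]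
      refine hC _ ((norm_add_le _ _).trans ?_)
      simpa using h1
    | succ U ih =>
      have hz : (U : ℝ) + 1 ≤ ‖1 + (U : ℂ) + γ‖ := by
        refine le_trans ?_ (Complex.re_le_norm _)
        simp; linarith
      have e := inv_Gamma_eq (1 + U + γ)
      rw [e, norm_mul] at ih
      have e2 : 1 + ((U + 1 : ℕ) : ℂ) + γ = 1 + U + γ + 1 := by push_cast; ring
      rw [e2, Nat.factorial_succ, Nat.cast_mul, ← div_div, div_right_comm, le_div_iff₀ (by positivity)]
      refine le_trans ?_ ih
      rw [mul_comm, Nat.cast_succ]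
      gcongr
  have down : ∀ γ : ℂ, ‖γ‖ ≤ r + r → ∀ k : ℕ,
      ‖(Complex.Gamma (1 - k + γ))⁻¹‖ ≤ C * (r + r + k).factorial := by
    intro γ h1 k
    induction k with
    | zero =>
      simp only [Nat.cast_zero, sub_zero, add_zero]
      refine (hC _ ((norm_add_le _ _).trans (by simpa using h1))).trans ?_
      refine le_mul_of_one_le_right hC0.le ?_
      exact_mod_cast Nat.succ_le_of_lt (Nat.factorial_pos _)
    | succ k ih =>
      have e2 : 1 - ((k + 1 : ℕ) : ℂ) + γ = γ - k := by push_cast; ring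
      rw [e2, inv_Gamma_eq, norm_mul]
      have e3 : γ - k + 1 = 1 - k + γ := by ring
      rw [e3, ← add_assoc, Nat.factorial_succ, Nat.cast_mul, mul_left_comm]
      refine mul_le_mul ?_ ih (norm_nonneg _) (by positivity)
      refine (norm_sub_le _ _).trans ?_
      simp only [Complex.norm_natCast]
      push_cast
      linarith
  refine ⟨C * (r.factorial) + C * ((r + r + r).factorial * 2 ^ (r + r + r)), by positivity,
    fun γ hγ u => ?_⟩
  rw [add_mul, add_mul]
  have hn : ‖γ + r‖ ≤ r + r := (norm_add_le _ _).trans (by simp; linarith)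
  have n1 := factWeight_nonneg u
  rcases le_total (r : ℤ) u with h | h
  · refine le_add_of_le_of_nonneg ?_ (by positivity)
    obtain ⟨U, rfl⟩ := Int.eq_ofNat_of_zero_le (sub_nonneg.2 h) |>.imp fun U hU =>
      (sub_eq_iff_eq_add.1 hU)
    have e : (1 : ℂ) + (((U : ℤ) + (r : ℤ) : ℤ) : ℂ) + γ = 1 + U + (γ + r) := by push_cast; ring
    rw [e]
    have hre : 0 ≤ (γ + r).re := by
      have := (abs_le.1 (Complex.abs_re_le_norm γ)).1
      simp; linarith
    refine (up _ hre hn U).trans ?_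
    unfold factWeight
    have e1 : (-((U : ℤ) + r)).toNat = 0 := by omega
    have e2 : ((U : ℤ) + r).toNat = U + r := by omega
    have e3 : ((U : ℤ) + r).natAbs = U + r := by omega
    rw [e1, e2, e3, Nat.factorial_zero, Nat.cast_one, mul_one_div, div_le_div_iff₀ (by positivity)
      (by positivity)]
    have := factorial_add_le U r
    have h2 : ((U + r).factorial : ℝ) ≤ 2 ^ (U + r) * (U.factorial * r.factorial) := by
      exact_mod_cast this
    calc C * ((U + r).factorial : ℝ) ≤ C * (2 ^ (U + r) * (U.factorial * r.factorial)) := by gcongr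
      _ = _ := by ring
  · refine le_add_of_nonneg_of_le (by positivity) ?_
    obtain ⟨k, hk⟩ := Int.eq_ofNat_of_zero_le (sub_nonneg.2 h)
    have hu : u = r - k := by omega
    have e : (1 : ℂ) + (u : ℂ) + γ = 1 - k + (γ + r) := by rw [hu]; push_cast; ring
    rw [e]
    refine (down _ hn k).trans ?_
    have := factorial_shift_le (r + r + r) (-u) (by push_cast; omega)
    have e2 : (((r + r + r : ℕ) : ℤ) + -u).toNat = r + r + k := by omega
    rw [e2, neg_neg, Int.natAbs_neg] at this
    calc _ ≤ C * _ := mul_le_mul_of_nonneg_left this hC0.le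
      _ = _ := by ring

/-- The values of `Γ` at integral translates of a bounded set, to the right of a positive bound. -/
lemma exists_Gamma_add_int_le (b B : ℝ) (hb : 0 < b) :
    ∃ C > 0, ∀ β : ℝ, |β| ≤ B → ∀ N : ℤ, b ≤ β + N →
      Real.Gamma (β + N) ≤ C * 2 ^ N.natAbs * factWeight (-N) := by
  obtain ⟨r, hr⟩ := exists_nat_ge (B + 2)
  refine ⟨(b * (b + 1))⁻¹ * (r.factorial * 2 ^ r), by positivity, fun β hβ N hN => ?_⟩
  have hx : 0 < β + N := hb.trans_le hN
  have h1 : Real.Gamma (β + N + 1 + 1) = (β + N + 1) * ((β + N) * Real.Gamma (β + N)) := by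
    rw [Real.Gamma_add_one (by positivity), Real.Gamma_add_one hx.ne']
  have hβ' := (abs_le.1 hβ).2
  have hle : β + N + 1 + 1 ≤ r + N := by linarith
  have hpos : (0 : ℤ) ≤ r + N := by
    have : (0 : ℝ) ≤ ((r + N : ℤ) : ℝ) := by push_cast; linarith
    exact_mod_cast this
  have h2 : Real.Gamma (β + N + 1 + 1) ≤ Real.Gamma (r + N) :=
    Real.Gamma_strictMonoOn_Ici.monotoneOn (by simp; linarith) (by simp; linarith) hle
  obtain ⟨k, hk⟩ := Int.eq_ofNat_of_zero_le hpos
  have h3 : Real.Gamma (r + N) ≤ ((r + N : ℤ).toNat.factorial : ℝ) := by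
    have e : (r : ℝ) + N = k := by exact_mod_cast hk
    rw [e, hk]
    have hk2 : (2 : ℝ) ≤ k := by rw [← e]; linarith
    have hk3 : 2 ≤ k := by exact_mod_cast hk2
    obtain ⟨l, rfl⟩ : ∃ l, k = l + 1 := ⟨k - 1, by omega⟩
    rw [Nat.cast_succ, Real.Gamma_nat_eq_factorial]
    simp only [Int.toNat_natCast]
    exact_mod_cast Nat.factorial_le (by omega)
  have h4 := factorial_shift_le r N hpos
  have hG := (Real.Gamma_pos_of_pos hx).le
  have h5 : b * (b + 1) * Real.Gamma (β + N) ≤ Real.Gamma (β + N + 1 + 1) := by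
    rw [h1, ← mul_assoc]
    refine mul_le_mul_of_nonneg_right ?_ hG
    rw [mul_comm]
    gcongr
  rw [mul_assoc, mul_assoc, inv_mul_eq_div, le_div_iff₀ (by positivity), mul_comm]
  refine (h5.trans (h2.trans (h3.trans h4))).trans_eq (by ring)

/-- `|Γ(u)| / Γ(Re u)`. -/
noncomputable def gammaRatio (u : ℂ) : ℝ := ‖Complex.Gamma u‖ / Real.Gamma u.re

lemma gammaRatio_nonneg {u : ℂ} (hu : 0 < u.re) : 0 ≤ gammaRatio u :=
  div_nonneg (norm_nonneg _) (Real.Gamma_pos_of_pos hu).le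

lemma norm_betaIntegral_le (u v : ℂ) :
    ‖Complex.betaIntegral u v‖ ≤ ‖Complex.betaIntegral u.re v.re‖ := by
  have e : Complex.betaIntegral u.re v.re =
      ((∫ x : ℝ in (0 : ℝ)..1, x ^ (u.re - 1) * (1 - x) ^ (v.re - 1) : ℝ) : ℂ) := by
    unfold Complex.betaIntegral
    rw [← intervalIntegral.integral_ofReal]
    refine intervalIntegral.integral_congr fun x hx => ?_
    rw [Set.uIcc_of_le zero_le_one] at hx
    rw [Complex.ofReal_mul, Complex.ofReal_cpow hx.1, Complex.ofReal_cpow (by linarith [hx.2])]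
    push_cast; rfl
  have hnn : 0 ≤ ∫ x : ℝ in (0 : ℝ)..1, x ^ (u.re - 1) * (1 - x) ^ (v.re - 1) :=
    intervalIntegral.integral_nonneg zero_le_one fun x hx => mul_nonneg
      (Real.rpow_nonneg hx.1 _) (Real.rpow_nonneg (by linarith [hx.2]) _)
  rw [e, Complex.norm_real, Real.norm_of_nonneg hnn]
  unfold Complex.betaIntegral
  refine (intervalIntegral.norm_integral_le_integral_norm zero_le_one).trans_eq ?_
  refine intervalIntegral.integral_congr_ae ?_
  have h1 : ∀ᵐ x : ℝ, x ≠ 1 := by simp [MeasureTheory.ae_iff]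
  filter_upwards [h1] with x hx1 hx
  rw [Set.uIoc_of_le zero_le_one] at hx
  have hx2 : 0 < 1 - x := sub_pos.2 (lt_of_le_of_ne hx.2 hx1)
  rw [norm_mul]
  congr 1
  · rw [Complex.norm_cpow_eq_rpow_re_of_pos hx.1]; simp
  · have := Complex.norm_cpow_eq_rpow_re_of_pos hx2 (v - 1)
    push_cast at this
    rw [this]; simp

/-- The absolute value of Euler's Beta integral is at most its value at the real parts. -/
lemma gammaRatio_mul_le {u v : ℂ} (hu : 0 < u.re) (hv : 0 < v.re) :
    gammaRatio u * gammaRatio v ≤ gammaRatio (u + v) := by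
  have hb := norm_betaIntegral_le u v
  have h1 := Complex.Gamma_mul_Gamma_eq_betaIntegral hu hv
  have h2 := Complex.Gamma_mul_Gamma_eq_betaIntegral (s := u.re) (t := v.re) (by simpa) (by simpa)
  have n1 := congrArg norm h1
  have n2 := congrArg norm h2
  have pu := Real.Gamma_pos_of_pos hu
  have pv := Real.Gamma_pos_of_pos hv
  have puv := Real.Gamma_pos_of_pos (add_pos hu hv)
  simp only [← Complex.ofReal_add, Complex.Gamma_ofReal, norm_mul, Complex.norm_real,
    Real.norm_of_nonneg pu.le, Real.norm_of_nonneg pv.le, Real.norm_of_nonneg puv.le] at n1 n2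
  unfold gammaRatio
  rw [div_mul_div_comm, n1, n2, Complex.add_re, mul_div_mul_comm]
  refine mul_le_of_le_one_right (by positivity) (div_le_one_of_le₀ hb (norm_nonneg _))

lemma prod_gammaRatio_le {ι : Type*} (S : Finset ι) (hS : S.Nonempty) (u : ι → ℂ)
    (hu : ∀ j ∈ S, 0 < (u j).re) :
    ∏ j ∈ S, gammaRatio (u j) ≤ gammaRatio (∑ j ∈ S, u j) := by
  classical
  induction hS using Finset.Nonempty.cons_induction with
  | singleton a => simp
  | cons a S ha hS ih =>
    rw [Finset.prod_cons, Finset.sum_cons]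
    have h0 := hu a (Finset.mem_cons_self _ _)
    have h1 : ∀ j ∈ S, 0 < (u j).re := fun j hj => hu j (Finset.mem_cons_of_mem hj)
    refine (mul_le_mul_of_nonneg_left (ih h1) (gammaRatio_nonneg h0)).trans
      (gammaRatio_mul_le h0 ?_)
    rw [Complex.re_sum]
    exact Finset.sum_pos h1 hS

lemma gammaRatio_add_nat_le {w : ℂ} (hw : 1 ≤ w.re) (M : ℕ) :
    gammaRatio (w + M) ≤ gammaRatio w * ∏ i ∈ Finset.range M, (1 + |w.im| / (1 + i)) := by
  induction M with
  | zero => simp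
  | succ M ih =>
    have hre : (w + M).re = w.re + M := by simp
    have hp : 0 < (w + M).re := by rw [hre]; positivity
    have hne : w + M ≠ 0 := fun h => by rw [h] at hp; simp at hp
    have key : gammaRatio (w + (M + 1 : ℕ)) ≤ gammaRatio (w + M) * (1 + |w.im| / (1 + M)) := by
      unfold gammaRatio
      have e : w + ((M + 1 : ℕ) : ℂ) = (w + M) + 1 := by push_cast; ring
      have e2 : (w + M + 1).re = (w + M).re + 1 := by simp
      rw [e, e2, Complex.Gamma_add_one _ hne, Real.Gamma_add_one hp.ne', norm_mul,
        mul_div_mul_comm, mul_comm]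
      refine mul_le_mul_of_nonneg_left ?_ (gammaRatio_nonneg hp)
      rw [div_le_iff₀ hp]
      refine (Complex.norm_le_abs_re_add_abs_im _).trans ?_
      rw [abs_of_pos hp, add_mul, one_mul]
      have : (w + M).im = w.im := by simp
      rw [this, div_mul_eq_mul_div]
      gcongr
      rw [le_div_iff₀ (by positivity)]
      refine mul_le_mul_of_nonneg_left ?_ (abs_nonneg _)
      rw [hre]; linarith
    rw [Finset.prod_range_succ, ← mul_assoc]
    exact key.trans (mul_le_mul_of_nonneg_right ih (by positivity))

/-- By the binomial theorem, the product `(1 + y) (1 + y / 2) ⋯ (1 + y / M)` has an arbitrarily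
small exponential rate in `y`, at the price of a geometric factor in `M`. -/
lemma exists_prod_one_add_div_le (η : ℝ) (hη : 0 < η) :
    ∃ A ≥ 1, ∀ (M : ℕ) (y : ℝ), 0 ≤ y →
      ∏ i ∈ Finset.range M, (1 + y / (1 + i)) ≤ A * A ^ M * Real.exp (η * y) := by
  set q := Real.exp (-η) with hq
  have hq0 : 0 < q := Real.exp_pos _
  have hq1 : q < 1 := by rw [hq]; exact Real.exp_lt_one_iff.2 (by linarith)
  have hε : 0 < 1 - q := by linarith
  refine ⟨max (Real.exp η) (1 - q)⁻¹, le_max_of_le_left (Real.one_le_exp hη.le), fun M y hy => ?_⟩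
  set Y := ⌈y⌉₊
  have hY : y ≤ Y := Nat.le_ceil y
  have hY2 : (Y : ℝ) ≤ y + 1 := (Nat.ceil_lt_add_one hy).le
  have h1 : ∏ i ∈ Finset.range M, (1 + y / (1 + i)) ≤ ((M + Y).choose M : ℝ) := by
    have h2 : ∏ i ∈ Finset.range M, (1 + y / (1 + i)) ≤
        ∏ i ∈ Finset.range M, (1 + (Y : ℝ) / (1 + i)) := by
      refine Finset.prod_le_prod (fun i _ => by positivity) fun i _ => ?_
      gcongr
    refine h2.trans_eq ?_
    induction M with
    | zero => simp
    | succ M ih =>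
      rw [Finset.prod_range_succ, ih (Finset.prod_le_prod (fun i _ => by positivity)
        fun i _ => by gcongr)]
      have := Nat.add_one_mul_choose_eq (M + Y) M
      have h3 : ((M + Y + 1 : ℕ) : ℝ) * (M + Y).choose M = (M + Y + 1).choose (M + 1) * (M + 1 : ℕ) := by
        exact_mod_cast this
      have e : M + 1 + Y = M + Y + 1 := by ring
      rw [e]
      field_simp
      push_cast at h3
      linear_combination h3
  have h2 : ((M + Y).choose M : ℝ) * ((1 - q) ^ M * q ^ Y) ≤ 1 := by
    have h3 := add_pow (1 - q) q (M + Y)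
    rw [sub_add_cancel, one_pow] at h3
    have := Finset.single_le_sum (f := fun k => (1 - q) ^ k * q ^ (M + Y - k) * ((M + Y).choose k : ℝ))
      (s := Finset.range (M + Y + 1)) (fun i _ => by positivity) (Finset.mem_range.2 (by omega : M < M + Y + 1))
    rw [← h3] at this
    refine le_trans (le_of_eq ?_) this
    simp only [Nat.add_sub_cancel_left]
    ring
  have h3 : ((M + Y).choose M : ℝ) ≤ (1 - q)⁻¹ ^ M * Real.exp (η * Y) := by
    have e : Real.exp (η * Y) = (q ^ Y)⁻¹ := by
      rw [hq, ← Real.exp_nat_mul, ← Real.exp_neg]; congr 1; ring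
    rw [e, inv_pow, ← mul_inv, ← one_div, le_div_iff₀ (by positivity)]
    exact h2
  refine h1.trans (h3.trans ?_)
  have h4 : Real.exp (η * Y) ≤ Real.exp η * Real.exp (η * y) := by
    rw [← Real.exp_add]
    refine Real.exp_le_exp.2 ?_
    nlinarith
  calc (1 - q)⁻¹ ^ M * Real.exp (η * Y) ≤ (max (Real.exp η) (1 - q)⁻¹) ^ M *
        (max (Real.exp η) (1 - q)⁻¹ * Real.exp (η * y)) := by
        refine mul_le_mul ?_ (h4.trans ?_) (Real.exp_pos _).le (by positivity)
        · exact pow_le_pow_left₀ (by positivity) (le_max_right _ _) _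
        · exact mul_le_mul_of_nonneg_right (le_max_left _ _) (Real.exp_pos _).le
    _ = _ := by ring

/-- The quotient of a product of Gamma functions by one Gamma function of the same total argument
has an arbitrarily small exponential rate along vertical lines, uniformly in a further integral
translation by `M`. -/
lemma prod_norm_Gamma_mul_le {ι : Type*} {η A : ℝ}
    (hA : ∀ (M : ℕ) (y : ℝ), 0 ≤ y →
      ∏ i ∈ Finset.range M, (1 + y / (1 + i)) ≤ A * A ^ M * Real.exp (η * y))
    (S : Finset ι) (hS : S.Nonempty) (u : ι → ℂ) (hu : ∀ j ∈ S, 0 < (u j).re)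
    (X s : ℂ) (M : ℕ) (hsum : ∑ j ∈ S, u j = X + s + M) (hX : X.re < 1) (hXs : 1 ≤ X.re + s.re) :
    (∏ j ∈ S, ‖Complex.Gamma (u j)‖) * ‖(Complex.Gamma (1 + s))⁻¹‖ ≤
      (∏ j ∈ S, Real.Gamma (u j).re) * (A * A ^ M * Real.exp (η * |X.im + s.im|)) *
        (Real.Gamma (1 - X.re) * ‖(Complex.Gamma (1 - X))⁻¹‖ * (Real.Gamma (1 + s.re))⁻¹) := by
  have h1 := prod_gammaRatio_le S hS u hu
  have hXs' : 1 ≤ (X + s).re := by simpa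
  have h2 := gammaRatio_add_nat_le hXs' M
  have h3 := hA M |(X + s).im| (abs_nonneg _)
  have hXre : 0 < (1 - X).re := by simpa
  have h4 := gammaRatio_mul_le (u := X + s) (v := 1 - X) (by linarith) hXre
  have e : X + s + (1 - X) = 1 + s := by ring
  rw [e] at h4
  have e5 : ∏ j ∈ S, ‖Complex.Gamma (u j)‖ =
      (∏ j ∈ S, gammaRatio (u j)) * ∏ j ∈ S, Real.Gamma (u j).re := by
    rw [← Finset.prod_mul_distrib]
    refine Finset.prod_congr rfl fun j hj => ?_
    unfold gammaRatio
    rw [div_mul_cancel₀ _ (Real.Gamma_pos_of_pos (hu j hj)).ne']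
  have hpr : 0 ≤ ∏ j ∈ S, Real.Gamma (u j).re :=
    Finset.prod_nonneg fun j hj => (Real.Gamma_pos_of_pos (hu j hj)).le
  have hs : 0 < (1 + s).re := by simp; linarith
  have hg1 : 0 < ‖Complex.Gamma (1 + s)‖ := norm_pos_iff.2 (Complex.Gamma_ne_zero_of_re_pos hs)
  have hg2 : 0 < ‖Complex.Gamma (1 - X)‖ := norm_pos_iff.2 (Complex.Gamma_ne_zero_of_re_pos hXre)
  have hg3 := Real.Gamma_pos_of_pos hXre
  have hg4 := Real.Gamma_pos_of_pos hs
  have h6 : gammaRatio (X + s) * ‖(Complex.Gamma (1 + s))⁻¹‖ ≤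
      Real.Gamma (1 - X.re) * ‖(Complex.Gamma (1 - X))⁻¹‖ * (Real.Gamma (1 + s.re))⁻¹ := by
    have r1 : gammaRatio (1 - X) = ‖Complex.Gamma (1 - X)‖ / Real.Gamma (1 - X.re) := by
      simp [gammaRatio]
    have r2 : gammaRatio (1 + s) = ‖Complex.Gamma (1 + s)‖ / Real.Gamma (1 + s.re) := by
      simp [gammaRatio]
    have q3 : 0 < Real.Gamma (1 - X.re) := by simpa using hg3
    have q4 : 0 < Real.Gamma (1 + s.re) := by simpa using hg4
    rw [r1, r2, mul_div_assoc', div_le_div_iff₀ q3 q4] at h4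
    rw [norm_inv, norm_inv, ← div_eq_mul_inv, ← div_eq_mul_inv, ← div_eq_mul_inv, div_div,
      div_le_div_iff₀ hg1 (by positivity)]
    linarith
  have h7 : ∏ j ∈ S, gammaRatio (u j) ≤
      gammaRatio (X + s) * (A * A ^ M * Real.exp (η * |X.im + s.im|)) := by
    rw [hsum] at h1
    refine h1.trans (h2.trans (mul_le_mul_of_nonneg_left h3 (gammaRatio_nonneg (by linarith))))
  have hE : 0 ≤ A * A ^ M * Real.exp (η * |X.im + s.im|) :=
    le_trans (by positivity) h3
  rw [e5]
  calc _ ≤ (gammaRatio (X + s) * (A * A ^ M * Real.exp (η * |X.im + s.im|))) *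
        (∏ j ∈ S, Real.Gamma (u j).re) * ‖(Complex.Gamma (1 + s))⁻¹‖ := by gcongr
    _ = (∏ j ∈ S, Real.Gamma (u j).re) * (A * A ^ M * Real.exp (η * |X.im + s.im|)) *
        (gammaRatio (X + s) * ‖(Complex.Gamma (1 + s))⁻¹‖) := by ring
    _ ≤ _ := mul_le_mul_of_nonneg_left h6 (mul_nonneg hpr hE)

/-! ### Residues in a vertical strip -/

open MeasureTheory in
lemma integrable_exp_neg_mul_abs {δ : ℝ} (hδ : 0 < δ) :
    Integrable (fun y : ℝ => Real.exp (-(δ * |y|))) := by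
  rw [← integrableOn_univ, ← Set.Iic_union_Ioi (a := (0 : ℝ))]
  refine IntegrableOn.union ?_ ?_
  · refine (integrableOn_exp_mul_Iic hδ 0).congr_fun (fun y hy => ?_) measurableSet_Iic
    simp only [abs_of_nonpos (Set.mem_Iic.1 hy)]; congr 1; ring
  · refine (exp_neg_integrableOn_Ioi 0 hδ).congr_fun (fun y hy => ?_) measurableSet_Ioi
    simp only [abs_of_pos (Set.mem_Ioi.1 hy)]; congr 1; ring

open MeasureTheory in
lemma integrable_of_norm_le_exp {f : ℝ → ℂ} (hf : Continuous f) {C δ T : ℝ} (hδ : 0 < δ)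
    (h : ∀ y, T ≤ |y| → ‖f y‖ ≤ C * Real.exp (-(δ * |y|))) : Integrable f := by
  obtain ⟨B, hB⟩ := (isCompact_Icc (a := -T) (b := T)).exists_bound_of_continuousOn hf.continuousOn
  refine Integrable.mono' ((integrable_exp_neg_mul_abs hδ).const_mul
    (|C| + |B| * Real.exp (δ * |T|))) hf.aestronglyMeasurable (Eventually.of_forall fun y => ?_)
  rcases le_total T |y| with hy | hy
  · refine (h y hy).trans (mul_le_mul_of_nonneg_right ?_ (Real.exp_pos _).le)
    exact (le_abs_self C).trans (le_add_of_nonneg_right (by positivity))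
  · refine (hB y (abs_le.1 hy)).trans ((le_abs_self B).trans ?_)
    rw [add_mul]
    refine le_add_of_nonneg_of_le (by positivity) ?_
    rw [mul_assoc, ← Real.exp_add]
    refine le_mul_of_one_le_right (abs_nonneg _) (Real.one_le_exp ?_)
    have := hy.trans (le_abs_self T)
    nlinarith

lemma hasDerivAt_log_line (δ b y : ℝ) (hδ : 0 < δ) :
    HasDerivAt (fun y : ℝ => -Complex.I * Complex.log (δ + (y - b) * Complex.I))
      ((δ + (y - b : ℂ) * Complex.I)⁻¹) y := by
  have h1 : HasDerivAt (fun y : ℝ => (δ : ℂ) + ((y : ℂ) - b) * Complex.I) Complex.I y := by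
    have := (((hasDerivAt_id (y : ℂ)).comp_ofReal.sub_const (b : ℂ)).mul_const Complex.I).const_add
      (δ : ℂ)
    simpa using this
  have h2 := (h1.clog_real (by simp [Complex.mem_slitPlane_iff, hδ])).const_mul (-Complex.I)
  refine h2.congr_deriv ?_
  rw [mul_div_assoc', neg_mul, Complex.I_mul_I, neg_neg, one_div]

lemma tendsto_log_line (δ b : ℝ) (hδ : 0 < δ) :
    Tendsto (fun T : ℝ => Complex.log (δ + (T - b : ℂ) * Complex.I) -
      Complex.log (δ + (-T - b : ℂ) * Complex.I)) atTop (𝓝 (Real.pi * Complex.I)) := by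
  have key : ∀ y : ℝ, Complex.log (δ + y * Complex.I) =
      ((Real.log √(δ ^ 2 + y ^ 2) : ℝ) : ℂ) + (Real.arctan (y / δ) : ℝ) * Complex.I := by
    intro y
    apply Complex.ext
    · rw [Complex.log_re, Complex.norm_def, Complex.normSq_apply]
      simp [-Complex.ofReal_arctan, pow_two]
    · rw [Complex.log_im, Complex.arg_of_re_nonneg (by simpa using hδ.le)]
      simp only [Complex.add_im, Complex.ofReal_im, Complex.mul_im, Complex.ofReal_re,
        Complex.I_im, mul_one, Complex.I_re, mul_zero, add_zero, zero_add]
      rw [Real.arctan_eq_arcsin]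
      congr 1
      have : ‖(δ : ℂ) + y * Complex.I‖ = δ * √(1 + (y / δ) ^ 2) := by
        rw [Complex.norm_def, Complex.normSq_apply]
        simp only [Complex.add_im, Complex.ofReal_im, Complex.mul_im, Complex.ofReal_re,
          Complex.I_im, mul_one, Complex.I_re, mul_zero, add_zero, zero_add, Complex.add_re,
          Complex.mul_re, sub_zero]
        rw [show δ * δ + y * y = δ ^ 2 * (1 + (y / δ) ^ 2) by field_simp,
          Real.sqrt_mul (by positivity), Real.sqrt_sq hδ.le]
      rw [this, div_div]
  have e : ∀ T : ℝ, Complex.log (δ + (T - b : ℂ) * Complex.I) -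
      Complex.log (δ + (-T - b : ℂ) * Complex.I) =
      ((1 / 2 * Real.log ((δ ^ 2 + (T - b) ^ 2) / (δ ^ 2 + (T + b) ^ 2)) : ℝ) : ℂ) +
      ((Real.arctan ((T - b) / δ) + Real.arctan ((T + b) / δ) : ℝ) : ℂ) * Complex.I := by
    intro T
    have k1 := key (T - b)
    have k2 := key (-T - b)
    rw [Complex.ofReal_sub] at k1 k2
    rw [Complex.ofReal_neg] at k2
    rw [k1, k2, Real.log_div (by positivity) (by positivity), Real.log_sqrt (by positivity),
      Real.log_sqrt (by positivity)]
    have e1 : (-T - b) / δ = -((T + b) / δ) := by ring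
    have e2 : (-T - b) ^ 2 = (T + b) ^ 2 := by ring
    rw [e1, e2, Real.arctan_neg]
    rw [← sub_eq_zero, ← Complex.ofReal_zero]
    simp only [Complex.ofReal_add, Complex.ofReal_sub, Complex.ofReal_mul, Complex.ofReal_div,
      Complex.ofReal_neg, Complex.ofReal_one, Complex.ofReal_zero, Complex.ofReal_ofNat]
    ring
  simp_rw [e]
  have t1 : Tendsto (fun T : ℝ => (δ ^ 2 + (T - b) ^ 2) / (δ ^ 2 + (T + b) ^ 2)) atTop (𝓝 1) := by
    have hinv : Tendsto (fun T : ℝ => T⁻¹) atTop (𝓝 0) := tendsto_inv_atTop_zero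
    have : Tendsto (fun T : ℝ => ((δ * T⁻¹) ^ 2 + (1 - b * T⁻¹) ^ 2) /
        ((δ * T⁻¹) ^ 2 + (1 + b * T⁻¹) ^ 2)) atTop (𝓝 (((δ * 0) ^ 2 + (1 - b * 0) ^ 2) /
        ((δ * 0) ^ 2 + (1 + b * 0) ^ 2))) := by
      refine Tendsto.div ?_ ?_ (by norm_num)
      · exact ((hinv.const_mul δ).pow 2).add (((hinv.const_mul b).const_sub 1).pow 2)
      · exact ((hinv.const_mul δ).pow 2).add (((hinv.const_mul b).const_add 1).pow 2)
    norm_num at this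
    refine this.congr' ?_
    filter_upwards [eventually_gt_atTop 0] with T hT
    field_simp
  have t2 : Tendsto (fun T : ℝ => 1 / 2 * Real.log ((δ ^ 2 + (T - b) ^ 2) / (δ ^ 2 + (T + b) ^ 2)))
      atTop (𝓝 0) := by
    have := (t1.log one_ne_zero).const_mul (1 / 2)
    simpa using this
  have a1 : Tendsto (fun T : ℝ => Real.arctan ((T - b) / δ)) atTop (𝓝 (Real.pi / 2)) :=
    (Real.tendsto_arctan_atTop.mono_right nhdsWithin_le_nhds).comp
      ((tendsto_atTop_add_const_right _ (-b) tendsto_id).atTop_div_const hδ)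
  have a2 : Tendsto (fun T : ℝ => Real.arctan ((T + b) / δ)) atTop (𝓝 (Real.pi / 2)) :=
    (Real.tendsto_arctan_atTop.mono_right nhdsWithin_le_nhds).comp
      ((tendsto_atTop_add_const_right _ b tendsto_id).atTop_div_const hδ)
  have t3 := a1.add a2
  rw [add_halves] at t3
  have := ((Complex.continuous_ofReal.tendsto 0).comp t2).add
    (((Complex.continuous_ofReal.tendsto Real.pi).comp t3).mul_const Complex.I)
  simpa [-Complex.ofReal_arctan, Function.comp_def] using this

lemma tendsto_integral_line_inv_of_pos (δ b : ℝ) (hδ : 0 < δ) :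
    Tendsto (fun T : ℝ => ∫ y in (-T)..T, ((δ : ℂ) + (y - b : ℂ) * Complex.I)⁻¹) atTop
      (𝓝 (Real.pi : ℂ)) := by
  have hne : ∀ y : ℝ, (δ : ℂ) + (y - b : ℂ) * Complex.I ≠ 0 := fun y h => by
    have := congrArg Complex.re h
    simp at this; exact hδ.ne' this
  have e : ∀ T : ℝ, ∫ y in (-T)..T, ((δ : ℂ) + (y - b : ℂ) * Complex.I)⁻¹ =
      -Complex.I * (Complex.log (δ + (T - b : ℂ) * Complex.I) -
      Complex.log (δ + (-T - b : ℂ) * Complex.I)) := by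
    intro T
    rw [intervalIntegral.integral_eq_sub_of_hasDerivAt
      (fun y _ => hasDerivAt_log_line δ b y hδ)]
    · push_cast; ring
    · exact (Continuous.inv₀ (by fun_prop) hne).intervalIntegrable _ _
  simp_rw [e]
  have := (tendsto_log_line δ b hδ).const_mul (-Complex.I)
  convert this using 2
  linear_combination (Real.pi : ℂ) * Complex.I_mul_I

lemma tendsto_integral_line_inv (σ : ℝ) (p : ℂ) (h : σ ≠ p.re) :
    Tendsto (fun T : ℝ => ∫ y in (-T)..T, ((σ : ℂ) + y * Complex.I - p)⁻¹) atTop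
      (𝓝 (if p.re < σ then (Real.pi : ℂ) else -Real.pi)) := by
  split_ifs with hlt
  · have := tendsto_integral_line_inv_of_pos (σ - p.re) p.im (by linarith)
    refine this.congr fun T => intervalIntegral.integral_congr fun y _ => ?_
    show _ = ((σ : ℂ) + y * Complex.I - p)⁻¹
    congr 1
    apply Complex.ext <;> simp
  · have hgt : σ < p.re := lt_of_le_of_ne (not_lt.1 hlt) h
    have := (tendsto_integral_line_inv_of_pos (p.re - σ) (-p.im) (by linarith)).neg
    refine this.congr fun T => ?_
    rw [← intervalIntegral.integral_neg]
    have := intervalIntegral.integral_comp_neg (a := -T) (b := T)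
      (fun y : ℝ => ((σ : ℂ) + y * Complex.I - p)⁻¹)
    rw [neg_neg] at this
    rw [← this]
    refine intervalIntegral.integral_congr fun y _ => ?_
    show -(_)⁻¹ = _
    rw [← inv_neg]
    congr 1
    apply Complex.ext <;> simp
    ring

open Complex in
/-- **Residue theorem in a vertical strip**, for a function with finitely many poles, all simple,
which decays exponentially at both ends of the strip. -/
theorem integral_line_sub_integral_line {h : ℂ → ℂ} {σ₁ σ₂ C δ T₀ : ℝ} (hσ : σ₁ < σ₂) (S : Finset ℂ)
    (r : ℂ → ℂ) (hS : ∀ p ∈ S, σ₁ < p.re ∧ p.re < σ₂)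
    (hd : ∀ s : ℂ, σ₁ ≤ s.re → s.re ≤ σ₂ → s ∉ S → DifferentiableAt ℂ h s)
    (hr : ∀ p ∈ S, Tendsto (fun s => (s - p) * h s) (𝓝[≠] p) (𝓝 (r p))) (hδ : 0 < δ)
    (hb : ∀ s : ℂ, σ₁ ≤ s.re → s.re ≤ σ₂ → T₀ ≤ |s.im| → ‖h s‖ ≤ C * Real.exp (-(δ * |s.im|))) :
    (∫ y : ℝ, h (σ₂ + y * I)) - ∫ y : ℝ, h (σ₁ + y * I) = 2 * Real.pi * ∑ p ∈ S, r p := by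
  set R : ℂ → ℂ := fun s => ∑ p ∈ S, r p * (s - p)⁻¹ with hR
  set G : ℂ → ℂ := fun s => h s - R s with hG
  have hRd : ∀ s ∉ S, DifferentiableAt ℂ R s := fun s hs => by
    refine DifferentiableAt.fun_sum fun p hp => ?_
    refine DifferentiableAt.const_mul (DifferentiableAt.inv (by fun_prop) ?_) _
    exact sub_ne_zero.2 fun e => hs (e ▸ hp)
  have hRr : ∀ p ∈ S, Tendsto (fun s => (s - p) * R s) (𝓝[≠] p) (𝓝 (r p)) := by
    intro p hp
    have h1 : ∀ᶠ s in 𝓝[≠] p, r p + (s - p) * ∑ q ∈ S.erase p, r q * (s - q)⁻¹ = (s - p) * R s := by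
      filter_upwards [self_mem_nhdsWithin] with s hs
      have hs' : s - p ≠ 0 := sub_ne_zero.2 hs
      simp only [hR]
      rw [← Finset.add_sum_erase _ _ hp, mul_add]
      congr 1
      field_simp
    refine Tendsto.congr' h1 ?_
    have hc : ContinuousAt (fun s : ℂ => r p + (s - p) * ∑ q ∈ S.erase p, r q * (s - q)⁻¹) p := by
      refine continuousAt_const.add ((continuousAt_id.sub continuousAt_const).mul ?_)
      refine tendsto_finsetSum _ fun q hq => ?_
      refine continuousAt_const.mul (ContinuousAt.inv₀ (by fun_prop) ?_)
      exact sub_ne_zero.2 fun e => (Finset.ne_of_mem_erase hq) e.symm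
    have := hc.tendsto
    simp only [sub_self, zero_mul, add_zero] at this
    exact this.mono_left nhdsWithin_le_nhds
  have hGr : ∀ p ∈ S, Tendsto (fun s => (s - p) * G s) (𝓝[≠] p) (𝓝 0) := by
    intro p hp
    have := (hr p hp).sub (hRr p hp)
    rw [sub_self] at this
    refine this.congr fun s => by simp only [hG]; ring
  have hGd : ∀ s : ℂ, σ₁ ≤ s.re → s.re ≤ σ₂ → s ∉ S → DifferentiableAt ℂ G s :=
    fun s h1 h2 h3 => (hd s h1 h2 h3).sub (hRd s h3)
  -- `G` is `h` minus its principal parts; `g` fills in its removable singularities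
  classical
  set g : ℂ → ℂ := fun s => if s ∈ S then limUnder (𝓝[≠] s) G else G s with hg
  have hgG : ∀ s ∉ S, g s = G s := fun s hs => by simp [hg, hs]
  have hgd : ∀ s : ℂ, σ₁ ≤ s.re → s.re ≤ σ₂ → DifferentiableAt ℂ g s := by
    intro s h1 h2
    by_cases hs : s ∈ S
    · obtain ⟨h3, h4⟩ := hS s hs
      set V : Set ℂ := {z : ℂ | σ₁ < z.re ∧ z.re < σ₂} ∩ ((S.erase s : Finset ℂ) : Set ℂ)ᶜ with hV
      have hVo : V ∈ 𝓝 s := by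
        refine inter_mem ?_ ?_
        · exact ((isOpen_lt continuous_const Complex.continuous_re).inter
            (isOpen_lt Complex.continuous_re continuous_const)).mem_nhds ⟨h3, h4⟩
        · exact (Finset.finite_toSet _).isClosed.isOpen_compl.mem_nhds (by simp)
      have hdV : DifferentiableOn ℂ G (V \ {s}) := by
        rintro z ⟨⟨⟨hz1, hz2⟩, hz3⟩, hz4⟩
        refine (hGd z hz1.le hz2.le fun hz => hz3 ?_).differentiableWithinAt
        exact Finset.mem_coe.2 (Finset.mem_erase.2 ⟨hz4, hz⟩)
      have ho : (fun z => G z - G s) =o[𝓝[≠] s] fun z => (z - s)⁻¹ := by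
        refine Asymptotics.isLittleO_of_tendsto' ?_ ?_
        · filter_upwards [self_mem_nhdsWithin] with z hz h0
          exact absurd (inv_eq_zero.1 h0) (sub_ne_zero.2 hz)
        · have t1 : Tendsto (fun z : ℂ => (z - s) * G s) (𝓝[≠] s) (𝓝 0) := by
            have : ContinuousAt (fun z : ℂ => (z - s) * G s) s := by fun_prop
            have := this.tendsto
            simp only [sub_self, zero_mul] at this
            exact this.mono_left nhdsWithin_le_nhds
          have := (hGr s hs).sub t1
          rw [sub_self] at this
          refine this.congr fun z => ?_
          rw [div_inv_eq_mul]; ring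
      have := (Complex.differentiableOn_update_limUnder_of_isLittleO hVo hdV ho).differentiableAt hVo
      refine this.congr_of_eventuallyEq ?_
      filter_upwards [hVo] with z hz
      by_cases hzs : z = s
      · subst hzs; simp [hg, hs]
      · have : z ∉ S := fun h => hz.2 (Finset.mem_coe.2 (Finset.mem_erase.2 ⟨hzs, h⟩))
        simp [hg, this, hzs]
    · refine (hGd s h1 h2 hs).congr_of_eventuallyEq ?_
      filter_upwards [(Finset.finite_toSet S).isClosed.isOpen_compl.mem_nhds hs] with z hz
      exact hgG z hz
  have hedge : ∀ σ : ℝ, (σ = σ₁ ∨ σ = σ₂) → ∀ y : ℝ, ((σ : ℂ) + y * I) ∉ S := by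
    rintro σ hσ' y hmem
    have h1 := hS _ hmem
    simp only [Complex.add_re, Complex.ofReal_re, Complex.mul_re, Complex.I_re, mul_zero,
      Complex.ofReal_im, Complex.I_im, mul_one, sub_self, add_zero] at h1
    rcases hσ' with rfl | rfl
    · exact lt_irrefl _ h1.1
    · exact lt_irrefl _ h1.2
  have hhc : ∀ σ : ℝ, (σ = σ₁ ∨ σ = σ₂) → Continuous fun y : ℝ => h (σ + y * I) := by
    intro σ hσ'
    rw [continuous_iff_continuousAt]
    intro y
    have hcont : ContinuousAt h (σ + y * I) := by
      refine (hd _ ?_ ?_ (hedge σ hσ' y)).continuousAt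
      · rcases hσ' with rfl | rfl <;> simp [hσ.le]
      · rcases hσ' with rfl | rfl <;> simp [hσ.le]
    exact ContinuousAt.comp (f := fun y : ℝ => (σ : ℂ) + y * I) hcont (by fun_prop)
  have hvert : ∀ σ : ℝ, (σ = σ₁ ∨ σ = σ₂) →
      Tendsto (fun T : ℝ => ∫ y in (-T)..T, g (σ + y * I)) atTop
      (𝓝 ((∫ y : ℝ, h (σ + y * I)) -
        ∑ p ∈ S, r p * (if p.re < σ then (Real.pi : ℂ) else -Real.pi))) := by
    intro σ hσ'
    have hint : MeasureTheory.Integrable fun y : ℝ => h (σ + y * I) := by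
      refine integrable_of_norm_le_exp (hhc σ hσ') hδ (T := T₀) (C := C) fun y hy => ?_
      have := hb (σ + y * I) (by rcases hσ' with rfl | rfl <;> simp [hσ.le])
        (by rcases hσ' with rfl | rfl <;> simp [hσ.le]) (by simpa using hy)
      simpa using this
    have t1 := MeasureTheory.intervalIntegral_tendsto_integral hint tendsto_neg_atTop_atBot tendsto_id
    have t2 : Tendsto (fun T : ℝ => ∑ p ∈ S, r p * ∫ y in (-T)..T, ((σ : ℂ) + y * I - p)⁻¹) atTop
        (𝓝 (∑ p ∈ S, r p * (if p.re < σ then (Real.pi : ℂ) else -Real.pi))) := by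
      refine tendsto_finsetSum _ fun p hp => (tendsto_integral_line_inv σ p ?_).const_mul _
      obtain ⟨h1, h2⟩ := hS p hp
      rcases hσ' with rfl | rfl
      · exact h1.ne
      · exact h2.ne'
    refine (t1.sub t2).congr fun T => ?_
    have hc : ∀ p ∈ S, Continuous fun y : ℝ => ((σ : ℂ) + y * I - p)⁻¹ := fun p hp =>
      Continuous.inv₀ (by fun_prop) fun y e => hedge σ hσ' y (by rw [sub_eq_zero.1 e]; exact hp)
    simp_rw [← intervalIntegral.integral_const_mul]
    rw [← intervalIntegral.integral_finsetSum, id, ← intervalIntegral.integral_sub]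
    · refine intervalIntegral.integral_congr fun y _ => ?_
      simp only [hgG _ (hedge σ hσ' y), hG, hR]
    · exact (hhc σ hσ').intervalIntegrable _ _
    · exact (continuous_finsetSum _ fun p hp => continuous_const.mul (hc p hp)).intervalIntegrable _ _
    · exact fun p hp => (continuous_const.mul (hc p hp)).intervalIntegrable _ _
  have hhor : ∀ ε : ℝ, (ε = 1 ∨ ε = -1) →
      Tendsto (fun T : ℝ => ∫ x in σ₁..σ₂, g (x + ((ε * T : ℝ) : ℂ) * I)) atTop (𝓝 0) := by
    intro ε hε
    have hε1 : |ε| = 1 := by rcases hε with rfl | rfl <;> simp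
    set bound : ℝ → ℝ := fun T => (C * Real.exp (-(δ * T)) + ∑ p ∈ S, ‖r p‖ * (T - |p.im|)⁻¹) *
      |σ₂ - σ₁| with hbound
    have hbt : Tendsto bound atTop (𝓝 0) := by
      have t1 : Tendsto (fun T : ℝ => C * Real.exp (-(δ * T))) atTop (𝓝 0) := by
        have : Tendsto (fun T : ℝ => Real.exp (-(δ * T))) atTop (𝓝 0) :=
          Real.tendsto_exp_neg_atTop_nhds_zero.comp (tendsto_id.const_mul_atTop hδ)
        simpa using this.const_mul C
      have t2 : Tendsto (fun T : ℝ => ∑ p ∈ S, ‖r p‖ * (T - |p.im|)⁻¹) atTop (𝓝 0) := by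
        have : Tendsto (fun T : ℝ => ∑ p ∈ S, ‖r p‖ * (T - |p.im|)⁻¹) atTop
            (𝓝 (∑ p ∈ S, ‖r p‖ * 0)) := by
          refine tendsto_finsetSum _ fun p _ => Tendsto.const_mul _ ?_
          exact tendsto_inv_atTop_zero.comp (tendsto_atTop_add_const_right _ (-|p.im|) tendsto_id)
        simpa using this
      simpa using (t1.add t2).mul_const |σ₂ - σ₁|
    refine squeeze_zero_norm' ?_ hbt
    have hev : ∀ᶠ T : ℝ in atTop, ∀ p ∈ S, |p.im| < T :=
      (Finset.eventually_all S).2 fun p _ => eventually_gt_atTop _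
    filter_upwards [hev, eventually_ge_atTop T₀, eventually_ge_atTop 0] with T hT hT0 hTpos
    refine intervalIntegral.norm_integral_le_of_norm_le_const fun x hx => ?_
    rw [Set.uIoc_of_le hσ.le] at hx
    have him : |((x : ℂ) + ((ε * T : ℝ) : ℂ) * I).im| = T := by
      rw [Complex.add_im, Complex.ofReal_im, Complex.im_ofReal_mul, Complex.I_im, mul_one, zero_add,
        abs_mul, hε1, one_mul, abs_of_nonneg hTpos]
    have hre : ((x : ℂ) + ((ε * T : ℝ) : ℂ) * I).re = x := by
      simp
    have hnot : ((x : ℂ) + ((ε * T : ℝ) : ℂ) * I) ∉ S := fun hm => by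
      have := hT _ hm
      rw [him] at this
      exact lt_irrefl _ this
    rw [hgG _ hnot]
    have hb1 := hb _ (by rw [hre]; exact hx.1.le) (by rw [hre]; exact hx.2) (by rw [him]; exact hT0)
    rw [him] at hb1
    refine (norm_sub_le _ _).trans (add_le_add hb1 ((norm_sum_le _ _).trans ?_))
    refine Finset.sum_le_sum fun p hp => ?_
    rw [norm_mul, norm_inv]
    refine mul_le_mul_of_nonneg_left (inv_anti₀ (by linarith [hT p hp]) ?_) (norm_nonneg _)
    have h1 := Complex.abs_im_le_norm ((x : ℂ) + ((ε * T : ℝ) : ℂ) * I - p)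
    rw [Complex.sub_im] at h1
    refine le_trans ?_ h1
    refine le_trans (le_of_eq ?_) (abs_sub_abs_le_abs_sub _ _)
    rw [him]
  have hrect : ∀ T : ℝ, (∫ x in σ₁..σ₂, g (x + ((-1 * T : ℝ) : ℂ) * I)) -
      (∫ x in σ₁..σ₂, g (x + ((1 * T : ℝ) : ℂ) * I)) + I * (∫ y in (-T)..T, g (σ₂ + y * I)) -
      I * (∫ y in (-T)..T, g (σ₁ + y * I)) = 0 := by
    intro T
    have := Complex.integral_boundary_rect_eq_zero_of_differentiableOn g (σ₁ + ((-T : ℝ) : ℂ) * I)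
      (σ₂ + (T : ℂ) * I) ?_
    · simpa using this
    · intro s hs
      rw [Complex.mem_reProdIm] at hs
      have h1 := hs.1
      simp only [Complex.add_re, Complex.ofReal_re, Complex.mul_re, Complex.I_re, mul_zero,
        Complex.ofReal_im, Complex.I_im, mul_one, sub_self, add_zero, Set.uIcc_of_le hσ.le] at h1
      exact (hgd s h1.1 h1.2).differentiableWithinAt
  have hlim := (((hhor (-1) (Or.inr rfl)).sub (hhor 1 (Or.inl rfl))).add
    ((hvert σ₂ (Or.inr rfl)).const_mul I)).sub ((hvert σ₁ (Or.inl rfl)).const_mul I)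
  have h0 := tendsto_nhds_unique (hlim.congr hrect) tendsto_const_nhds
  have s1 : ∑ p ∈ S, r p * (if p.re < σ₁ then (Real.pi : ℂ) else -Real.pi) = -(Real.pi * ∑ p ∈ S, r p) := by
    rw [Finset.mul_sum, ← Finset.sum_neg_distrib]
    refine Finset.sum_congr rfl fun p hp => ?_
    rw [if_neg (not_lt.2 (hS p hp).1.le)]; ring
  have s2 : ∑ p ∈ S, r p * (if p.re < σ₂ then (Real.pi : ℂ) else -Real.pi) = Real.pi * ∑ p ∈ S, r p := by
    rw [Finset.mul_sum]
    refine Finset.sum_congr rfl fun p hp => ?_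
    rw [if_pos (hS p hp).2]; ring
  rw [s1, s2] at h0
  have h1 := congrArg (fun z => -I * z) h0
  simp only [mul_zero] at h1
  linear_combination h1 + (2 * Real.pi * ∑ p ∈ S, r p - ((∫ y : ℝ, h (σ₂ + y * I)) -
    ∫ y : ℝ, h (σ₁ + y * I))) * (-I_mul_I)

/-! ### Superpositions of exponentials -/

section Superposition

open MeasureTheory

variable {J Ω : Type*} [Fintype J] [MeasurableSpace Ω]

/-- The bilinear pairing `⟨l, x⟩ = ∑ l_j x_j`. -/
noncomputable def pairing (l x : J → ℂ) : ℂ := ∑ j, l j * x j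

/-- The `ℓ¹` norm. -/
noncomputable def norm1 (l : J → ℂ) : ℝ := ∑ j, ‖l j‖

lemma norm1_nonneg (l : J → ℂ) : 0 ≤ norm1 l := Finset.sum_nonneg fun _ _ => norm_nonneg _

lemma pairing_add (l x y : J → ℂ) : pairing l (x + y) = pairing l x + pairing l y := by
  simp [pairing, mul_add, Finset.sum_add_distrib]

lemma norm_pairing_le (l x : J → ℂ) : ‖pairing l x‖ ≤ norm1 l * ‖x‖ := by
  unfold pairing norm1
  rw [Finset.sum_mul]
  refine (norm_sum_le _ _).trans (Finset.sum_le_sum fun j _ => ?_)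
  rw [norm_mul]
  exact mul_le_mul_of_nonneg_left (norm_le_pi_norm x j) (norm_nonneg _)

lemma re_pairing_le (l x y : J → ℂ) :
    (pairing l x).re ≤ (pairing l y).re + ‖x - y‖ * norm1 l := by
  have h1 : pairing l x = pairing l y + pairing l (x - y) := by
    rw [← pairing_add]; congr 1; ext j; simp
  rw [h1, Complex.add_re]
  have h2 := (Complex.re_le_norm _).trans (norm_pairing_le l (x - y))
  linarith

@[fun_prop]
lemma continuous_pairing : Continuous fun q : (J → ℂ) × (J → ℂ) => pairing q.1 q.2 := by
  unfold pairing; fun_prop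

lemma continuous_norm1 : Continuous (norm1 : (J → ℂ) → ℝ) := by
  unfold norm1; fun_prop

/-- The linear form `x ↦ ⟨l, x⟩`. -/
noncomputable def pairingL (l : J → ℂ) : (J → ℂ) →L[ℂ] ℂ :=
  ∑ j, l j • ContinuousLinearMap.proj (R := ℂ) (φ := fun _ : J => ℂ) j

lemma pairingL_apply (l x : J → ℂ) : pairingL l x = pairing l x := by
  simp [pairingL, pairing]

lemma continuous_pairingL : Continuous (pairingL : (J → ℂ) → _) := by
  unfold pairingL; fun_prop

/-- The form `(x₁, …, x_n) ↦ ⟨l, x₁⟩ ⋯ ⟨l, x_n⟩`. -/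
noncomputable def pairingPow (n : ℕ) (l : J → ℂ) :
    ContinuousMultilinearMap ℂ (fun _ : Fin n => J → ℂ) ℂ :=
  (ContinuousMultilinearMap.mkPiAlgebra ℂ (Fin n) ℂ).compContinuousLinearMap fun _ => pairingL l

lemma pairingPow_apply (n : ℕ) (l y : J → ℂ) : pairingPow n l (fun _ => y) = pairing l y ^ n := by
  simp [pairingPow, pairingL_apply]

lemma continuous_pairingPow (n : ℕ) : Continuous (pairingPow n : (J → ℂ) → _) := by
  have h : (pairingPow n : (J → ℂ) → _) = fun l =>
      ContinuousMultilinearMap.compContinuousLinearMapContinuousMultilinear ℂ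
        (fun _ : Fin n => J → ℂ) (fun _ : Fin n => ℂ) ℂ (fun _ => pairingL l)
        (ContinuousMultilinearMap.mkPiAlgebra ℂ (Fin n) ℂ) := by
    ext l x
    simp [pairingPow]
  rw [h]
  have h1 : Continuous fun l : J → ℂ => (fun _ : Fin n => pairingL l) :=
    continuous_pi fun _ => continuous_pairingL
  have h2 := (ContinuousMultilinearMap.compContinuousLinearMapContinuousMultilinear ℂ
        (fun _ : Fin n => J → ℂ) (fun _ : Fin n => ℂ) ℂ).cont.comp h1
  exact (ContinuousLinearMap.apply ℂ _
    (ContinuousMultilinearMap.mkPiAlgebra ℂ (Fin n) ℂ)).continuous.comp h2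

lemma norm_pairingPow_le (n : ℕ) (l : J → ℂ) : ‖pairingPow n l‖ ≤ norm1 l ^ n := by
  refine ContinuousMultilinearMap.opNorm_le_bound (by have := norm1_nonneg l; positivity) fun x => ?_
  simp only [pairingPow, ContinuousMultilinearMap.compContinuousLinearMap_apply,
    ContinuousMultilinearMap.mkPiAlgebra_apply, pairingL_apply]
  rw [norm_prod]
  refine (Finset.prod_le_prod (fun _ _ => norm_nonneg _) fun i _ => norm_pairing_le l (x i)).trans_eq ?_
  rw [Finset.prod_mul_distrib, Finset.prod_const, Finset.card_univ, Fintype.card_fin]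

/-- A superposition `∫ k(ω) exp ⟨l(ω), x⟩ dμ(ω)` of exponentials is analytic where it converges
with some room. -/
theorem analyticAt_integral_exp {μ : Measure Ω} {k : Ω → ℂ} {l : Ω → J → ℂ} {bound : Ω → ℝ}
    (hk : AEStronglyMeasurable k μ) (hl : AEStronglyMeasurable l μ) (x₀ : J → ℂ) {δ : ℝ}
    (hδ : 0 < δ)
    (hb : ∀ ω, ‖k ω‖ * Real.exp ((pairing (l ω) x₀).re + δ * norm1 (l ω)) ≤ bound ω)
    (hbi : Integrable bound μ) :
    AnalyticAt ℂ (fun x => ∫ ω, k ω * Complex.exp (pairing (l ω) x) ∂μ) x₀ := by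
  set w : Ω → ℂ := fun ω => k ω * Complex.exp (pairing (l ω) x₀) with hw
  have hpm : ∀ x, AEStronglyMeasurable (fun ω => pairing (l ω) x) μ := fun x =>
    (continuous_pairing.comp (Continuous.prodMk_left x)).comp_aestronglyMeasurable hl
  have hwm : AEStronglyMeasurable w μ :=
    hk.mul (Complex.continuous_exp.comp_aestronglyMeasurable (hpm x₀))
  have hn1 : AEStronglyMeasurable (fun ω => norm1 (l ω)) μ :=
    continuous_norm1.comp_aestronglyMeasurable hl
  have hwn : ∀ ω, ‖w ω‖ * Real.exp (δ * norm1 (l ω)) ≤ bound ω := by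
    intro ω
    rw [hw, norm_mul, Complex.norm_exp, mul_assoc, ← Real.exp_add]
    exact hb ω
  have hterm : ∀ (n : ℕ) ω, ‖w ω‖ * ((δ * norm1 (l ω)) ^ n / n.factorial) ≤ bound ω := by
    intro n ω
    refine le_trans (mul_le_mul_of_nonneg_left ?_ (norm_nonneg _)) (hwn ω)
    exact Real.pow_div_factorial_le_exp _ (mul_nonneg hδ.le (norm1_nonneg _)) n
  set q : (n : ℕ) → Ω → ContinuousMultilinearMap ℂ (fun _ : Fin n => J → ℂ) ℂ :=
    fun n ω => (w ω * ((n.factorial : ℂ))⁻¹) • pairingPow n (l ω) with hq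
  have hqm : ∀ n, AEStronglyMeasurable (q n) μ := fun n =>
    (hwm.mul_const _).smul ((continuous_pairingPow n).comp_aestronglyMeasurable hl)
  have hqn : ∀ n ω, ‖q n ω‖ * δ ^ n ≤ bound ω := by
    intro n ω
    refine le_trans ?_ (hterm n ω)
    rw [hq, norm_smul, norm_mul, norm_inv, Complex.norm_natCast, mul_pow]
    have := norm_pairingPow_le n (l ω)
    calc _ ≤ ‖w ω‖ * (n.factorial : ℝ)⁻¹ * norm1 (l ω) ^ n * δ ^ n := by gcongr
      _ = _ := by rw [div_eq_mul_inv]; ring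
  have hqi : ∀ n, Integrable (q n) μ := fun n => by
    refine Integrable.mono' (hbi.const_mul ((δ ^ n)⁻¹)) (hqm n) (Eventually.of_forall fun ω => ?_)
    rw [inv_mul_eq_div, le_div_iff₀ (by positivity)]
    exact hqn n ω
  refine ⟨fun n => ∫ ω, q n ω ∂μ, ENNReal.ofReal δ, ?_, ENNReal.ofReal_pos.2 hδ, fun {y} hy => ?_⟩
  · refine FormalMultilinearSeries.le_radius_of_bound (r := ⟨δ, hδ.le⟩) _ (∫ ω, bound ω ∂μ)
      (fun n => ?_) |>.trans' (le_of_eq ?_)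
    · show ‖∫ ω, q n ω ∂μ‖ * δ ^ n ≤ _
      calc _ ≤ (∫ ω, ‖q n ω‖ ∂μ) * δ ^ n := by gcongr; exact norm_integral_le_integral_norm _
        _ = ∫ ω, ‖q n ω‖ * δ ^ n ∂μ := (integral_mul_const _ _).symm
        _ ≤ _ := integral_mono ((hqi n).norm.mul_const _) hbi (hqn n)
    · rw [ENNReal.ofReal, Real.toNNReal_of_nonneg hδ.le]; rfl
  · have hy' : ‖y‖ < δ := by
      rw [Metric.eball_ofReal] at hy
      simpa using hy
    have e : ∀ n, (∫ ω, q n ω ∂μ) (fun _ => y) =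
        ∫ ω, w ω * (pairing (l ω) y ^ n / n.factorial) ∂μ := by
      intro n
      have := (ContinuousMultilinearMap.apply ℂ (fun _ : Fin n => J → ℂ) ℂ
        (fun _ => y)).integral_comp_comm (hqi n)
      simp only [ContinuousMultilinearMap.apply_apply] at this
      rw [← this]
      refine integral_congr_ae (Eventually.of_forall fun ω => ?_)
      simp only [hq, smul_apply, pairingPow_apply, smul_eq_mul]
      rw [div_eq_mul_inv]; ring
    simp_rw [e]
    have hexp : ∀ ω, k ω * Complex.exp (pairing (l ω) (x₀ + y)) =
        w ω * Complex.exp (pairing (l ω) y) := by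
      intro ω
      rw [pairing_add, Complex.exp_add, hw]; ring
    simp_rw [hexp]
    have hs : ∀ ω, HasSum (fun n : ℕ => ‖w ω‖ * ((δ * norm1 (l ω)) ^ n / n.factorial))
        (‖w ω‖ * Real.exp (δ * norm1 (l ω))) := fun ω => by
      have := (NormedSpace.expSeries_div_hasSum_exp (δ * norm1 (l ω))).mul_left ‖w ω‖
      rwa [← Real.exp_eq_exp_ℝ] at this
    refine hasSum_integral_of_dominated_convergence
      (fun n ω => ‖w ω‖ * ((δ * norm1 (l ω)) ^ n / n.factorial)) (fun n => ?_)
      (fun n => Eventually.of_forall fun ω => ?_) (Eventually.of_forall fun ω => (hs ω).summable)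
      ?_ (Eventually.of_forall fun ω => ?_)
    · simp_rw [div_eq_mul_inv]
      exact hwm.mul (((hpm y).pow n).mul_const _)
    · rw [norm_mul, norm_div, norm_pow, Complex.norm_natCast]
      have h1 := norm_pairing_le (l ω) y
      have h2 := norm1_nonneg (l ω)
      gcongr
      refine h1.trans ?_
      rw [mul_comm]
      gcongr
    · simp_rw [fun ω => (hs ω).tsum_eq]
      refine Integrable.mono' hbi (hwm.norm.mul (Real.continuous_exp.comp_aestronglyMeasurable
        (hn1.const_mul δ))) (Eventually.of_forall fun ω => ?_)
      rw [Real.norm_of_nonneg (by positivity)]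
      exact hwn ω
    · have := (NormedSpace.expSeries_div_hasSum_exp (pairing (l ω) y)).mul_left (w ω)
      rwa [← Complex.exp_eq_exp_ℂ] at this

/-- Joint continuity of a superposition of exponentials in `x` and in a parameter. -/
theorem continuousAt_integral_exp {P : Type*} [TopologicalSpace P] [FirstCountableTopology P]
    {μ : Measure Ω} {k : P → Ω → ℂ} {l : P → Ω → J → ℂ} {bound : Ω → ℝ} (e₀ : P)
    (hk : ∀ᶠ e in 𝓝 e₀, AEStronglyMeasurable (k e) μ)
    (hl : ∀ᶠ e in 𝓝 e₀, AEStronglyMeasurable (l e) μ)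
    (hkc : ∀ ω, ContinuousAt (fun e => k e ω) e₀) (hlc : ∀ ω, ContinuousAt (fun e => l e ω) e₀)
    (x₀ : J → ℂ) {δ : ℝ}
    (hb : ∀ᶠ e in 𝓝 e₀, ∀ ω,
      ‖k e ω‖ * Real.exp ((pairing (l e ω) x₀).re + δ * norm1 (l e ω)) ≤ bound ω)
    (hbi : Integrable bound μ) (x : J → ℂ) (hx : ‖x - x₀‖ < δ) :
    ContinuousAt (fun q : P × (J → ℂ) => ∫ ω, k q.1 ω * Complex.exp (pairing (l q.1 ω) q.2) ∂μ)
      (e₀, x) := by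
  have hx' : ∀ᶠ z in 𝓝 x, ‖z - x₀‖ < δ :=
    (isOpen_lt (by fun_prop) continuous_const).mem_nhds hx
  refine continuousAt_of_dominated (bound := bound) ?_ ?_ hbi (Eventually.of_forall fun ω => ?_)
  · filter_upwards [(hk.and hl).prod_inl_nhds x] with q hq
    exact hq.1.mul (Complex.continuous_exp.comp_aestronglyMeasurable
      ((continuous_pairing.comp (Continuous.prodMk_left q.2)).comp_aestronglyMeasurable hq.2))
  · filter_upwards [(hb.prod_inl_nhds x).and (hx'.prod_inr_nhds e₀)] with q hq
    refine Eventually.of_forall fun ω => le_trans ?_ (hq.1 ω)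
    rw [norm_mul, Complex.norm_exp]
    refine mul_le_mul_of_nonneg_left (Real.exp_le_exp.2 ?_) (norm_nonneg _)
    have := re_pairing_le (l q.1 ω) q.2 x₀
    have h2 := mul_le_mul_of_nonneg_right hq.2.le (norm1_nonneg (l q.1 ω))
    linarith
  · have h1 : ContinuousAt (fun q : P × (J → ℂ) => k q.1 ω) (e₀, x) :=
      ContinuousAt.comp (f := Prod.fst) (g := fun e => k e ω) (hkc ω) continuousAt_fst
    have h2 : ContinuousAt (fun q : P × (J → ℂ) => l q.1 ω) (e₀, x) :=
      ContinuousAt.comp (f := Prod.fst) (g := fun e => l e ω) (hlc ω) continuousAt_fst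
    refine h1.mul (Complex.continuous_exp.continuousAt.comp ?_)
    exact ContinuousAt.comp (f := fun q : P × (J → ℂ) => (l q.1 ω, q.2))
      continuous_pairing.continuousAt (h2.prodMk continuousAt_snd)

end Superposition

/-! ### The regular subdivision -/

section Subdivision

variable {m n : ℕ}

@[simp] lemma fermatA_inl (d : ℕ) (a : Matrix (Fin n) (Fin m) ℕ) (i : Fin n) (k : Fin m) :
    fermatA d a i (.inl k) = a i k := by simp [fermatA]

@[simp] lemma fermatA_inr (d : ℕ) (a : Matrix (Fin n) (Fin m) ℕ) (i j : Fin n) :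
    fermatA d a i (.inr j) = if i = j then (d : ℤ) else 0 := by
  simp [fermatA, Matrix.diagonal_apply]

variable {d : ℕ} {a : Matrix (Fin n) (Fin m) ℕ} {w : Fin m ⊕ Fin n → ℝ}

lemma mem_regularSubdivision_fermatA {σ : Finset (Fin m ⊕ Fin n)} :
    σ ∈ regularSubdivision (fermatA d a) w ↔ ∃ ν : Fin n → ℝ,
      ((∀ k, .inl k ∈ σ → ∑ i, ν i * a i k = w (.inl k)) ∧
        ∀ j, .inr j ∈ σ → ν j * d = w (.inr j)) ∧
      (∀ k, .inl k ∉ σ → ∑ i, ν i * a i k < w (.inl k)) ∧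
        ∀ j, .inr j ∉ σ → ν j * d < w (.inr j) := by
  simp [regularSubdivision, Sum.forall]

variable [NeZero m]

/-- The simplex `{1, m+1, …, m+n} ∖ {m+i}`. -/
def dworkCell (m : ℕ) {n : ℕ} [NeZero m] (i : Fin n) : Finset (Fin m ⊕ Fin n) :=
  insert (Sum.inl 0) ((Finset.univ.erase i).image Sum.inr)

lemma inl_mem_dworkCell {i : Fin n} {k : Fin m} : .inl k ∈ dworkCell m i ↔ k = 0 := by
  simp [dworkCell]

lemma inr_mem_dworkCell {i j : Fin n} : .inr j ∈ dworkCell m i ↔ j ≠ i := by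
  simp [dworkCell]

lemma dworkCell_injective {i i' : Fin n} (h : dworkCell m i ⊆ dworkCell m i') : i = i' := by
  by_contra hne
  have := h (inr_mem_dworkCell.2 (Ne.symm hne))
  exact inr_mem_dworkCell.1 this rfl

lemma dworkCell_mem (hd : 0 < d) (hw : IsDworkPerturbation d a w) {i : Fin n} (hi : a i 0 ≠ 0) :
    dworkCell m i ∈ regularSubdivision (fermatA d a) w := by
  have hd' : (0 : ℝ) < d := by exact_mod_cast hd
  have hi' : (0 : ℝ) < a i 0 := by exact_mod_cast Nat.pos_of_ne_zero hi
  obtain ⟨h1, h2⟩ := hw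
  set D : ℝ := ∑ k ∈ Finset.univ.erase i, w (.inr k) * a k 0 with hD
  set ν : Fin n → ℝ := fun j => if j = i then (w (.inl 0) * d - D) / (a i 0 * d)
    else w (.inr j) / d with hν
  have hνi : ν i = (w (.inl 0) * d - D) / (a i 0 * d) := by simp [hν]
  have hνj : ∀ j, j ≠ i → ν j = w (.inr j) / d := fun j hj => by simp [hν, hj]
  have hsum : ∀ k, ∑ j, ν j * a j k = (w (.inl 0) * d - D) / (a i 0 * d) * a i k +
      (∑ j ∈ Finset.univ.erase i, w (.inr j) * a j k) / d := by
    intro k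
    rw [← Finset.add_sum_erase _ _ (Finset.mem_univ i), hνi, Finset.sum_div]
    congr 1
    refine Finset.sum_congr rfl fun j hj => ?_
    rw [hνj j (Finset.ne_of_mem_erase hj)]; ring
  have hsplit : ∀ f : Fin n → ℝ, ∑ k, f k = f i + ∑ k ∈ Finset.univ.erase i, f k := fun f =>
    (Finset.add_sum_erase _ _ (Finset.mem_univ i)).symm
  refine mem_regularSubdivision_fermatA.2 ⟨ν, ⟨fun k hk => ?_, fun j hj => ?_⟩,
    fun k hk => ?_, fun j hj => ?_⟩
  · rw [inl_mem_dworkCell] at hk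
    subst hk
    rw [hsum]
    field_simp
    ring
  · rw [inr_mem_dworkCell] at hj
    rw [hνj j hj, div_mul_cancel₀ _ hd'.ne']
  · rw [inl_mem_dworkCell] at hk
    have h3 := h2 k hk i hi
    rw [hsplit] at h3
    have e : ∑ j ∈ Finset.univ.erase i, w (.inr j) * ((a i k : ℝ) * a j 0 - (a i 0 : ℝ) * a j k) =
        a i k * D - a i 0 * ∑ j ∈ Finset.univ.erase i, w (.inr j) * a j k := by
      rw [hD, Finset.mul_sum, Finset.mul_sum, ← Finset.sum_sub_distrib]
      exact Finset.sum_congr rfl fun j _ => by ring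
    rw [e] at h3
    rw [hsum, div_mul_eq_mul_div, ← mul_div_mul_left _ (d : ℝ) hi'.ne', ← add_div,
      div_lt_iff₀ (by positivity)]
    linarith
  · have hji : j = i := by
      by_contra hne
      exact hj (inr_mem_dworkCell.2 hne)
    subst hji
    rw [hsplit] at h1
    rw [hνi, div_mul_eq_mul_div, div_lt_iff₀ (by positivity)]
    nlinarith

lemma exists_subset_dworkCell (hd : 0 < d) (hw : IsDworkPerturbation d a w)
    {σ : Finset (Fin m ⊕ Fin n)} (hσ : σ ∈ regularSubdivision (fermatA d a) w) :
    ∃ i, a i 0 ≠ 0 ∧ σ ⊆ dworkCell m i := by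
  obtain ⟨ν, ⟨e1, e2⟩, s1, s2⟩ := mem_regularSubdivision_fermatA.1 hσ
  obtain ⟨h1, h2⟩ := hw
  have hd' : (0 : ℝ) < d := by exact_mod_cast hd
  -- the slack of the inequality of index `m + k`
  set δ : Fin n → ℝ := fun k => w (.inr k) - ν k * d with hδ
  have hδ0 : ∀ k, 0 ≤ δ k := fun k => by
    by_cases hk : .inr k ∈ σ
    · simp [hδ, e2 k hk]
    · simp only [hδ]; linarith [s2 k hk]
  set D : Fin m → ℝ := fun l => ∑ k, w (.inr k) * a k l - w (.inl l) * d with hDdef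
  have hδD : ∀ l, ∑ k, δ k * a k l = D l + (w (.inl l) - ∑ k, ν k * a k l) * d := by
    intro l
    simp only [hδ, hDdef, sub_mul, Finset.sum_sub_distrib, Finset.sum_mul]
    have : ∑ x, ν x * d * (a x l : ℝ) = ∑ x, ν x * a x l * d :=
      Finset.sum_congr rfl fun x _ => by ring
    rw [this]; ring
  have hle : ∀ l, ∑ k, ν k * a k l ≤ w (.inl l) := fun l => by
    by_cases hl : .inl l ∈ σ
    · exact (e1 l hl).le
    · exact (s1 l hl).le
  have hD0 : 0 < D 0 := by simp only [hDdef]; linarith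
  have hsum0 : D 0 ≤ ∑ k, δ k * a k 0 := by
    rw [hδD]; nlinarith [hle 0]
  have hDl : ∀ l, l ≠ 0 → ∀ j, a j 0 ≠ 0 → a j 0 * D l < a j l * D 0 := by
    intro l hl j hj
    have := h2 l hl j hj
    have e : ∑ k, w (.inr k) * ((a j l : ℝ) * a k 0 - (a j 0 : ℝ) * a k l) =
        a j l * ∑ k, w (.inr k) * a k 0 - a j 0 * ∑ k, w (.inr k) * a k l := by
      rw [Finset.mul_sum, Finset.mul_sum, ← Finset.sum_sub_distrib]
      exact Finset.sum_congr rfl fun j _ => by ring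
    rw [e] at this
    simp only [hDdef]
    linarith
  obtain ⟨i, -, hi⟩ : ∃ i ∈ Finset.univ, 0 < δ i * a i 0 := by
    by_contra! hcon
    exact absurd (hD0.trans_le hsum0) (not_lt.2 (Finset.sum_nonpos hcon))
  have hai : a i 0 ≠ 0 := fun h => by simp [h] at hi
  refine ⟨i, hai, fun x hx => ?_⟩
  rcases x with l | j
  · rw [inl_mem_dworkCell]
    by_contra hl
    have hDeq : ∑ k, δ k * a k l = D l := by rw [hδD, e1 l hx]; ring
    have hlt : D l * ∑ k, δ k * a k 0 < D 0 * ∑ k, δ k * a k l := by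
      rw [Finset.mul_sum, Finset.mul_sum]
      refine Finset.sum_lt_sum (fun k _ => ?_) ⟨i, Finset.mem_univ i, ?_⟩
      · by_cases hk : a k 0 = 0
        · have h5 := hδ0 k
          rw [hk]
          simp only [Nat.cast_zero, mul_zero]
          positivity
        · nlinarith [hDl l hl k hk, hδ0 k]
      · have h6 : 0 < δ i := lt_of_le_of_ne (hδ0 i) fun h => by simp [← h] at hi
        nlinarith [hDl l hl i hai]
    rw [hDeq] at hlt
    have hDl0 : 0 ≤ D l := by
      rw [← hDeq]
      exact Finset.sum_nonneg fun k _ => mul_nonneg (hδ0 k) (Nat.cast_nonneg _)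
    nlinarith
  · rw [inr_mem_dworkCell]
    rintro rfl
    have : δ j = 0 := by simp [hδ, e2 j hx]
    simp [this] at hi

/-- The regular subdivision of a perturbation of the generalized Dwork family. -/
theorem maximalCells_eq_cellsDwork (hd : 0 < d) (hw : IsDworkPerturbation d a w) :
    maximalCells (fermatA d a) w = cellsDwork a := by
  ext σ
  constructor
  · intro hσ
    obtain ⟨i, hi, hsub⟩ := exists_subset_dworkCell hd hw hσ.1
    exact ⟨i, hi, le_antisymm hsub (hσ.2 (dworkCell_mem hd hw hi) hsub)⟩
  · rintro ⟨i, hi, rfl⟩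
    refine ⟨dworkCell_mem hd hw hi, fun τ hτ hle => ?_⟩
    obtain ⟨i', -, hsub⟩ := exists_subset_dworkCell hd hw hτ
    have : i = i' := dworkCell_injective (m := m) (hle.trans hsub)
    subst this
    exact hsub

end Subdivision

/-! ### Absolute convergence of Gamma series -/

lemma summable_pow_sum_natAbs {κ : Type*} [Fintype κ] {θ : ℝ} (h0 : 0 ≤ θ) (h1 : θ < 1) :
    Summable fun t : κ → ℤ => θ ^ ∑ k, (t k).natAbs := by
  classical
  have hZ : Summable fun z : ℤ => θ ^ z.natAbs := by
    refine Summable.of_nat_of_neg ?_ ?_ <;> simpa using summable_geometric_of_lt_one h0 h1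
  refine summable_of_sum_le (c := ∏ _k : κ, ∑' z : ℤ, θ ^ z.natAbs) (fun t => by positivity)
    fun s => ?_
  have hs : s ⊆ Fintype.piFinset fun k => s.image fun t => t k := fun t ht =>
    Fintype.mem_piFinset.2 fun k => Finset.mem_image_of_mem _ ht
  calc ∑ t ∈ s, θ ^ ∑ k, (t k).natAbs
      ≤ ∑ t ∈ Fintype.piFinset fun k => s.image fun t => t k, θ ^ ∑ k, (t k).natAbs :=
        Finset.sum_le_sum_of_subset_of_nonneg hs fun _ _ _ => by positivity
    _ = ∏ k : κ, ∑ z ∈ s.image fun t => t k, θ ^ z.natAbs := by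
        rw [Finset.prod_univ_sum]
        exact Finset.sum_congr rfl fun t _ => (Finset.prod_pow_eq_pow_sum _ _ _).symm
    _ ≤ _ := Finset.prod_le_prod (fun k _ => Finset.sum_nonneg fun _ _ => by positivity)
        fun k _ => hZ.sum_le_tsum _ fun _ _ => by positivity

section GammaTerm

variable {J : Type*} [Fintype J]

lemma gammaTerm_eq (γ x : J → ℂ) (u : J → ℤ) :
    gammaTerm γ x u = (∏ j, (Complex.Gamma (1 + (u j : ℂ) + γ j))⁻¹) *
      Complex.exp (pairing (fun j => (u j : ℂ) + γ j) x) := by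
  unfold gammaTerm pairing
  rw [Finset.prod_mul_distrib, Complex.exp_sum, mul_comm]

/-- The rate of growth of the Gamma factors of a Gamma series. -/
noncomputable def gammaRate (J : Type*) [Fintype J] : ℝ := Real.log (2 * 2 ^ Fintype.card J)

lemma gammaRate_nonneg : 0 ≤ gammaRate J :=
  Real.log_nonneg (one_le_mul_of_one_le_of_one_le one_le_two (one_le_pow₀ one_le_two))

lemma exists_prod_inv_Gamma_le (J : Type*) [Fintype J] (ρ : ℝ) : ∃ C > 0, ∀ γ : J → ℂ, ‖γ‖ ≤ ρ →
    ∀ u : J → ℤ, ∑ j, u j = 0 →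
      ∏ j, ‖(Complex.Gamma (1 + (u j : ℂ) + γ j))⁻¹‖ ≤
        C * Real.exp (gammaRate J * ∑ j, |(u j : ℝ)|) := by
  obtain ⟨C, hC, h⟩ := exists_norm_inv_Gamma_add_int_le ρ
  refine ⟨C ^ Fintype.card J, by positivity, fun γ hγ u hu => ?_⟩
  have h1 : ∏ j, ‖(Complex.Gamma (1 + (u j : ℂ) + γ j))⁻¹‖ ≤
      ∏ j, (C * 2 ^ (u j).natAbs * factWeight (u j)) :=
    Finset.prod_le_prod (fun _ _ => norm_nonneg _)
      fun j _ => h _ ((norm_le_pi_norm γ j).trans hγ) _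
  refine h1.trans ?_
  rw [Finset.prod_mul_distrib, Finset.prod_mul_distrib, Finset.prod_const, Finset.card_univ,
    Finset.prod_pow_eq_pow_sum, mul_assoc]
  refine mul_le_mul_of_nonneg_left ?_ (by positivity)
  refine (mul_le_mul_of_nonneg_left (prod_factWeight_le u hu) (by positivity)).trans_eq ?_
  rw [← mul_pow, gammaRate, mul_comm (Real.log _)]
  have e : ∑ j, |(u j : ℝ)| = ((∑ j, (u j).natAbs : ℕ) : ℝ) := by
    push_cast
    exact Finset.sum_congr rfl fun j _ => by rw [Nat.cast_natAbs, Int.cast_abs]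
  rw [e, Real.exp_nat_mul, Real.exp_log (by positivity)]

lemma norm_exp_pairing (γ x : J → ℂ) (u : J → ℤ) :
    ‖Complex.exp (pairing (fun j => (u j : ℂ) + γ j) x)‖ =
      Real.exp (pairing γ x).re * Real.exp (∑ j, (u j : ℝ) * (x j).re) := by
  rw [Complex.norm_exp, ← Real.exp_add]
  congr 1
  unfold pairing
  simp only [add_mul, Finset.sum_add_distrib, Complex.add_re, Complex.re_sum]
  rw [add_comm]
  congr 1
  refine Finset.sum_congr rfl fun j _ => ?_
  simp

/-- The size of the terms of a Gamma series, with room for a change of the variables, uniformly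
for bounded exponents. -/
lemma exists_norm_gammaTerm_le (ρ : ℝ) (x : J → ℂ) : ∃ C > 0, ∀ γ : J → ℂ, ‖γ‖ ≤ ρ →
    ∀ u : J → ℤ, ∑ j, u j = 0 →
    ‖∏ j, (Complex.Gamma (1 + (u j : ℂ) + γ j))⁻¹‖ *
        Real.exp ((pairing (fun j => (u j : ℂ) + γ j) x).re + norm1 fun j => (u j : ℂ) + γ j) ≤
      C * Real.exp ((gammaRate J + 1) * ∑ j, |(u j : ℝ)| + ∑ j, (u j : ℝ) * (x j).re) := by
  obtain ⟨C, hC, h⟩ := exists_prod_inv_Gamma_le J ρ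
  refine ⟨C * Real.exp (Fintype.card J * ρ * ‖x‖ + Fintype.card J * ρ), by positivity,
    fun γ hγ u hu => ?_⟩
  have hn : norm1 γ ≤ Fintype.card J * ρ := by
    unfold norm1
    refine (Finset.sum_le_sum fun j _ => (norm_le_pi_norm γ j).trans hγ).trans_eq ?_
    simp
  have h1 : (norm1 fun j => (u j : ℂ) + γ j) ≤ ∑ j, |(u j : ℝ)| + norm1 γ := by
    unfold norm1
    rw [← Finset.sum_add_distrib]
    refine Finset.sum_le_sum fun j _ => (norm_add_le _ _).trans ?_
    simp
  have h2 : (pairing γ x).re ≤ Fintype.card J * ρ * ‖x‖ :=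
    (Complex.re_le_norm _).trans ((norm_pairing_le γ x).trans
      (mul_le_mul_of_nonneg_right hn (norm_nonneg _)))
  have h3 := norm_exp_pairing γ x u
  rw [Complex.norm_exp] at h3
  rw [norm_prod, Real.exp_add, h3]
  calc _ ≤ (C * Real.exp (gammaRate J * ∑ j, |(u j : ℝ)|)) *
        (Real.exp (Fintype.card J * ρ * ‖x‖) * Real.exp (∑ j, (u j : ℝ) * (x j).re) *
        Real.exp (∑ j, |(u j : ℝ)| + Fintype.card J * ρ)) := by
        gcongr
        · exact h γ hγ u hu
        · linarith
    _ = _ := by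
        rw [add_mul, one_mul]
        simp only [Real.exp_add]
        ring

lemma norm_gammaTerm_le (γ x : J → ℂ) (u : J → ℤ) :
    ‖gammaTerm γ x u‖ ≤ ‖∏ j, (Complex.Gamma (1 + (u j : ℂ) + γ j))⁻¹‖ *
        Real.exp ((pairing (fun j => (u j : ℂ) + γ j) x).re + norm1 fun j => (u j : ℂ) + γ j) := by
  rw [gammaTerm_eq, norm_mul, Complex.norm_exp]
  gcongr
  exact le_add_of_nonneg_right (norm1_nonneg _)

/-- A term of a Gamma series vanishes if it has a negative integer exponent. -/
lemma gammaTerm_eq_zero {γ x : J → ℂ} {u : J → ℤ} {j : J} {g : ℤ} (hg : γ j = g)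
    (h : u j + g < 0) : gammaTerm γ x u = 0 := by
  unfold gammaTerm
  refine Finset.prod_eq_zero (Finset.mem_univ j) ?_
  obtain ⟨N, hN⟩ := Int.eq_ofNat_of_zero_le (by omega : 0 ≤ -(1 + u j + g))
  have e : (1 : ℂ) + (u j : ℂ) + γ j = -(N : ℂ) := by
    rw [hg]
    have : ((1 + u j + g : ℤ) : ℂ) = ((-(N : ℤ) : ℤ) : ℂ) := by congr 1; omega
    push_cast at this
    exact this
  rw [e, Complex.Gamma_neg_nat_eq_zero, inv_zero, mul_zero]

end GammaTerm

section FermatLattice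

variable {m n : ℕ} {d : ℕ} {a : Matrix (Fin n) (Fin m) ℕ}

/-- The lattice vector `∑ t_k b_k`. -/
def latticeVec (d : ℕ) (a : Matrix (Fin n) (Fin m) ℕ) (t : Fin m → ℤ) : Fin m ⊕ Fin n → ℤ :=
  Sum.elim (fun k => t k * d) fun j => -∑ k, t k * a j k

@[simp] lemma latticeVec_inl (t : Fin m → ℤ) (k : Fin m) :
    latticeVec d a t (.inl k) = t k * d := rfl

@[simp] lemma latticeVec_inr (t : Fin m → ℤ) (j : Fin n) :
    latticeVec d a t (.inr j) = -∑ k, t k * a j k := rfl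

lemma sum_smul_fermatB (t : Fin m → ℤ) : ∑ k, t k • fermatB d a k = latticeVec d a t := by
  funext x
  rw [Finset.sum_apply]
  rcases x with k | j
  · simp [fermatB, Pi.single_apply]
  · simp [fermatB]

/-- The parametrization of `L_A` by the basis `b_1, …, b_m`. -/
noncomputable def latticeEquiv (hd : 0 < d)
    (hB : Submodule.span ℤ (Set.range (fermatB d a)) = lattice (fermatA d a)) :
    (Fin m → ℤ) ≃ lattice (fermatA d a) :=
  Equiv.ofBijective (fun t => ⟨latticeVec d a t, by
      rw [← hB, ← sum_smul_fermatB]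
      exact Submodule.mem_span_range_iff_exists_fun ℤ |>.2 ⟨t, rfl⟩⟩)
    ⟨fun t t' h => by
      funext k
      have := congrFun (congrArg Subtype.val h) (.inl k)
      simp only [latticeVec_inl] at this
      exact mul_right_cancel₀ (by exact_mod_cast hd.ne') this,
     fun u => by
      obtain ⟨t, ht⟩ := (Submodule.mem_span_range_iff_exists_fun ℤ).1 (hB.symm ▸ u.2 :
        (u : Fin m ⊕ Fin n → ℤ) ∈ Submodule.span ℤ (Set.range (fermatB d a)))
      exact ⟨t, Subtype.ext (by rw [← ht, sum_smul_fermatB])⟩⟩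

lemma sum_latticeVec (ha : ∀ j, ∑ i, a i j = d) (t : Fin m → ℤ) : ∑ j, latticeVec d a t j = 0 := by
  rw [Fintype.sum_sum_type]
  simp only [latticeVec_inl, latticeVec_inr, Finset.sum_neg_distrib]
  rw [Finset.sum_comm]
  have : ∀ k, ∑ i, t k * (a i k : ℤ) = t k * d := fun k => by
    rw [← Finset.mul_sum, ← ha k]; push_cast; rfl
  simp [this]

lemma le_of_sum_eq (ha : ∀ j, ∑ i, a i j = d) (i : Fin n) (k : Fin m) : a i k ≤ d := by
  rw [← ha k]
  exact Finset.single_le_sum (f := fun i => a i k) (fun _ _ => Nat.zero_le _) (Finset.mem_univ i)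

lemma sum_abs_latticeVec_inr_le (ha : ∀ j, ∑ i, a i j = d) (t : Fin m → ℤ) :
    ∑ j, |(latticeVec d a t (.inr j) : ℝ)| ≤ d * ∑ k, |(t k : ℝ)| := by
  have h1 : ∀ j, |(latticeVec d a t (.inr j) : ℝ)| ≤ ∑ k, |(t k : ℝ)| * a j k := by
    intro j
    simp only [latticeVec_inr]
    push_cast
    rw [abs_neg]
    refine (Finset.abs_sum_le_sum_abs _ _).trans_eq (Finset.sum_congr rfl fun k _ => ?_)
    rw [abs_mul, abs_of_nonneg (Nat.cast_nonneg (a j k) : (0 : ℝ) ≤ _)]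
  refine (Finset.sum_le_sum fun j _ => h1 j).trans_eq ?_
  rw [Finset.sum_comm, Finset.mul_sum]
  refine Finset.sum_congr rfl fun k _ => ?_
  rw [← Finset.mul_sum, ← ha k]; push_cast; ring

lemma sum_abs_latticeVec_le (ha : ∀ j, ∑ i, a i j = d) (t : Fin m → ℤ) :
    ∑ j, |(latticeVec d a t j : ℝ)| ≤ 2 * d * ∑ k, |(t k : ℝ)| := by
  rw [Fintype.sum_sum_type]
  have h1 := sum_abs_latticeVec_inr_le ha t
  have h2 : ∑ k, |(latticeVec d a t (.inl k) : ℝ)| = d * ∑ k, |(t k : ℝ)| := by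
    rw [Finset.mul_sum]
    refine Finset.sum_congr rfl fun k _ => ?_
    simp only [latticeVec_inl]
    push_cast
    rw [abs_mul, abs_of_nonneg (Nat.cast_nonneg d : (0 : ℝ) ≤ _), mul_comm]
  linarith

/-- The part of the exponent `∑ u_j Re x_j + rate ∑ |u_j|` which does not come from the
variables `z_1, …, z_m`. -/
lemma latticeVec_exponent_le (ha : ∀ j, ∑ i, a i j = d) (t : Fin m → ℤ)
    (x : Fin m ⊕ Fin n → ℂ) (hx : ∀ j, |(x (.inr j)).re| ≤ 1) {L : ℝ} (hL : 0 ≤ L) :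
    L * ∑ j, |(latticeVec d a t j : ℝ)| + ∑ j, (latticeVec d a t j : ℝ) * (x j).re ≤
      2 * d * (L + 1) * ∑ k, |(t k : ℝ)| + ∑ k, (t k : ℝ) * d * (x (.inl k)).re := by
  have h1 := sum_abs_latticeVec_le ha t
  have h2 := sum_abs_latticeVec_inr_le ha t
  have h3 : ∑ j, (latticeVec d a t (.inr j) : ℝ) * (x (.inr j)).re ≤
      ∑ j, |(latticeVec d a t (.inr j) : ℝ)| := by
    refine Finset.sum_le_sum fun j _ => (le_abs_self _).trans ?_
    rw [abs_mul]
    exact mul_le_of_le_one_right (abs_nonneg _) (hx j)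
  rw [Fintype.sum_sum_type (fun j => (latticeVec d a t j : ℝ) * (x j).re)]
  have h4 : ∑ k, (latticeVec d a t (.inl k) : ℝ) * (x (.inl k)).re =
      ∑ k, (t k : ℝ) * d * (x (.inl k)).re := by
    refine Finset.sum_congr rfl fun k _ => ?_
    simp
  rw [h4]
  have h5 := mul_le_mul_of_nonneg_left h1 hL
  have h6 : (0 : ℝ) ≤ ∑ k, |(t k : ℝ)| := Finset.sum_nonneg fun _ _ => abs_nonneg _
  have h7 : (0 : ℝ) ≤ d * ∑ k, |(t k : ℝ)| := mul_nonneg (Nat.cast_nonneg d) h6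
  nlinarith

/-- The product of an integer `t`, bounded below, and a negative number is at most `-S |t|`, up to a
constant. -/
lemma int_mul_le_of_neg {t g : ℤ} {y S : ℝ} (h : 0 ≤ t + g) (hS : 0 ≤ S) (hy : y ≤ -S) :
    (t : ℝ) * y ≤ -S * |(t : ℝ)| + 2 * |(g : ℝ)| * |y| := by
  rw [abs_of_nonpos (by linarith : y ≤ 0)]
  rcases le_total 0 t with ht | ht
  · have ht' : (0 : ℝ) ≤ t := by exact_mod_cast ht
    rw [abs_of_nonneg ht']
    have : 0 ≤ 2 * |(g : ℝ)| * -y := mul_nonneg (by positivity) (by linarith)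
    nlinarith
  · have ht' : (t : ℝ) ≤ 0 := by exact_mod_cast ht
    have hg : -(t : ℝ) ≤ g := by
      have : (0 : ℝ) ≤ t + g := by exact_mod_cast h
      linarith
    rw [abs_of_nonpos ht', abs_of_nonneg (by linarith : (0 : ℝ) ≤ g)]
    nlinarith

lemma sum_natAbs_cast {κ : Type*} [Fintype κ] (t : κ → ℤ) :
    ((∑ k, (t k).natAbs : ℕ) : ℝ) = ∑ k, |(t k : ℝ)| := by
  push_cast
  exact Finset.sum_congr rfl fun j _ => by rw [Nat.cast_natAbs, Int.cast_abs]

lemma summable_of_norm_le_exp {κ ι : Type*} [Fintype κ] {f : ι → ℂ} {v : ι → κ → ℤ}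
    (hv : Function.Injective v) {C : ℝ}
    (h : ∀ t, ‖f t‖ ≤ C * Real.exp (-∑ k, |(v t k : ℝ)|)) : Summable f := by
  have hs := (summable_pow_sum_natAbs (κ := κ) (θ := Real.exp (-1)) (Real.exp_pos _).le
    (Real.exp_lt_one_iff.2 (by norm_num))).comp_injective hv
  refine Summable.of_norm_bounded (hs.mul_left C) fun t => (h t).trans_eq ?_
  simp only [Function.comp]
  rw [← Real.exp_nat_mul, sum_natAbs_cast]
  ring_nf

/-- A size of the variables for which the Gamma series converge. -/
noncomputable def radiusBound (m n d : ℕ) : ℝ :=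
  2 * d * (d + 1) * (gammaRate (Fin m ⊕ Fin n) + 2) + 1

lemma gammaTerm_latticeVec_eq_zero (hd : 0 < d) {γ x : Fin m ⊕ Fin n → ℂ} {k : Fin m} {g : ℤ}
    (hγ : γ (.inl k) = g) {t : Fin m → ℤ} (h : t k + |g| < 0) :
    gammaTerm γ x (latticeVec d a t) = 0 := by
  refine gammaTerm_eq_zero hγ ?_
  rw [latticeVec_inl]
  have h1 := le_abs_self g
  have h2 := abs_nonneg g
  have hd' : (1 : ℤ) ≤ d := by exact_mod_cast hd
  nlinarith

lemma rate_le_radiusBound (hd : 0 < d) :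
    2 * d * (gammaRate (Fin m ⊕ Fin n) + 2) + 1 ≤ radiusBound m n d := by
  have hL0 : 0 ≤ gammaRate (Fin m ⊕ Fin n) := gammaRate_nonneg
  unfold radiusBound
  have hd1 : (1 : ℝ) ≤ d := by exact_mod_cast hd
  have : 2 * d * (gammaRate (Fin m ⊕ Fin n) + 2) * 1 ≤
      2 * d * (gammaRate (Fin m ⊕ Fin n) + 2) * (d + 1) :=
    mul_le_mul_of_nonneg_left (by linarith) (by positivity)
  linarith

lemma radiusBound_pos : 0 < radiusBound m n d := by
  have hL0 : 0 ≤ gammaRate (Fin m ⊕ Fin n) := gammaRate_nonneg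
  unfold radiusBound; positivity

/-- The Gamma series with exponents integral outside the simplex `{m+1, …, m+n}` converge
absolutely where `z_1, …, z_m` are small. -/
lemma summable_gammaTerm_fer (hd : 0 < d) (ha : ∀ j, ∑ i, a i j = d) {T : ℝ}
    (hT : radiusBound m n d ≤ T) {γ x : Fin m ⊕ Fin n → ℂ} {g : Fin m → ℤ}
    (hγ : ∀ k, γ (.inl k) = g k) (hx1 : ∀ k, (x (.inl k)).re ≤ -T)
    (hx2 : ∀ j, |(x (.inr j)).re| ≤ 1) :
    Summable fun t : Fin m → ℤ => gammaTerm γ x (latticeVec d a t) := by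
  obtain ⟨C, hC, h⟩ := exists_norm_gammaTerm_le ‖γ‖ x
  set L := gammaRate (Fin m ⊕ Fin n) with hL
  have hL0 : 0 ≤ L := gammaRate_nonneg
  have hd1 : (1 : ℝ) ≤ d := by exact_mod_cast hd
  have hT' : 2 * d * (L + 2) + 1 ≤ T := (rate_le_radiusBound hd).trans hT
  have hT0 : 0 ≤ T := radiusBound_pos.le.trans hT
  refine summable_of_norm_le_exp (v := fun t => t) Function.injective_id
    (C := C * Real.exp (∑ k, 2 * |((|g k| : ℤ) : ℝ)| * |d * (x (.inl k)).re|)) fun t => ?_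
  by_cases hneg : ∃ k, t k + |g k| < 0
  · obtain ⟨k, hk⟩ := hneg
    rw [gammaTerm_latticeVec_eq_zero hd (hγ k) hk, norm_zero]; positivity
  · push Not at hneg
    refine ((norm_gammaTerm_le _ _ _).trans (h γ le_rfl _ (sum_latticeVec ha t))).trans ?_
    rw [mul_assoc, ← Real.exp_add]
    refine mul_le_mul_of_nonneg_left (Real.exp_le_exp.2 ?_) hC.le
    refine (latticeVec_exponent_le ha t x hx2 (by linarith)).trans ?_
    have h1 : ∑ k, (t k : ℝ) * d * (x (.inl k)).re ≤
        ∑ k, (-T * |(t k : ℝ)| + 2 * |((|g k| : ℤ) : ℝ)| * |d * (x (.inl k)).re|) := by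
      refine Finset.sum_le_sum fun k _ => ?_
      rw [mul_assoc]
      refine int_mul_le_of_neg (hneg k) hT0 ?_
      nlinarith [hx1 k]
    rw [Finset.sum_add_distrib, ← Finset.mul_sum] at h1
    have h6 : (0 : ℝ) ≤ ∑ k, |(t k : ℝ)| := Finset.sum_nonneg fun _ _ => abs_nonneg _
    nlinarith

lemma norm_expFer_le {p : Fin m → ℤ} (hd : 0 < d) (ha : ∀ j, ∑ i, a i j = d) {ρ : ℝ} {c : Fin n → ℂ}
    (hc : ‖c‖ ≤ ρ) : ‖expFer d a c p‖ ≤ ρ + ∑ k, |(p k : ℝ)| := by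
  have hρ : 0 ≤ ρ := (norm_nonneg c).trans hc
  have hd1 : (1 : ℝ) ≤ d := by exact_mod_cast hd
  rw [pi_norm_le_iff_of_nonneg (by positivity)]
  rintro (k | j)
  · have := Finset.single_le_sum (f := fun k => |(p k : ℝ)|) (fun _ _ => abs_nonneg _)
      (Finset.mem_univ k)
    simp only [expFer, Sum.elim_inl, Complex.norm_intCast]
    linarith
  · simp only [expFer, Sum.elim_inr]
    rw [norm_div, norm_neg, Complex.norm_natCast, div_le_iff₀ (by linarith), add_mul]
    refine (norm_add_le _ _).trans (add_le_add (((norm_le_pi_norm c j).trans hc).trans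
      (le_mul_of_one_le_right hρ hd1)) ?_)
    rw [Finset.sum_mul]
    refine (norm_sum_le _ _).trans (Finset.sum_le_sum fun k _ => ?_)
    rw [norm_mul, Complex.norm_intCast, Complex.norm_natCast]
    refine mul_le_mul_of_nonneg_left ?_ (abs_nonneg _)
    exact_mod_cast le_of_sum_eq ha j k

variable [NeZero m]

/-- The coordinates `(u_{m+i}, t_2, …, t_m)` of the lattice vector `u = ∑ t_k b_k`. -/
def dworkCoord (a : Matrix (Fin n) (Fin m) ℕ) (i : Fin n) (t : Fin m → ℤ) : Fin m → ℤ :=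
  fun k => if k = 0 then -∑ l, t l * a i l else t k

lemma sum_fin_eq_add {M : Type*} [AddCommMonoid M] (f : Fin m → M) :
    ∑ k, f k = f 0 + ∑ k : {k : Fin m // k ≠ 0}, f k :=
  Fintype.sum_eq_add_sum_subtype_ne f 0

lemma dworkCoord_injective {i : Fin n} (hi : a i 0 ≠ 0) : Function.Injective (dworkCoord a i) := by
  intro t t' h
  have hk : ∀ k, k ≠ 0 → t k = t' k := fun k hk => by simpa [dworkCoord, hk] using congrFun h k
  funext k
  by_cases h0 : k = 0
  · subst h0
    have h1 := congrFun h 0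
    simp only [dworkCoord, if_true, neg_inj, sum_fin_eq_add (fun l => t l * (a i l : ℤ)),
      sum_fin_eq_add (fun l => t' l * (a i l : ℤ))] at h1
    rw [Finset.sum_congr rfl fun (l : {k : Fin m // k ≠ 0}) _ => by rw [hk l l.2]] at h1
    exact mul_right_cancel₀ (by exact_mod_cast hi) (add_right_cancel h1)
  · exact hk k h0

/-- The Gamma series with exponents integral outside the simplex
`{1, m+1, …, m+n} ∖ {m+i}` converge absolutely where `z_1` is large and `z_2, …, z_m` are small. -/
lemma summable_gammaTerm_dwork (hd : 0 < d) (ha : ∀ j, ∑ i, a i j = d) {T : ℝ}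
    (hT : radiusBound m n d ≤ T) {i : Fin n} (hi : a i 0 ≠ 0) {γ x : Fin m ⊕ Fin n → ℂ}
    {g : Fin m → ℤ} (hγ : ∀ k, k ≠ 0 → γ (.inl k) = g k) (hγi : γ (.inr i) = g 0)
    (hx0 : T ≤ (x (.inl 0)).re) (hx1 : ∀ k, k ≠ 0 → (x (.inl k)).re ≤ -T)
    (hx2 : ∀ j, |(x (.inr j)).re| ≤ 1) :
    Summable fun t : Fin m → ℤ => gammaTerm γ x (latticeVec d a t) := by
  obtain ⟨C, hC, h⟩ := exists_norm_gammaTerm_le ‖γ‖ x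
  set L := gammaRate (Fin m ⊕ Fin n) with hL
  have hL0 : 0 ≤ L := gammaRate_nonneg
  have hd1 : (1 : ℝ) ≤ d := by exact_mod_cast hd
  have hT0 : 0 ≤ T := radiusBound_pos.le.trans hT
  set X := (x (.inl 0)).re with hX
  have hai : (1 : ℝ) ≤ a i 0 := by exact_mod_cast Nat.one_le_iff_ne_zero.2 hi
  set r : ℝ := d * X / a i 0 with hr
  have hdai : (a i 0 : ℝ) ≤ d := by exact_mod_cast le_of_sum_eq ha i 0
  have hX0 : 0 ≤ X := hT0.trans hx0
  have hrT : T ≤ r := by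
    rw [hr, le_div_iff₀ (by linarith)]
    nlinarith
  set y : Fin m → ℝ := fun k => if k = 0 then -r else -r * a i k + d * (x (.inl k)).re with hy
  refine summable_of_norm_le_exp (dworkCoord_injective hi)
    (C := C * Real.exp (∑ k, 2 * |((|g k| : ℤ) : ℝ)| * |y k|)) fun t => ?_
  set v := dworkCoord a i t with hv
  by_cases hneg : ∃ k, v k + |g k| < 0
  · obtain ⟨k, hk⟩ := hneg
    have hz : gammaTerm γ x (latticeVec d a t) = 0 := by
      by_cases h0 : k = 0
      · subst h0
        refine gammaTerm_eq_zero hγi ?_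
        have e : v 0 = latticeVec d a t (.inr i) := by simp [hv, dworkCoord]
        rw [← e]
        linarith [le_abs_self (g 0)]
      · refine gammaTerm_latticeVec_eq_zero hd (hγ k h0) ?_
        simpa [hv, dworkCoord, h0] using hk
    rw [hz, norm_zero]; positivity
  · push Not at hneg
    refine ((norm_gammaTerm_le _ _ _).trans (h γ le_rfl _ (sum_latticeVec ha t))).trans ?_
    rw [mul_assoc, ← Real.exp_add]
    refine mul_le_mul_of_nonneg_left (Real.exp_le_exp.2 ?_) hC.le
    refine (latticeVec_exponent_le ha t x hx2 (by linarith)).trans ?_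
    have hvk : ∀ k : {k : Fin m // k ≠ 0}, v k = t k := fun k => by simp [hv, dworkCoord, k.2]
    have hv0 : (v 0 : ℝ) = -(t 0 * a i 0 + ∑ k : {k : Fin m // k ≠ 0}, (t k : ℝ) * a i k) := by
      have : v 0 = -(t 0 * a i 0 + ∑ k : {k : Fin m // k ≠ 0}, t k * (a i k : ℤ)) := by
        simp only [hv, dworkCoord, if_true]
        rw [sum_fin_eq_add fun l => t l * (a i l : ℤ)]
      rw [this]; push_cast; rfl
    have h1 : ∑ k, (v k : ℝ) * y k ≤ ∑ k, (-T * |(v k : ℝ)| + 2 * |((|g k| : ℤ) : ℝ)| * |y k|) := by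
      refine Finset.sum_le_sum fun k _ => int_mul_le_of_neg (hneg k) hT0 ?_
      by_cases h0 : k = 0
      · simp only [hy, h0, if_true]; linarith
      · simp only [hy, h0, if_false]
        have e1 : 0 ≤ r * a i k := mul_nonneg (hT0.trans hrT) (Nat.cast_nonneg _)
        nlinarith [hx1 k h0]
    rw [Finset.sum_add_distrib, ← Finset.mul_sum] at h1
    have h2 : ∑ k, (t k : ℝ) * d * (x (.inl k)).re = ∑ k, (v k : ℝ) * y k := by
      rw [sum_fin_eq_add (fun k => (t k : ℝ) * d * (x (.inl k)).re),
        sum_fin_eq_add (fun k => (v k : ℝ) * y k)]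
      have e1 : ∑ k : {k : Fin m // k ≠ 0}, (v k : ℝ) * y k =
          -r * ∑ k : {k : Fin m // k ≠ 0}, (t k : ℝ) * a i k +
          ∑ k : {k : Fin m // k ≠ 0}, (t k : ℝ) * d * (x (.inl k)).re := by
        rw [Finset.mul_sum, ← Finset.sum_add_distrib]
        refine Finset.sum_congr rfl fun k _ => ?_
        rw [hvk]
        simp only [hy, k.2, if_false]; ring
      rw [e1, hv0]
      simp only [hy, if_true, hr]
      field_simp
      ring
    have h3 : |(t 0 : ℝ)| ≤ |(v 0 : ℝ)| + d * ∑ k : {k : Fin m // k ≠ 0}, |(v k : ℝ)| := by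
      have e1 : (t 0 : ℝ) * a i 0 = -v 0 - ∑ k : {k : Fin m // k ≠ 0}, (v k : ℝ) * a i k := by
        simp only [hvk]
        rw [hv0]; ring
      have e2 : |∑ k : {k : Fin m // k ≠ 0}, (v k : ℝ) * a i k| ≤
          d * ∑ k : {k : Fin m // k ≠ 0}, |(v k : ℝ)| := by
        rw [Finset.mul_sum]
        refine (Finset.abs_sum_le_sum_abs _ _).trans (Finset.sum_le_sum fun k _ => ?_)
        rw [abs_mul, mul_comm, Nat.abs_cast]
        refine mul_le_mul_of_nonneg_right ?_ (abs_nonneg _)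
        exact_mod_cast le_of_sum_eq ha i k
      calc |(t 0 : ℝ)| ≤ |(t 0 : ℝ)| * a i 0 := le_mul_of_one_le_right (abs_nonneg _) hai
        _ = |(t 0 : ℝ) * a i 0| := by rw [abs_mul, Nat.abs_cast]
        _ ≤ _ := by
          rw [e1]
          refine (abs_sub _ _).trans ?_
          rw [abs_neg]
          linarith
    have h4 : ∑ k, |(t k : ℝ)| ≤ (d + 1) * ∑ k, |(v k : ℝ)| := by
      rw [sum_fin_eq_add (fun k => |(t k : ℝ)|), sum_fin_eq_add (fun k => |(v k : ℝ)|)]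
      simp only [hvk] at h3 ⊢
      have := abs_nonneg (v 0 : ℝ)
      nlinarith
    have h6 : (0 : ℝ) ≤ ∑ k, |(v k : ℝ)| := Finset.sum_nonneg fun _ _ => abs_nonneg _
    have h7 : 2 * d * (L + 2) * ∑ k, |(t k : ℝ)| ≤ 2 * d * (L + 2) * ((d + 1) * ∑ k, |(v k : ℝ)|) :=
      mul_le_mul_of_nonneg_left h4 (by positivity)
    have h8 : 2 * d * (d + 1) * (L + 2) + 1 ≤ T := hT
    have h9 := mul_le_mul_of_nonneg_right h8 h6
    have e10 : L + 1 + 1 = L + 2 := by ring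
    rw [h2, e10]
    linarith

end FermatLattice

/-! ### The path and the two domains of convergence -/

section Path

variable {m n d : ℕ} {a : Matrix (Fin n) (Fin m) ℕ}

lemma mem_convergenceDomain {I J : Type*} [Fintype I] [Fintype J] {A : Matrix I J ℤ}
    {T : Set (Finset J)} (b : J → ℂ)
    (h : ∀ x : J → ℂ, (∀ j, |(x j).re - (b j).re| < 1) → ∀ σ ∈ T, ∀ γ : J → ℂ, IntegralOff σ γ →
      Summable fun u : lattice A => gammaTerm γ x u) :
    (fun j => Complex.exp (b j)) ∈ convergenceDomain A T := by
  rw [convergenceDomain, mem_interior_iff_mem_nhds]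
  have h0 : ∀ᶠ z : J → ℂ in 𝓝 fun j => Complex.exp (b j), ∀ j, z j ≠ 0 :=
    eventually_all.2 fun j => (continuous_apply j).continuousAt.eventually_ne (Complex.exp_ne_zero _)
  have h1 : ∀ᶠ z : J → ℂ in 𝓝 fun j => Complex.exp (b j), ∀ j, |Real.log ‖z j‖ - (b j).re| < 1 := by
    refine eventually_all.2 fun j => ?_
    have hc : ContinuousAt (fun z : J → ℂ => |Real.log ‖z j‖ - (b j).re|)
        fun j => Complex.exp (b j) := by
      refine (ContinuousAt.sub (ContinuousAt.log (continuous_apply j).continuousAt.norm ?_) continuousAt_const).abs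
      simp
    refine hc.eventually_lt continuousAt_const ?_
    simp [Complex.norm_exp]
  filter_upwards [h0, h1] with z hz0 hz1
  refine ⟨hz0, fun x hx => h x fun j => ?_⟩
  have := hz1 j
  rwa [← hx j, Complex.norm_exp, Real.log_exp] at this

lemma gammaSeries_eq_tsum (hd : 0 < d)
    (hB : Submodule.span ℤ (Set.range (fermatB d a)) = lattice (fermatA d a))
    (γ x : Fin m ⊕ Fin n → ℂ) :
    gammaSeries (fermatA d a) γ x = ∑' t, gammaTerm γ x (latticeVec d a t) :=
  ((latticeEquiv hd hB).tsum_eq fun u => gammaTerm γ x u).symm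

lemma summable_gammaTerm_lattice_iff (hd : 0 < d)
    (hB : Submodule.span ℤ (Set.range (fermatB d a)) = lattice (fermatA d a))
    (γ x : Fin m ⊕ Fin n → ℂ) :
    (Summable fun u : lattice (fermatA d a) => gammaTerm γ x u) ↔
      Summable fun t => gammaTerm γ x (latticeVec d a t) :=
  ((latticeEquiv hd hB).summable_iff
    (f := fun u : lattice (fermatA d a) => gammaTerm γ x (u : Fin m ⊕ Fin n → ℤ))).symm

variable [NeZero m]

/-- The logarithms of the coordinates of the points of the path: `z_2, …, z_m` are small,
`z_{m+1} = ⋯ = z_{m+n} = 1`, and `z_1` lies on the ray of argument `-π (d - 1) / d`. -/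
noncomputable def basePoint (m n d : ℕ) [NeZero m] (T τ : ℝ) : Fin m ⊕ Fin n → ℂ :=
  Sum.elim (fun k => if k = 0 then (τ : ℂ) - (Real.pi * (d - 1) / d : ℝ) * Complex.I else -T)
    fun _ => 0

lemma basePoint_re_zero (T τ : ℝ) : (basePoint m n d T τ (.inl 0)).re = τ := by
  simp [basePoint, -Complex.ofReal_mul, -Complex.ofReal_div, -Complex.ofReal_sub]

lemma basePoint_inl {k : Fin m} (hk : k ≠ 0) (T τ : ℝ) : basePoint m n d T τ (.inl k) = -T := by
  simp [basePoint, hk]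

@[simp] lemma basePoint_inr (j : Fin n) (T τ : ℝ) : basePoint m n d T τ (.inr j) = 0 := rfl

/-- The path along which the series are continued. -/
noncomputable def dworkPath (m n d : ℕ) [NeZero m] (T : ℝ) : C(unitInterval, Fin m ⊕ Fin n → ℂ) where
  toFun t := basePoint m n d T (-T + 2 * T * t)
  continuous_toFun := by
    refine continuous_pi fun j => ?_
    rcases j with k | j
    · by_cases hk : k = 0
      · simp only [basePoint, hk, Sum.elim_inl, if_true]; fun_prop
      · simp only [basePoint, hk, Sum.elim_inl, if_false]; fun_prop
    · exact continuous_const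

lemma dworkPath_apply (T : ℝ) (t : unitInterval) :
    dworkPath m n d T t = basePoint m n d T (-T + 2 * T * t) := rfl

lemma dworkPath_zero (T : ℝ) : dworkPath m n d T 0 = basePoint m n d T (-T) := by
  simp [dworkPath_apply]

lemma dworkPath_one (T : ℝ) : dworkPath m n d T 1 = basePoint m n d T T := by
  rw [dworkPath_apply]; congr 1; simp; ring

/-- The real parts of the coordinates of a point near the start of the path. -/
lemma near_start {T : ℝ} {x : Fin m ⊕ Fin n → ℂ}
    (h : ∀ j, |(x j).re - (basePoint m n d T (-T) j).re| < 1) :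
    (∀ k, (x (.inl k)).re ≤ -(T - 1)) ∧ ∀ j, |(x (.inr j)).re| ≤ 1 := by
  refine ⟨fun k => ?_, fun j => ?_⟩
  · have := (abs_lt.1 (h (.inl k))).2
    by_cases hk : k = 0
    · subst hk
      rw [basePoint_re_zero] at this; linarith
    · rw [basePoint_inl hk] at this
      simp at this; linarith
  · have := h (.inr j)
    simp at this; exact this.le

/-- The real parts of the coordinates of a point near the end of the path. -/
lemma near_end {T : ℝ} {x : Fin m ⊕ Fin n → ℂ}
    (h : ∀ j, |(x j).re - (basePoint m n d T T j).re| < 1) :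
    T - 1 ≤ (x (.inl 0)).re ∧ (∀ k, k ≠ 0 → (x (.inl k)).re ≤ -(T - 1)) ∧
      ∀ j, |(x (.inr j)).re| ≤ 1 := by
  refine ⟨?_, fun k hk => ?_, fun j => ?_⟩
  · have := (abs_lt.1 (h (.inl 0))).1
    rw [basePoint_re_zero] at this; linarith
  · have := (abs_lt.1 (h (.inl k))).2
    rw [basePoint_inl hk] at this
    simp at this; linarith
  · have := h (.inr j)
    simp at this; exact this.le

lemma start_mem_convergenceDomain (hd : 0 < d) (ha : ∀ j, ∑ i, a i j = d)
    (hB : Submodule.span ℤ (Set.range (fermatB d a)) = lattice (fermatA d a)) {T : ℝ}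
    (hT : radiusBound m n d + 1 ≤ T) :
    (fun j => Complex.exp (dworkPath m n d T 0 j)) ∈
      convergenceDomain (fermatA d a) (cellsFer m n) := by
  rw [dworkPath_zero]
  refine mem_convergenceDomain _ fun x hx σ hσ γ hγ => ?_
  rw [cellsFer, Set.mem_singleton_iff] at hσ
  subst hσ
  rw [summable_gammaTerm_lattice_iff hd hB]
  choose g hg using fun k : Fin m => hγ (.inl k) (by simp)
  obtain ⟨h1, h2⟩ := near_start hx
  exact summable_gammaTerm_fer hd ha (by linarith) hg h1 h2

lemma end_mem_convergenceDomain (hd : 0 < d) (ha : ∀ j, ∑ i, a i j = d)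
    (hB : Submodule.span ℤ (Set.range (fermatB d a)) = lattice (fermatA d a)) {T : ℝ}
    (hT : radiusBound m n d + 1 ≤ T) :
    (fun j => Complex.exp (dworkPath m n d T 1 j)) ∈
      convergenceDomain (fermatA d a) (cellsDwork a) := by
  rw [dworkPath_one]
  refine mem_convergenceDomain _ fun x hx σ hσ γ hγ => ?_
  obtain ⟨i, hi, rfl⟩ := hσ
  rw [summable_gammaTerm_lattice_iff hd hB]
  have hk : ∀ k : Fin m, ∃ g : ℤ, (k ≠ 0 → γ (.inl k) = g) ∧ (k = 0 → γ (.inr i) = g) := by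
    intro k
    by_cases hk : k = 0
    · obtain ⟨g, hg⟩ := hγ (.inr i) (by simp)
      exact ⟨g, fun h => absurd hk h, fun _ => hg⟩
    · obtain ⟨g, hg⟩ := hγ (.inl k) (by simp [hk])
      exact ⟨g, fun _ => hg, fun h => absurd h hk⟩
  choose g hg1 hg2 using hk
  obtain ⟨h0, h1, h2⟩ := near_end hx
  exact summable_gammaTerm_dwork hd ha (by linarith) hi hg1 (hg2 0 rfl) h0 h1 h2

end Path

/-! ### The Mellin–Barnes kernel -/

lemma norm_sin_le (z : ℂ) : ‖Complex.sin z‖ ≤ Real.exp |z.im| := by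
  rw [Complex.sin, norm_div, norm_mul, Complex.norm_I, mul_one, Complex.norm_ofNat,
    div_le_iff₀ two_pos]
  refine (norm_sub_le _ _).trans ?_
  rw [Complex.norm_exp, Complex.norm_exp, mul_two]
  refine add_le_add (Real.exp_le_exp.2 ?_) (Real.exp_le_exp.2 ?_)
  · simpa using le_abs_self z.im
  · simpa using neg_le_abs z.im

/-- A lower bound for the sine away from its zeros. -/
lemma exists_le_norm_sin {v : ℝ} (hv : 0 < v) : ∃ κ > 0, ∀ z : ℂ,
    (Real.cos z.re = 0 ∨ v ≤ |z.im|) → κ * Real.exp |z.im| ≤ ‖Complex.sin z‖ := by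
  have h1 : Real.exp (-(2 * v)) < 1 := Real.exp_lt_one_iff.2 (by linarith)
  refine ⟨(1 - Real.exp (-(2 * v))) / 2, by linarith, fun z hz => ?_⟩
  rcases hz with hz | hz
  · have e : ‖Complex.sin z‖ = Real.cosh z.im := by
      have hs : |Real.sin z.re| = 1 := by
        have := Real.sin_sq_add_cos_sq z.re
        rw [hz] at this
        have h2 : Real.sin z.re ^ 2 = 1 := by linarith
        exact (pow_eq_one_iff_of_nonneg (abs_nonneg _) two_ne_zero).1 (by rw [sq_abs]; exact h2)
      conv_lhs => rw [← Complex.re_add_im z]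
      rw [Complex.sin_add_mul_I, ← Complex.ofReal_cos, hz, Complex.ofReal_zero, zero_mul, zero_mul,
        add_zero, norm_mul, ← Complex.ofReal_sin, Complex.norm_real, Real.norm_eq_abs, hs, one_mul,
        ← Complex.ofReal_cosh, Complex.norm_real, Real.norm_of_nonneg (Real.cosh_pos _).le]
    rw [e, ← Real.cosh_abs, Real.cosh_eq]
    have := Real.exp_pos (-|z.im|)
    have h3 := Real.exp_pos |z.im|
    have h4 := Real.exp_pos (-(2 * v))
    nlinarith
  · have e : Real.exp |z.im| - Real.exp (-|z.im|) ≤ 2 * ‖Complex.sin z‖ := by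
      have h2 : ‖Complex.sin z‖ = ‖Complex.exp (-z * Complex.I) - Complex.exp (z * Complex.I)‖ / 2 := by
        rw [Complex.sin, norm_div, norm_mul, Complex.norm_I, mul_one, Complex.norm_ofNat]
      have n1 : ‖Complex.exp (-z * Complex.I)‖ = Real.exp z.im := by simp [Complex.norm_exp]
      have n2 : ‖Complex.exp (z * Complex.I)‖ = Real.exp (-z.im) := by simp [Complex.norm_exp]
      have h3 := abs_norm_sub_norm_le (Complex.exp (-z * Complex.I)) (Complex.exp (z * Complex.I))
      rw [n1, n2] at h3
      rw [h2]
      rcases abs_cases z.im with ⟨ha, _⟩ | ⟨ha, _⟩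
      · rw [ha]; linarith [le_abs_self (Real.exp z.im - Real.exp (-z.im))]
      · rw [ha, neg_neg]; linarith [neg_le_abs (Real.exp z.im - Real.exp (-z.im))]
    have h5 : Real.exp (-|z.im|) ≤ Real.exp (-(2 * v)) * Real.exp |z.im| := by
      rw [← Real.exp_add]
      exact Real.exp_le_exp.2 (by linarith)
    linarith

section Kernel

variable {m n : ℕ} [NeZero m]

/-- The indices `2, …, m`. -/
abbrev Rest (m : ℕ) [NeZero m] : Type := {k : Fin m // k ≠ 0}

/-- The vector with first coordinate `t₀` and remaining coordinates `t`. -/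
def cons0 (t₀ : ℤ) (t : Rest m → ℤ) : Fin m → ℤ := fun k => if h : k = 0 then t₀ else t ⟨k, h⟩

@[simp] lemma cons0_zero (t₀ : ℤ) (t : Rest m → ℤ) : cons0 t₀ t 0 = t₀ := by simp [cons0]

@[simp] lemma cons0_rest (t₀ : ℤ) (t : Rest m → ℤ) (k : Rest m) : cons0 t₀ t k = t k := by
  simp [cons0, k.2]

/-- The argument `(c_j + s a_{j1} + ∑_{k ≥ 2} (p_k + t_k d) a_{jk}) / d` of the `j`-th Gamma
factor. -/
noncomputable def uArg (d : ℕ) (a : Matrix (Fin n) (Fin m) ℕ) (c : Fin n → ℂ) (p : Fin m → ℤ)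
    (t : Rest m → ℤ) (j : Fin n) (s : ℂ) : ℂ :=
  (c j + s * a j 0 + ∑ k : Rest m, ((p k : ℂ) + t k * d) * a j k) / d

/-- The `j`-th factor of the Mellin–Barnes kernel. By the reflection formula it agrees with
`1 / Γ(1 - u_j)` up to sign at the points `s ∈ p_1 + d ℤ`; if `a_{j1} = 0`, then `u_j` does not
depend on `s`. -/
noncomputable def mbFactor (d : ℕ) (a : Matrix (Fin n) (Fin m) ℕ) (c : Fin n → ℂ) (p : Fin m → ℤ)
    (t : Rest m → ℤ) (j : Fin n) (s : ℂ) : ℂ :=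
  if a j 0 = 0 then (Complex.Gamma (1 - uArg d a c p t j s))⁻¹
  else Complex.sin (Real.pi * uArg d a c p t j (p 0)) / Real.pi *
    Complex.Gamma (uArg d a c p t j s)

/-- The product of the Gamma factors of the Mellin–Barnes kernel. -/
noncomputable def mbGamma (d : ℕ) (a : Matrix (Fin n) (Fin m) ℕ) (c : Fin n → ℂ) (p : Fin m → ℤ)
    (t : Rest m → ℤ) (s : ℂ) : ℂ :=
  (∏ k : Rest m, (Complex.Gamma (1 + ((t k * d : ℤ) : ℂ) + p k))⁻¹) * (Complex.Gamma (1 + s))⁻¹ *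
    ∏ j, mbFactor d a c p t j s

/-- The trigonometric factor of the Mellin–Barnes kernel, with simple poles at `p_1 + d ℤ`. -/
noncomputable def mbTrig (d : ℕ) (p₀ : ℤ) (s : ℂ) : ℂ :=
  Real.pi / d * Complex.exp (Real.pi * (d - 1) / d * (s - p₀) * Complex.I) /
    Complex.sin (Real.pi / d * (s - p₀))

/-- The exponents of the variables in the Mellin–Barnes integrand. -/
noncomputable def mbExp (d : ℕ) (a : Matrix (Fin n) (Fin m) ℕ) (c : Fin n → ℂ) (p : Fin m → ℤ)
    (t : Rest m → ℤ) (s : ℂ) : Fin m ⊕ Fin n → ℂ :=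
  Sum.elim (fun k => if h : k = 0 then s else (p k : ℂ) + t ⟨k, h⟩ * d)
    fun j => -uArg d a c p t j s

variable {d : ℕ} {a : Matrix (Fin n) (Fin m) ℕ} {p : Fin m → ℤ}

/-- The part of `u_j` independent of `s` and of the summation indices. -/
noncomputable def uBase (d : ℕ) (a : Matrix (Fin n) (Fin m) ℕ) (c : Fin n → ℂ) (p : Fin m → ℤ)
    (j : Fin n) : ℂ := (c j + ∑ k : Rest m, (p k : ℂ) * a j k) / d

/-- The integral part of `u_j`, which depends on the summation indices. -/
def uInt (a : Matrix (Fin n) (Fin m) ℕ) (t : Rest m → ℤ) (j : Fin n) : ℤ :=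
  ∑ k : Rest m, t k * a j k

lemma uArg_eq (hd : 0 < d) (c : Fin n → ℂ) (t : Rest m → ℤ) (j : Fin n) (s : ℂ) :
    uArg d a c p t j s = uBase d a c p j + uInt a t j + s * (a j 0 / d) := by
  have hd' : (d : ℂ) ≠ 0 := by exact_mod_cast hd.ne'
  unfold uArg uBase uInt
  push_cast
  have : ∑ k : Rest m, ((p k : ℂ) + t k * d) * a j k =
      ∑ k : Rest m, (p k : ℂ) * a j k + d * ∑ k : Rest m, (t k : ℂ) * a j k := by
    rw [Finset.mul_sum, ← Finset.sum_add_distrib]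
    exact Finset.sum_congr rfl fun k _ => by ring
  rw [this]
  field_simp
  ring

/-- A bound for `uBase`. -/
noncomputable def uBound (p : Fin m → ℤ) (ρ : ℝ) : ℝ := ρ + ∑ k : Rest m, |(p k : ℝ)|

lemma norm_uBase_le (hd : 0 < d) (ha : ∀ j, ∑ i, a i j = d) {ρ : ℝ} {c : Fin n → ℂ}
    (hc : ‖c‖ ≤ ρ) (j : Fin n) : ‖uBase d a c p j‖ ≤ uBound p ρ := by
  have hd1 : (1 : ℝ) ≤ d := by exact_mod_cast hd
  unfold uBase uBound
  rw [norm_div, Complex.norm_natCast, div_le_iff₀ (by linarith), add_mul]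
  have hρ : 0 ≤ ρ := (norm_nonneg c).trans hc
  refine (norm_add_le _ _).trans (add_le_add (((norm_le_pi_norm c j).trans hc).trans
    (le_mul_of_one_le_right hρ hd1)) ?_)
  rw [Finset.sum_mul]
  refine (norm_sum_le _ _).trans (Finset.sum_le_sum fun k _ => ?_)
  rw [norm_mul, Complex.norm_intCast, Complex.norm_natCast]
  refine mul_le_mul_of_nonneg_left ?_ (abs_nonneg _)
  exact_mod_cast le_of_sum_eq ha j k

lemma uBound_nonneg {ρ : ℝ} (hρ : 0 ≤ ρ) : 0 ≤ uBound p ρ := by unfold uBound; positivity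

/-- A lower bound for `uInt`, as a natural number. -/
def uLow (d : ℕ) (p : Fin m → ℤ) : ℕ := ∑ k : Rest m, (p k).natAbs * d

lemma neg_uLow_le (ha : ∀ j, ∑ i, a i j = d) {t : Rest m → ℤ}
    (ht : ∀ k : Rest m, 0 ≤ t k + |p k|) (j : Fin n) : -(uLow d p : ℤ) ≤ uInt a t j := by
  unfold uLow uInt
  push_cast
  rw [← Finset.sum_neg_distrib]
  refine Finset.sum_le_sum fun k _ => ?_
  have h1 := ht k
  have h2 : (a j k : ℤ) ≤ d := by exact_mod_cast le_of_sum_eq ha j k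
  have h3 : (0 : ℤ) ≤ a j k := Int.natCast_nonneg _
  have h4 := abs_nonneg (p k)
  nlinarith

lemma uInt_eq (t : Rest m → ℤ) (j : Fin n) :
    latticeVec d a (cons0 0 t) (.inr j) = -uInt a t j := by
  rw [latticeVec_inr, sum_fin_eq_add (fun k => cons0 0 t k * (a j k : ℤ))]
  simp [uInt]

lemma sum_abs_cons0 (t : Rest m → ℤ) : ∑ k, |((cons0 0 t k : ℤ) : ℝ)| = ∑ k, |(t k : ℝ)| := by
  rw [sum_fin_eq_add (fun k => |((cons0 0 t k : ℤ) : ℝ)|)]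
  simp

lemma sum_abs_uInt_le (ha : ∀ j, ∑ i, a i j = d) (t : Rest m → ℤ) :
    ∑ j, |(uInt a t j : ℝ)| ≤ d * ∑ k, |(t k : ℝ)| := by
  have := sum_abs_latticeVec_inr_le ha (cons0 0 t)
  rw [sum_abs_cons0] at this
  simpa [uInt_eq, -latticeVec_inr] using this

lemma sum_div_eq_one (hd : 0 < d) (ha : ∀ j, ∑ i, a i j = d) :
    ∑ j with a j 0 ≠ 0, ((a j 0 : ℂ) / d) = 1 := by
  have hd' : (d : ℂ) ≠ 0 := by exact_mod_cast hd.ne'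
  rw [← Finset.sum_div, div_eq_one_iff_eq hd', Finset.sum_filter_of_ne]
  · exact_mod_cast ha 0
  · intro j _ h h0
    exact h (by simp [h0])

lemma filter_nonempty (hd : 0 < d) (ha : ∀ j, ∑ i, a i j = d) :
    (Finset.univ.filter fun j => a j 0 ≠ 0).Nonempty := by
  by_contra h
  rw [Finset.not_nonempty_iff_eq_empty] at h
  have := sum_div_eq_one hd ha
  rw [h] at this
  simp at this

/-- A real part of `s` to the right of which all arguments `u_j` have real part at least `1`. -/
noncomputable def mbAbscissa (n d : ℕ) (p : Fin m → ℤ) (ρ : ℝ) : ℝ :=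
  d * (uBound p ρ + uLow d p + 1) + 1 + n * (uBound p ρ + ⌈uBound p ρ + uLow d p⌉₊)

lemma one_le_re_uArg (hd : 0 < d) (ha : ∀ j, ∑ i, a i j = d) {ρ : ℝ} {c : Fin n → ℂ}
    (hc : ‖c‖ ≤ ρ) {t : Rest m → ℤ} (ht : ∀ k : Rest m, 0 ≤ t k + |p k|) {j : Fin n}
    (hj : a j 0 ≠ 0) {s : ℂ} (hs : mbAbscissa n d p ρ ≤ s.re) : 1 ≤ (uArg d a c p t j s).re := by
  have hd' : (0 : ℝ) < d := by exact_mod_cast hd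
  have hρ : 0 ≤ ρ := (norm_nonneg c).trans hc
  have hj1 : (1 : ℝ) ≤ a j 0 := by exact_mod_cast Nat.one_le_iff_ne_zero.2 hj
  have h1 := (abs_le.1 ((Complex.abs_re_le_norm _).trans (norm_uBase_le (p := p) hd ha hc j))).1
  have h2 : -(uLow d p : ℝ) ≤ uInt a t j := by exact_mod_cast neg_uLow_le ha ht j
  have hb := uBound_nonneg (p := p) hρ
  have h3 : uBound p ρ + uLow d p + 1 ≤ s.re * (a j 0 / d) := by
    rw [mul_div_assoc', le_div_iff₀ hd']
    have h4 : d * (uBound p ρ + uLow d p + 1) ≤ s.re := by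
      refine le_trans ?_ hs
      unfold mbAbscissa
      have : 0 ≤ (n : ℝ) * (uBound p ρ + ⌈uBound p ρ + uLow d p⌉₊) := by positivity
      linarith
    have h5 : 0 ≤ s.re := le_trans (by positivity) h4
    nlinarith
  rw [uArg_eq hd]
  have e : (s * ((a j 0 : ℂ) / d)).re = s.re * (a j 0 / d) := by
    have : ((a j 0 : ℂ) / d) = ((a j 0 / d : ℝ) : ℂ) := by push_cast; rfl
    rw [this, Complex.re_mul_ofReal]
  simp only [Complex.add_re, Complex.intCast_re, e]
  linarith

set_option maxHeartbeats 1000000 in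
/-- The Gamma factors of the Mellin–Barnes integrand grow at most exponentially in the summation
indices, and on vertical lines in the right half plane they grow arbitrarily slowly, at a rate
that does not depend on the parameters. -/
theorem exists_norm_mbGamma_le (hd : 0 < d) (ha : ∀ j, ∑ i, a i j = d) {η : ℝ} (hη : 0 < η) :
    ∃ L ≥ 0, ∀ (p : Fin m → ℤ) (ρ β : ℝ), ∃ C > 0, ∀ c : Fin n → ℂ, ‖c‖ ≤ ρ →
      ∀ t : Rest m → ℤ, (∀ k : Rest m, 0 ≤ t k + |p k|) →
      ∀ s : ℂ, mbAbscissa n d p ρ ≤ s.re → s.re ≤ β →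
        ‖mbGamma d a c p t s‖ ≤ C * Real.exp (L * ∑ k, |(t k : ℝ)| + η * |s.im|) := by
  obtain ⟨A, hA1, hA⟩ := exists_prod_one_add_div_le η hη
  have hA0 : 0 < A := by linarith
  set L0 := gammaRate (Fin m ⊕ Fin n) with hL0
  have hL0n : 0 ≤ L0 := gammaRate_nonneg
  have hlogA : 0 ≤ Real.log A := Real.log_nonneg hA1
  refine ⟨2 * d * (L0 + Real.log A), by positivity, fun p ρ β => ?_⟩
  rcases lt_or_ge ρ 0 with hρ | hρ
  · exact ⟨1, one_pos, fun c hc => absurd (hc.trans_lt hρ) (not_lt.2 (norm_nonneg c))⟩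
  set B := uBound p ρ with hB
  have hB0 : 0 ≤ B := uBound_nonneg hρ
  set P := ⌈B + uLow d p⌉₊ with hP
  have hPB : B + uLow d p ≤ P := Nat.le_ceil _
  set α := mbAbscissa n d p ρ with hα
  set J' := Finset.univ.filter fun j => a j 0 ≠ 0 with hJ'
  -- `C1`, `C2` bound the factors which grow with `t`; `C3`, `C4`, `C5` those with bounded arguments
  obtain ⟨C1, hC1, h1⟩ := exists_norm_inv_Gamma_add_int_le (max B ‖fun k : Rest m => (p k : ℂ)‖)
  obtain ⟨C2, hC2, h2⟩ := exists_Gamma_add_int_le 1 (B + (|α| + |β|)) one_pos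
  obtain ⟨C3, hC3, h3⟩ := exists_Gamma_add_int_le 1 (1 + n * (B + P)) one_pos
  obtain ⟨C4, hC4, h4⟩ := exists_norm_inv_Gamma_le (1 + n * (B + P))
  obtain ⟨C5, hC5, h5⟩ := exists_norm_inv_Gamma_le (1 + (|α| + |β|))
  set Cj : ℝ := max C1 (Real.exp (Real.pi * ρ) * C2) with hCj
  have hCj0 : 0 < Cj := lt_max_of_lt_left hC1
  refine ⟨(C1 ^ Fintype.card (Rest m)) * Cj ^ n * (A * A ^ (n * P) * Real.exp (η * (n * B))) *
    (C3 * C4 * C5), by positivity, fun c hc t ht s hs1 hs2 => ?_⟩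
  have hsabs : |s.re| ≤ |α| + |β| := by
    rw [abs_le]
    constructor
    · linarith [neg_abs_le α, abs_nonneg β]
    · linarith [le_abs_self β, abs_nonneg α]
  have hbase : ∀ j, ‖uBase d a c p j‖ ≤ B := norm_uBase_le hd ha hc
  have hone : ∀ j ∈ J', 1 ≤ (uArg d a c p t j s).re := fun j hj =>
    one_le_re_uArg hd ha hc ht (Finset.mem_filter.1 hj).2 hs1
  -- the arguments of the Gamma factors have the sum `X + s + M`, where `X` does not depend on `t` and
  -- `s`, and the shift by `P` makes `M` a natural number
  set X : ℂ := ∑ j ∈ J', (uBase d a c p j - P) with hX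
  have hNP : ∀ j, 0 ≤ uInt a t j + P := fun j => by
    have e1 := neg_uLow_le (a := a) ha ht j
    have e2 : (uLow d p : ℝ) ≤ P := by linarith
    have e3 : uLow d p ≤ P := by exact_mod_cast e2
    have e4 : (uLow d p : ℤ) ≤ P := by exact_mod_cast e3
    linarith
  set M : ℕ := (∑ j ∈ J', (uInt a t j + P)).toNat with hM
  have hMz : (M : ℤ) = ∑ j ∈ J', (uInt a t j + P) :=
    Int.toNat_of_nonneg (Finset.sum_nonneg fun j _ => hNP j)
  have hsum : ∑ j ∈ J', uArg d a c p t j s = X + s + M := by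
    have hMc : (M : ℂ) = ∑ j ∈ J', ((uInt a t j : ℂ) + P) := by
      have := congrArg (Int.cast : ℤ → ℂ) hMz
      push_cast at this
      exact this
    rw [Finset.sum_congr rfl fun j _ => uArg_eq hd c t j s, Finset.sum_add_distrib,
      ← Finset.mul_sum, sum_div_eq_one hd ha, hMc, hX]
    simp only [Finset.sum_add_distrib, Finset.sum_sub_distrib]
    ring
  have hcard : (J'.card : ℝ) ≤ n := by
    have := Finset.card_le_univ J'
    rw [Fintype.card_fin] at this
    exact_mod_cast this
  have hXn : ‖X‖ ≤ n * (B + P) := by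
    refine (norm_sum_le _ _).trans ?_
    refine (Finset.sum_le_sum fun j _ => (norm_sub_le _ _).trans
      (add_le_add (hbase j) (by simp : ‖((P : ℕ) : ℂ)‖ ≤ P))).trans ?_
    rw [Finset.sum_const, nsmul_eq_mul]
    exact mul_le_mul_of_nonneg_right hcard (by positivity)
  have hXre : X.re ≤ 0 := by
    rw [hX, Complex.re_sum]
    refine Finset.sum_nonpos fun j _ => ?_
    have := (Complex.re_le_norm _).trans (hbase j)
    have e : (0 : ℝ) ≤ uLow d p := Nat.cast_nonneg _
    simp only [Complex.sub_re, Complex.natCast_re]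
    linarith
  have hXre2 : -(n * (B + P)) ≤ X.re := by
    linarith [(abs_le.1 (Complex.abs_re_le_norm X)).1]
  have hXs : 1 ≤ X.re + s.re := by
    have : 1 + n * (B + P) ≤ α := by
      rw [hα, mbAbscissa]
      have : 0 ≤ (d : ℝ) * (uBound p ρ + uLow d p + 1) := by positivity
      linarith
    linarith
  have hXim : |X.im| ≤ n * B := by
    rw [hX, Complex.im_sum]
    refine (Finset.abs_sum_le_sum_abs _ _).trans ?_
    have e : ∀ j ∈ J', |(uBase d a c p j - P).im| ≤ B := fun j _ => by
      simpa using (Complex.abs_im_le_norm _).trans (hbase j)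
    refine (Finset.sum_le_sum e).trans ?_
    rw [Finset.sum_const, nsmul_eq_mul]
    exact mul_le_mul_of_nonneg_right hcard hB0
  have key := prod_norm_Gamma_mul_le hA J' (filter_nonempty hd ha) (fun j => uArg d a c p t j s)
    (fun j hj => by linarith [hone j hj]) X s M hsum (by linarith) hXs
  have k3 : Real.Gamma (1 - X.re) ≤ C3 := by
    have := h3 (1 - X.re) (by rw [abs_le]; constructor <;> linarith) 0 (by simp; linarith)
    simpa [factWeight] using this
  have k4 : ‖(Complex.Gamma (1 - X))⁻¹‖ ≤ C4 :=
    h4 _ ((norm_sub_le _ _).trans (by rw [norm_one]; linarith))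
  have k5 : (Real.Gamma (1 + s.re))⁻¹ ≤ C5 := by
    have := h5 ((1 + s.re : ℝ) : ℂ) (by
      rw [Complex.norm_real]
      refine (norm_add_le _ _).trans ?_
      rw [norm_one, Real.norm_eq_abs]; linarith)
    rw [Complex.Gamma_ofReal, ← Complex.ofReal_inv, Complex.norm_real] at this
    exact (le_abs_self _).trans this
  have hs1p : 0 < 1 + s.re := by linarith
  have hconst : Real.Gamma (1 - X.re) * ‖(Complex.Gamma (1 - X))⁻¹‖ * (Real.Gamma (1 + s.re))⁻¹ ≤
      C3 * C4 * C5 := by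
    have g1 := (Real.Gamma_pos_of_pos hs1p).le
    gcongr
  have hAM : A ^ M ≤ A ^ (n * P) * Real.exp (Real.log A * ∑ j, |(uInt a t j : ℝ)|) := by
    have e1 : (M : ℝ) ≤ n * P + ∑ j, |(uInt a t j : ℝ)| := by
      have := congrArg (Int.cast : ℤ → ℝ) hMz
      push_cast at this
      rw [this, Finset.sum_add_distrib, add_comm]
      refine add_le_add ?_ ?_
      · rw [Finset.sum_const, nsmul_eq_mul]
        exact mul_le_mul_of_nonneg_right hcard (Nat.cast_nonneg _)
      · refine (Finset.sum_le_sum fun j _ => le_abs_self _).trans ?_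
        exact Finset.sum_le_sum_of_subset_of_nonneg (Finset.filter_subset _ _)
          fun _ _ _ => abs_nonneg _
    have e2 : ∀ k : ℕ, A ^ k = Real.exp (Real.log A * k) := fun k => by
      rw [mul_comm, Real.exp_nat_mul, Real.exp_log hA0]
    rw [e2, e2, ← Real.exp_add]
    refine Real.exp_le_exp.2 ?_
    push_cast
    nlinarith
  have hexp : Real.exp (η * |X.im + s.im|) ≤ Real.exp (η * (n * B)) * Real.exp (η * |s.im|) := by
    rw [← Real.exp_add]
    refine Real.exp_le_exp.2 ?_
    have := abs_add_le X.im s.im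
    nlinarith
  have hGre : ∀ j ∈ J', Real.Gamma (uArg d a c p t j s).re ≤
      C2 * 2 ^ (uInt a t j).natAbs * factWeight (-uInt a t j) := by
    intro j hj
    have hd' : (0 : ℝ) < d := by exact_mod_cast hd
    have e : (uArg d a c p t j s).re = ((uBase d a c p j).re + s.re * (a j 0 / d)) + uInt a t j := by
      rw [uArg_eq hd]
      have : ((a j 0 : ℂ) / d) = ((a j 0 / d : ℝ) : ℂ) := by push_cast; rfl
      simp only [Complex.add_re, Complex.intCast_re, this, Complex.re_mul_ofReal]
      ring
    rw [e]
    refine h2 _ ?_ _ (by rw [← e]; exact hone j hj)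
    refine (abs_add_le _ _).trans (add_le_add ((Complex.abs_re_le_norm _).trans (hbase j)) ?_)
    rw [abs_mul]
    refine (mul_le_of_le_one_right (abs_nonneg _) ?_).trans hsabs
    rw [abs_of_nonneg (by positivity), div_le_one hd']
    exact_mod_cast le_of_sum_eq ha j 0
  have hsin : ∀ j, ‖Complex.sin (Real.pi * uArg d a c p t j (p 0)) / Real.pi‖ ≤
      Real.exp (Real.pi * ρ) := by
    intro j
    rw [norm_div, Complex.norm_real, Real.norm_of_nonneg Real.pi_pos.le, div_le_iff₀ Real.pi_pos]
    have e : (Real.pi * uArg d a c p t j (p 0)).im = Real.pi * ((c j).im / d) := by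
      rw [Complex.im_ofReal_mul]
      congr 1
      unfold uArg
      have e1 : (∑ k : Rest m, ((p k : ℂ) + t k * d) * a j k).im = 0 := by
        rw [Complex.im_sum]
        refine Finset.sum_eq_zero fun k _ => ?_
        have : ((p k : ℂ) + t k * d) * a j k = (((p k + t k * d) * a j k : ℤ) : ℂ) := by
          push_cast; rfl
        rw [this, Complex.intCast_im]
      have e2 : ((p 0 : ℂ) * a j 0).im = 0 := by
        have : (p 0 : ℂ) * a j 0 = ((p 0 * a j 0 : ℤ) : ℂ) := by push_cast; rfl
        rw [this, Complex.intCast_im]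
      rw [Complex.div_natCast_im, Complex.add_im, Complex.add_im, e1, e2]
      simp
    refine (norm_sin_le _).trans ?_
    rw [e]
    have hd1 : (1 : ℝ) ≤ d := by exact_mod_cast hd
    have e3 : |(c j).im / d| ≤ ρ := by
      rw [abs_div, Nat.abs_cast]
      exact (div_le_self (abs_nonneg _) hd1).trans ((Complex.abs_im_le_norm _).trans
        ((norm_le_pi_norm c j).trans hc))
    have e4 : Real.exp |Real.pi * ((c j).im / d)| ≤ Real.exp (Real.pi * ρ) := by
      refine Real.exp_le_exp.2 ?_
      rw [abs_mul, abs_of_pos Real.pi_pos]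
      exact mul_le_mul_of_nonneg_left e3 Real.pi_pos.le
    exact e4.trans (le_mul_of_one_le_right (Real.exp_pos _).le (by linarith [Real.pi_gt_three]))
  set W : Fin n → ℝ := fun j => Cj * 2 ^ (uInt a t j).natAbs * factWeight (-uInt a t j) with hW
  have hW0 : ∀ j, 0 ≤ W j := fun j => mul_nonneg (by positivity) (factWeight_nonneg _)
  have hfac : (∏ j, ‖mbFactor d a c p t j s‖) * ‖(Complex.Gamma (1 + s))⁻¹‖ ≤
      (∏ j, W j) * (A * A ^ M * Real.exp (η * |X.im + s.im|)) * (C3 * C4 * C5) := by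
    have hsplit : ∀ f : Fin n → ℝ, ∏ j, f j = (∏ j ∈ J', f j) *
        ∏ j ∈ Finset.univ.filter (fun j => ¬ a j 0 ≠ 0), f j := fun f =>
      (Finset.prod_filter_mul_prod_filter_not Finset.univ (fun j => a j 0 ≠ 0) f).symm
    rw [hsplit, hsplit W]
    have q1 : ∏ j ∈ J', ‖mbFactor d a c p t j s‖ =
        (∏ j ∈ J', ‖Complex.sin (Real.pi * uArg d a c p t j (p 0)) / Real.pi‖) *
        ∏ j ∈ J', ‖Complex.Gamma (uArg d a c p t j s)‖ := by
      rw [← Finset.prod_mul_distrib]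
      refine Finset.prod_congr rfl fun j hj => ?_
      rw [mbFactor, if_neg (Finset.mem_filter.1 hj).2, norm_mul]
    have q2 : ∏ j ∈ Finset.univ.filter (fun j => ¬ a j 0 ≠ 0), ‖mbFactor d a c p t j s‖ ≤
        ∏ j ∈ Finset.univ.filter (fun j => ¬ a j 0 ≠ 0), W j := by
      refine Finset.prod_le_prod (fun _ _ => norm_nonneg _) fun j hj => ?_
      have h0 : a j 0 = 0 := not_not.1 (Finset.mem_filter.1 hj).2
      rw [mbFactor, if_pos h0, uArg_eq hd, h0]
      have e : (1 : ℂ) - (uBase d a c p j + uInt a t j + s * ((0 : ℕ) / d)) =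
          1 + ((-uInt a t j : ℤ) : ℂ) + -uBase d a c p j := by push_cast; ring
      rw [e]
      have := h1 (-uBase d a c p j) (by rw [norm_neg]; exact (hbase j).trans (le_max_left _ _))
        (-uInt a t j)
      rw [Int.natAbs_neg] at this
      refine this.trans ?_
      have hw := factWeight_nonneg (-uInt a t j)
      simp only [hW]
      gcongr
      exact le_max_left _ _
    have q3 : (∏ j ∈ J', ‖Complex.sin (Real.pi * uArg d a c p t j (p 0)) / Real.pi‖) *
        ∏ j ∈ J', Real.Gamma (uArg d a c p t j s).re ≤ ∏ j ∈ J', W j := by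
      rw [← Finset.prod_mul_distrib]
      refine Finset.prod_le_prod (fun j hj => mul_nonneg (norm_nonneg _)
        (Real.Gamma_pos_of_pos (by linarith [hone j hj])).le) fun j hj => ?_
      refine (mul_le_mul (hsin j) (hGre j hj) (Real.Gamma_pos_of_pos (by linarith [hone j hj])).le
        (Real.exp_pos _).le).trans ?_
      have hw := factWeight_nonneg (-uInt a t j)
      simp only [hW, ← mul_assoc]
      gcongr
      exact le_max_right _ _
    have n0 : 0 ≤ ∏ j ∈ J', ‖Complex.sin (Real.pi * uArg d a c p t j (p 0)) / Real.pi‖ :=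
      Finset.prod_nonneg fun _ _ => norm_nonneg _
    have n1 : 0 ≤ ∏ j ∈ Finset.univ.filter (fun j => ¬ a j 0 ≠ 0), W j :=
      Finset.prod_nonneg fun j _ => hW0 j
    have n2 : 0 ≤ ∏ j ∈ J', W j := Finset.prod_nonneg fun j _ => hW0 j
    rw [q1]
    calc _ = (∏ j ∈ J', ‖Complex.sin (Real.pi * uArg d a c p t j (p 0)) / Real.pi‖) *
          ((∏ j ∈ J', ‖Complex.Gamma (uArg d a c p t j s)‖) * ‖(Complex.Gamma (1 + s))⁻¹‖) *
          ∏ j ∈ Finset.univ.filter (fun j => ¬ a j 0 ≠ 0), ‖mbFactor d a c p t j s‖ := by ring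
      _ ≤ (∏ j ∈ J', ‖Complex.sin (Real.pi * uArg d a c p t j (p 0)) / Real.pi‖) *
          ((∏ j ∈ J', Real.Gamma (uArg d a c p t j s).re) *
            (A * A ^ M * Real.exp (η * |X.im + s.im|)) * (C3 * C4 * C5)) *
          ∏ j ∈ Finset.univ.filter (fun j => ¬ a j 0 ≠ 0), W j := by
          have n3 : 0 ≤ ∏ j ∈ J', Real.Gamma (uArg d a c p t j s).re := Finset.prod_nonneg
            fun j hj => (Real.Gamma_pos_of_pos (by linarith [hone j hj])).le
          refine mul_le_mul (mul_le_mul_of_nonneg_left (key.trans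
            (mul_le_mul_of_nonneg_left hconst (by positivity))) n0) q2
            (Finset.prod_nonneg fun _ _ => norm_nonneg _) (by positivity)
      _ = ((∏ j ∈ J', ‖Complex.sin (Real.pi * uArg d a c p t j (p 0)) / Real.pi‖) *
          ∏ j ∈ J', Real.Gamma (uArg d a c p t j s).re) *
          ((A * A ^ M * Real.exp (η * |X.im + s.im|)) * (C3 * C4 * C5) *
          ∏ j ∈ Finset.univ.filter (fun j => ¬ a j 0 ≠ 0), W j) := by ring
      _ ≤ (∏ j ∈ J', W j) * ((A * A ^ M * Real.exp (η * |X.im + s.im|)) * (C3 * C4 * C5) *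
          ∏ j ∈ Finset.univ.filter (fun j => ¬ a j 0 ≠ 0), W j) :=
          mul_le_mul_of_nonneg_right q3 (by positivity)
      _ = _ := by ring
  have hk : ∏ k : Rest m, ‖(Complex.Gamma (1 + ((t k * d : ℤ) : ℂ) + p k))⁻¹‖ ≤
      ∏ k : Rest m, (C1 * 2 ^ (t k * d).natAbs * factWeight (t k * d)) :=
    Finset.prod_le_prod (fun _ _ => norm_nonneg _) fun k _ =>
      h1 (p k) ((norm_le_pi_norm (fun k : Rest m => (p k : ℂ)) k).trans (le_max_right _ _)) _
  -- all the weights together are those of the vector `∑ t_k b_k`, which has coordinate sum zero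
  set u := latticeVec d a (cons0 0 t) with hu
  have hprod : (∏ k : Rest m, 2 ^ (t k * d).natAbs * factWeight (t k * d)) *
      ∏ j, (2 ^ (uInt a t j).natAbs * factWeight (-uInt a t j)) =
      2 ^ (∑ x, (u x).natAbs) * ∏ x, factWeight (u x) := by
    rw [← Finset.prod_pow_eq_pow_sum, ← Finset.prod_mul_distrib, Fintype.prod_sum_type,
      Fintype.prod_eq_mul_prod_subtype_ne _ (0 : Fin m)]
    have e0 : u (.inl 0) = 0 := by simp [hu]
    have ek : ∀ k : Rest m, u (.inl k) = t k * d := fun k => by simp [hu]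
    have ej : ∀ j, u (.inr j) = -uInt a t j := fun j => uInt_eq t j
    simp only [e0, ek, ej, Int.natAbs_neg]
    simp [factWeight]
  have hweight : 2 ^ (∑ x, (u x).natAbs) * ∏ x, factWeight (u x) ≤
      Real.exp (L0 * (2 * d * ∑ k, |(t k : ℝ)|)) := by
    refine (mul_le_mul_of_nonneg_left (prod_factWeight_le u (sum_latticeVec ha _))
      (by positivity)).trans ?_
    rw [← mul_pow]
    have e : (2 * 2 ^ Fintype.card (Fin m ⊕ Fin n) : ℝ) ^ (∑ x, (u x).natAbs) =
        Real.exp (L0 * (∑ x, (u x).natAbs : ℕ)) := by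
      rw [mul_comm L0, Real.exp_nat_mul, hL0, gammaRate, Real.exp_log (by positivity)]
    rw [e, sum_natAbs_cast]
    refine Real.exp_le_exp.2 (mul_le_mul_of_nonneg_left ?_ hL0n)
    have := sum_abs_latticeVec_le ha (cons0 0 t)
    rwa [sum_abs_cons0] at this
  have huI := sum_abs_uInt_le ha t
  have hS0 : 0 ≤ ∑ k, |(t k : ℝ)| := Finset.sum_nonneg fun _ _ => abs_nonneg _
  unfold mbGamma
  rw [norm_mul, norm_mul, norm_prod, norm_prod]
  have hk0 : 0 ≤ ∏ k : Rest m, (C1 * 2 ^ (t k * d).natAbs * factWeight (t k * d)) :=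
    Finset.prod_nonneg fun k _ => mul_nonneg (by positivity) (factWeight_nonneg _)
  have hWp : 0 ≤ ∏ j, W j := Finset.prod_nonneg fun j _ => hW0 j
  have hfinal : (A * A ^ M * Real.exp (η * |X.im + s.im|)) ≤
      (A * A ^ (n * P) * Real.exp (η * (n * B))) *
        Real.exp (Real.log A * (2 * d * ∑ k, |(t k : ℝ)|) + η * |s.im|) := by
    rw [Real.exp_add]
    have e1 : Real.exp (Real.log A * ∑ j, |(uInt a t j : ℝ)|) ≤
        Real.exp (Real.log A * (2 * d * ∑ k, |(t k : ℝ)|)) := by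
      refine Real.exp_le_exp.2 (mul_le_mul_of_nonneg_left ?_ hlogA)
      have : (0 : ℝ) ≤ d * ∑ k, |(t k : ℝ)| := by positivity
      linarith
    calc _ ≤ A * (A ^ (n * P) * Real.exp (Real.log A * (2 * d * ∑ k, |(t k : ℝ)|))) *
          (Real.exp (η * (n * B)) * Real.exp (η * |s.im|)) := by
          gcongr
          exact hAM.trans (mul_le_mul_of_nonneg_left e1 (by positivity))
      _ = _ := by ring
  calc _ = (∏ k : Rest m, ‖(Complex.Gamma (1 + ((t k * d : ℤ) : ℂ) + p k))⁻¹‖) *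
        ((∏ j, ‖mbFactor d a c p t j s‖) * ‖(Complex.Gamma (1 + s))⁻¹‖) := by ring
    _ ≤ (∏ k : Rest m, (C1 * 2 ^ (t k * d).natAbs * factWeight (t k * d))) *
        ((∏ j, W j) * (A * A ^ M * Real.exp (η * |X.im + s.im|)) * (C3 * C4 * C5)) :=
        mul_le_mul hk hfac (by positivity) hk0
    _ = (C1 ^ Fintype.card (Rest m)) * Cj ^ n *
        (((∏ k : Rest m, 2 ^ (t k * d).natAbs * factWeight (t k * d)) *
      ∏ j, (2 ^ (uInt a t j).natAbs * factWeight (-uInt a t j))) *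
        (A * A ^ M * Real.exp (η * |X.im + s.im|))) * (C3 * C4 * C5) := by
        simp only [hW, Finset.prod_mul_distrib, Finset.prod_const, Finset.card_univ,
          Fintype.card_fin]
        ring
    _ ≤ (C1 ^ Fintype.card (Rest m)) * Cj ^ n *
        (Real.exp (L0 * (2 * d * ∑ k, |(t k : ℝ)|)) *
        ((A * A ^ (n * P) * Real.exp (η * (n * B))) *
        Real.exp (Real.log A * (2 * d * ∑ k, |(t k : ℝ)|) + η * |s.im|))) * (C3 * C4 * C5) := by
        rw [hprod]
        have n4 : 0 ≤ A * A ^ M * Real.exp (η * |X.im + s.im|) := by positivity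
        gcongr
    _ = (C1 ^ Fintype.card (Rest m)) * Cj ^ n * (A * A ^ (n * P) * Real.exp (η * (n * B))) *
        (C3 * C4 * C5) * (Real.exp (L0 * (2 * d * ∑ k, |(t k : ℝ)|)) *
        Real.exp (Real.log A * (2 * d * ∑ k, |(t k : ℝ)|) + η * |s.im|)) := by ring
    _ = _ := by
        rw [← Real.exp_add]
        congr 2
        ring

end Kernel

/-! ### The Mellin–Barnes integral -/

section Integral

open MeasureTheory

variable {m n : ℕ} [NeZero m] {d : ℕ} {a : Matrix (Fin n) (Fin m) ℕ} {p : Fin m → ℤ}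

/-- The coefficient of the exponential in the Mellin–Barnes integrand. -/
noncomputable def mbCoef (d : ℕ) (a : Matrix (Fin n) (Fin m) ℕ) (c : Fin n → ℂ) (p : Fin m → ℤ)
    (t : Rest m → ℤ) (s : ℂ) : ℂ := mbGamma d a c p t s * mbTrig d (p 0) s

/-- The Mellin–Barnes integrand. -/
noncomputable def mbKernel (d : ℕ) (a : Matrix (Fin n) (Fin m) ℕ) (c : Fin n → ℂ) (p : Fin m → ℤ)
    (t : Rest m → ℤ) (x : Fin m ⊕ Fin n → ℂ) (s : ℂ) : ℂ :=
  mbCoef d a c p t s * Complex.exp (pairing (mbExp d a c p t s) x)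

lemma mbGamma_eq_zero (hd : 0 < d) (c : Fin n → ℂ) {t : Rest m → ℤ} {k : Rest m}
    (hk : t k + |p k| < 0) (s : ℂ) : mbGamma d a c p t s = 0 := by
  have h0 : t k * d + p k < 0 := by
    have h1 : (1 : ℤ) ≤ d := by exact_mod_cast hd
    have h2 := le_abs_self (p k)
    have h3 := abs_nonneg (p k)
    nlinarith
  have h : Complex.Gamma (1 + ((t k * d : ℤ) : ℂ) + p k) = 0 := by
    rw [Complex.Gamma_eq_zero_iff]
    refine ⟨(-(1 + t k * d + p k)).toNat, ?_⟩
    have h4 : ((-(1 + t k * d + p k)).toNat : ℤ) = -(1 + t k * d + p k) :=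
      Int.toNat_of_nonneg (by omega)
    have := congrArg (Int.cast : ℤ → ℂ) h4
    push_cast at this ⊢
    rw [this]; ring
  unfold mbGamma
  rw [Finset.prod_eq_zero (Finset.mem_univ k) (by rw [h, inv_zero]), zero_mul, zero_mul]

/-- The width of the neighbourhood of the path in which the integral converges. -/
noncomputable def mbWidth (n d : ℕ) : ℝ := Real.pi / (4 * d * (n + 1))

lemma mbWidth_pos (hd : 0 < d) : 0 < mbWidth n d := by
  have : (0 : ℝ) < d := by exact_mod_cast hd
  unfold mbWidth; positivity

lemma norm1_mbExp_le (hd : 0 < d) (ha : ∀ j, ∑ i, a i j = d) {ρ : ℝ} {c : Fin n → ℂ}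
    (hc : ‖c‖ ≤ ρ) (t : Rest m → ℤ) (s : ℂ) :
    norm1 (mbExp d a c p t s) ≤ (n + 1) * ‖s‖ + 2 * d * ∑ k, |(t k : ℝ)| +
      (∑ k : Rest m, |(p k : ℝ)| + n * uBound p ρ) := by
  have hd' : (0 : ℝ) < d := by exact_mod_cast hd
  unfold norm1 mbExp
  rw [Fintype.sum_sum_type, sum_fin_eq_add]
  simp only [Sum.elim_inl, Sum.elim_inr, dif_pos, norm_neg]
  have h1 : ∑ k : Rest m, ‖(if h : (k : Fin m) = 0 then s else (p k : ℂ) + t ⟨k, h⟩ * d)‖ ≤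
      ∑ k : Rest m, (|(p k : ℝ)| + d * |(t k : ℝ)|) := by
    refine Finset.sum_le_sum fun k _ => ?_
    rw [dif_neg k.2]
    refine (norm_add_le _ _).trans_eq ?_
    rw [norm_mul, Complex.norm_intCast, Complex.norm_intCast, Complex.norm_natCast, mul_comm]
  have h2 : ∑ j, ‖uArg d a c p t j s‖ ≤ ∑ j : Fin n, (uBound p ρ + |(uInt a t j : ℝ)| + ‖s‖) := by
    refine Finset.sum_le_sum fun j _ => ?_
    rw [uArg_eq hd]
    refine (norm_add_le _ _).trans (add_le_add ((norm_add_le _ _).trans (add_le_add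
      (norm_uBase_le hd ha hc j) (by rw [Complex.norm_intCast]))) ?_)
    rw [norm_mul, norm_div, Complex.norm_natCast, Complex.norm_natCast]
    refine mul_le_of_le_one_right (norm_nonneg _) ((div_le_one hd').2 ?_)
    exact_mod_cast le_of_sum_eq ha j 0
  have h3 := sum_abs_uInt_le ha t
  rw [Finset.sum_add_distrib, Finset.sum_add_distrib, Finset.sum_const, Finset.sum_const,
    Finset.card_univ, Fintype.card_fin, nsmul_eq_mul, nsmul_eq_mul] at h2
  rw [Finset.sum_add_distrib, ← Finset.mul_sum] at h1
  linarith

lemma re_pairing_mbExp (c : Fin n → ℂ) (t : Rest m → ℤ) (s : ℂ) (T τ : ℝ) :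
    (pairing (mbExp d a c p t s) (basePoint m n d T τ)).re =
      (s.re * τ + s.im * (Real.pi * (d - 1) / d)) - T * ∑ k : Rest m, (p k + t k * d : ℝ) := by
  unfold pairing mbExp
  rw [Fintype.sum_sum_type, sum_fin_eq_add]
  simp only [Sum.elim_inl, Sum.elim_inr, dif_pos, basePoint_inr, mul_zero, Finset.sum_const_zero,
    add_zero, Complex.add_re]
  congr 1
  · simp only [basePoint, Sum.elim_inl, if_true, Complex.mul_re, Complex.sub_re,
      Complex.ofReal_re, Complex.sub_im, Complex.ofReal_im,
      Complex.im_ofReal_mul, Complex.I_re, Complex.I_im]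
    ring
  · rw [Finset.mul_sum, Complex.re_sum, ← Finset.sum_neg_distrib]
    refine Finset.sum_congr rfl fun k _ => ?_
    rw [dif_neg k.2, basePoint_inl k.2]
    have : ((p k : ℂ) + t k * d) * (-(T : ℂ)) = ((-(T * (p k + t k * d)) : ℝ) : ℂ) := by
      push_cast; ring
    rw [this, Complex.ofReal_re]

lemma exists_norm_mbTrig_le (hd : 0 < d) (p₀ : ℤ) : ∃ C > 0, ∀ s : ℂ,
    (Real.cos (Real.pi / d * (s.re - p₀)) = 0 ∨ 1 ≤ |s.im|) →
    ‖mbTrig d p₀ s‖ * Real.exp (s.im * (Real.pi * (d - 1) / d)) ≤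
      C * Real.exp (-(Real.pi / d * |s.im|)) := by
  have hd' : (0 : ℝ) < d := by exact_mod_cast hd
  have hv : 0 < Real.pi / d := div_pos Real.pi_pos hd'
  obtain ⟨κ, hκ, h⟩ := exists_le_norm_sin hv
  refine ⟨Real.pi / d * κ⁻¹, by positivity, fun s hs => ?_⟩
  have e : (Real.pi / d * (s - p₀) : ℂ) = ((Real.pi / d : ℝ) : ℂ) * (s - p₀) := by push_cast; rfl
  have hre : (Real.pi / d * (s - p₀) : ℂ).re = Real.pi / d * (s.re - p₀) := by
    rw [e, Complex.re_ofReal_mul]; simp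
  have him : (Real.pi / d * (s - p₀) : ℂ).im = Real.pi / d * s.im := by
    rw [e, Complex.im_ofReal_mul]; simp
  have h1 := h (Real.pi / d * (s - p₀)) (by
    rw [hre, him, abs_mul, abs_of_pos hv]
    exact hs.imp id fun h => le_mul_of_one_le_right hv.le h)
  rw [him, abs_mul, abs_of_pos hv] at h1
  have hpos := Real.exp_pos (Real.pi / d * |s.im|)
  have hsin : 0 < ‖Complex.sin (Real.pi / d * (s - p₀))‖ := lt_of_lt_of_le (by positivity) h1
  have hE : ‖Complex.exp (Real.pi * (d - 1) / d * (s - p₀) * Complex.I)‖ =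
      Real.exp (-(s.im * (Real.pi * (d - 1) / d))) := by
    rw [Complex.norm_exp]
    congr 1
    have : (Real.pi * (d - 1) / d * (s - p₀) * Complex.I : ℂ) =
        ((Real.pi * (d - 1) / d : ℝ) : ℂ) * ((s - p₀) * Complex.I) := by push_cast; ring
    rw [this, Complex.re_ofReal_mul]
    simp; ring
  have hπ : ‖(Real.pi / d : ℂ)‖ = Real.pi / d := by
    rw [norm_div, Complex.norm_real, Complex.norm_natCast, Real.norm_of_nonneg Real.pi_pos.le]
  rw [mbTrig, norm_div, norm_mul, hE, hπ, div_mul_eq_mul_div, mul_assoc, ← Real.exp_add,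
    neg_add_cancel, Real.exp_zero, mul_one, Real.exp_neg, mul_assoc, div_eq_mul_inv]
  refine mul_le_mul_of_nonneg_left ?_ hv.le
  rw [← mul_inv]
  exact inv_anti₀ (by positivity) h1

/-- `T` is large enough for the path: the variables `z_2, …, z_m` are so small, and `z_1` so small at
the start and so large at the end, that all series converge near the end points and the
Mellin–Barnes integrand is dominated along the path, on lines which avoid the poles of the
trigonometric factor and far from the real axis. The size `T` depends neither on `c` nor on `p`. The
condition `ratio` makes the factor by which the integrand decreases from one line to the next at
most `1 / 2` near the end points. -/
structure IsLarge (d : ℕ) (a : Matrix (Fin n) (Fin m) ℕ) (T : ℝ) : Prop where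
  radius : radiusBound m n d + 1 ≤ T
  ratio : 4 * d + 4 ≤ T
  domination : ∀ (p : Fin m → ℤ) (ρ β : ℝ), ∃ C > 0, ∀ c : Fin n → ℂ, ‖c‖ ≤ ρ →
      ∀ (t : Rest m → ℤ) (s : ℂ), mbAbscissa n d p ρ ≤ s.re → s.re ≤ β →
        (Real.cos (Real.pi / d * (s.re - p 0)) = 0 ∨ 1 ≤ |s.im|) → ∀ τ : ℝ, |τ| ≤ T →
        ‖mbCoef d a c p t s‖ * Real.exp ((pairing (mbExp d a c p t s) (basePoint m n d T τ)).re +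
          mbWidth n d * norm1 (mbExp d a c p t s)) ≤
        C * (Real.exp (-∑ k, |(t k : ℝ)|) * Real.exp (-(Real.pi / (2 * d) * |s.im|)))

theorem exists_isLarge (hd : 0 < d) (ha : ∀ j, ∑ i, a i j = d) : ∃ T, IsLarge d a T := by
  have hd' : (0 : ℝ) < d := by exact_mod_cast hd
  have hd1 : (1 : ℝ) ≤ d := by exact_mod_cast hd
  obtain ⟨L, hL, hG⟩ := exists_norm_mbGamma_le (a := a) hd ha
    (η := Real.pi / (4 * d)) (by positivity)
  obtain ⟨T, hT1, hT2, hT⟩ : ∃ T, radiusBound m n d + 1 ≤ T ∧ 4 * d + 4 ≤ T ∧ L + 3 ≤ T :=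
    ⟨max (radiusBound m n d + 1) (max (4 * d + 4) (L + 3)), le_max_left _ _,
      (le_max_left _ _).trans (le_max_right _ _), (le_max_right _ _).trans (le_max_right _ _)⟩
  refine ⟨T, hT1, hT2, fun p ρ β => ?_⟩
  rcases lt_or_ge ρ 0 with hρ | hρ
  · exact ⟨1, one_pos, fun c hc => absurd (hc.trans_lt hρ) (not_lt.2 (norm_nonneg c))⟩
  obtain ⟨C1, hC1, h1⟩ := hG p ρ β
  obtain ⟨C2, hC2, h2⟩ := exists_norm_mbTrig_le hd (p 0)
  set α := mbAbscissa n d p ρ with hα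
  set Q : ℝ := ∑ k : Rest m, |(p k : ℝ)| with hQ
  set B : ℝ := Q + n * uBound p ρ with hB
  have hT0 : 0 ≤ T := by linarith
  refine ⟨C1 * C2 * Real.exp ((|α| + |β|) * T + T * ((2 * d + 1) * Q) + Real.pi / (4 * d) *
    (|α| + |β|) + mbWidth n d * B), by positivity, fun c hc t s hs1 hs2 hs τ hτ => ?_⟩
  by_cases ht : ∀ k : Rest m, 0 ≤ t k + |p k|
  swap
  · push Not at ht
    obtain ⟨k, hk⟩ := ht
    rw [mbCoef, mbGamma_eq_zero hd c hk, zero_mul, norm_zero, zero_mul]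
    positivity
  have g1 := h1 c hc t ht s hs1 hs2
  have g2 := h2 s hs
  have g3 := norm1_mbExp_le (p := p) hd ha hc t s
  have hsabs : |s.re| ≤ |α| + |β| := by
    rw [abs_le]
    constructor
    · linarith [neg_abs_le α, abs_nonneg β]
    · linarith [le_abs_self β, abs_nonneg α]
  have hst : s.re * τ ≤ (|α| + |β|) * T := by
    refine (le_abs_self _).trans ?_
    rw [abs_mul]
    exact mul_le_mul hsabs hτ (abs_nonneg _) (by positivity)
  set St : ℝ := ∑ k, |(t k : ℝ)| with hSt
  have hSt0 : 0 ≤ St := Finset.sum_nonneg fun _ _ => abs_nonneg _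
  have hlin : d * St - (2 * d + 1) * Q ≤ ∑ k : Rest m, (p k + t k * d : ℝ) := by
    rw [hSt, hQ, Finset.mul_sum, Finset.mul_sum, ← Finset.sum_sub_distrib]
    refine Finset.sum_le_sum fun k _ => ?_
    have e1 : (0 : ℝ) ≤ t k + |(p k : ℝ)| := by exact_mod_cast ht k
    have e2 := neg_abs_le (p k : ℝ)
    have e3 := abs_nonneg (p k : ℝ)
    rcases abs_cases (t k : ℝ) with ⟨h, _⟩ | ⟨h, _⟩ <;> rw [h] <;> nlinarith
  have hw := mbWidth_pos (n := n) hd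
  have hw1 : mbWidth n d * (n + 1) = Real.pi / (4 * d) := by
    unfold mbWidth; field_simp
  have hw2 : mbWidth n d * (2 * d) ≤ 2 := by
    have : mbWidth n d * (2 * d) = Real.pi / (2 * (n + 1)) := by
      unfold mbWidth; field_simp; ring
    rw [this, div_le_iff₀ (by positivity)]
    have := Real.pi_le_four
    have hn : (0 : ℝ) ≤ n := Nat.cast_nonneg _
    linarith
  have hsn : ‖s‖ ≤ (|α| + |β|) + |s.im| := (Complex.norm_le_abs_re_add_abs_im s).trans (by linarith)
  have hn1 : mbWidth n d * norm1 (mbExp d a c p t s) ≤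
      Real.pi / (4 * d) * ((|α| + |β|) + |s.im|) + 2 * St + mbWidth n d * B := by
    refine (mul_le_mul_of_nonneg_left g3 hw.le).trans ?_
    rw [mul_add, mul_add, ← mul_assoc, hw1, ← mul_assoc]
    have e1 : Real.pi / (4 * d) * ‖s‖ ≤ Real.pi / (4 * d) * ((|α| + |β|) + |s.im|) :=
      mul_le_mul_of_nonneg_left hsn (by positivity)
    have e2 := mul_le_mul_of_nonneg_right hw2 hSt0
    linarith
  rw [re_pairing_mbExp, mbCoef, norm_mul]
  have hTSt : (L + 3) * St ≤ T * (d * St) := by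
    have : T ≤ T * d := le_mul_of_one_le_right hT0 hd1
    rw [← mul_assoc]
    exact mul_le_mul_of_nonneg_right (by linarith) hSt0
  have hTl := mul_le_mul_of_nonneg_left hlin hT0
  have hlast : Real.exp (L * St + Real.pi / (4 * d) * |s.im|) * Real.exp (-(Real.pi / d * |s.im|)) *
      Real.exp (s.re * τ - T * ∑ k : Rest m, (p k + t k * d : ℝ) +
        mbWidth n d * norm1 (mbExp d a c p t s)) ≤
      Real.exp ((|α| + |β|) * T + T * ((2 * d + 1) * Q) + Real.pi / (4 * d) *
        (|α| + |β|) + mbWidth n d * B) *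
      (Real.exp (-St) * Real.exp (-(Real.pi / (2 * d) * |s.im|))) := by
    simp only [← Real.exp_add]
    refine Real.exp_le_exp.2 ?_
    have e : Real.pi / d * |s.im| = Real.pi / (4 * d) * |s.im| + Real.pi / (4 * d) * |s.im| +
        Real.pi / (2 * d) * |s.im| := by field_simp; ring
    rw [mul_sub] at hTl
    rw [e]
    linarith
  calc _ = ‖mbGamma d a c p t s‖ * (‖mbTrig d (p 0) s‖ *
        Real.exp (s.im * (Real.pi * (d - 1) / d))) *
        Real.exp (s.re * τ - T * ∑ k : Rest m, (p k + t k * d : ℝ) +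
        mbWidth n d * norm1 (mbExp d a c p t s)) := by
        have : s.re * τ + s.im * (Real.pi * (d - 1) / d) - T * ∑ k : Rest m, (p k + t k * d : ℝ) +
            mbWidth n d * norm1 (mbExp d a c p t s) = s.im * (Real.pi * (d - 1) / d) +
            (s.re * τ - T * ∑ k : Rest m, (p k + t k * d : ℝ) +
            mbWidth n d * norm1 (mbExp d a c p t s)) := by ring
        rw [this, Real.exp_add]; ring
    _ ≤ (C1 * Real.exp (L * St + Real.pi / (4 * d) * |s.im|)) *
        (C2 * Real.exp (-(Real.pi / d * |s.im|))) *
        Real.exp (s.re * τ - T * ∑ k : Rest m, (p k + t k * d : ℝ) +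
        mbWidth n d * norm1 (mbExp d a c p t s)) := by gcongr
    _ = C1 * C2 * (Real.exp (L * St + Real.pi / (4 * d) * |s.im|) *
        Real.exp (-(Real.pi / d * |s.im|)) *
        Real.exp (s.re * τ - T * ∑ k : Rest m, (p k + t k * d : ℝ) +
        mbWidth n d * norm1 (mbExp d a c p t s))) := by ring
    _ ≤ C1 * C2 * _ := mul_le_mul_of_nonneg_left hlast (by positivity)
    _ = _ := by ring

end Integral

section Integral

open MeasureTheory

variable {m n : ℕ} [NeZero m] {d : ℕ} {a : Matrix (Fin n) (Fin m) ℕ} {p : Fin m → ℤ}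

/-- The Mellin–Barnes integral over the line `Re s = σ`, summed over `t_2, …, t_m`. -/
noncomputable def mbIntegral (d : ℕ) (a : Matrix (Fin n) (Fin m) ℕ) (c : Fin n → ℂ) (p : Fin m → ℤ)
    (σ : ℝ) (x : Fin m ⊕ Fin n → ℂ) : ℂ :=
  ∫ ω : (Rest m → ℤ) × ℝ, mbKernel d a c p ω.1 x (σ + ω.2 * Complex.I)
    ∂((Measure.count : Measure (Rest m → ℤ)).prod volume)

lemma measurable_Gamma : Measurable Complex.Gamma := by
  have : Complex.Gamma = fun s => ((Complex.Gamma s)⁻¹)⁻¹ := by ext s; rw [inv_inv]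
  rw [this]
  exact Complex.differentiable_one_div_Gamma.continuous.measurable.inv

lemma continuous_mbExp (c : Fin n → ℂ) (t : Rest m → ℤ) : Continuous (mbExp d a c p t) := by
  refine continuous_pi fun j => ?_
  rcases j with k | j
  · by_cases hk : k = 0
    · simp only [mbExp, Sum.elim_inl, hk, dif_pos]; exact continuous_id
    · simp only [mbExp, Sum.elim_inl, hk, dif_neg, not_false_eq_true]; exact continuous_const
  · simp only [mbExp, Sum.elim_inr, uArg]; fun_prop

lemma measurable_mbCoef (c : Fin n → ℂ) (t : Rest m → ℤ) : Measurable (mbCoef d a c p t) := by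
  have hf : ∀ j, Measurable (mbFactor d a c p t j) := fun j => by
    have hu : Measurable (uArg d a c p t j) := by unfold uArg; fun_prop
    unfold mbFactor
    split_ifs
    · exact (measurable_Gamma.comp (measurable_const.sub hu)).inv
    · exact measurable_const.mul (measurable_Gamma.comp hu)
  have h1 : Measurable fun s : ℂ => (Complex.Gamma (1 + s))⁻¹ :=
    (measurable_Gamma.comp (measurable_const.add measurable_id)).inv
  have h2 : Measurable fun s => ∏ j, mbFactor d a c p t j s :=
    Finset.measurable_prod _ fun j _ => hf j
  have h3 : Measurable (mbTrig d (p 0)) := by unfold mbTrig; fun_prop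
  unfold mbCoef mbGamma
  exact ((measurable_const.mul h1).mul h2).mul h3

lemma aestronglyMeasurable_line {E : Type*} [TopologicalSpace E] [TopologicalSpace.PseudoMetrizableSpace E]
    [SecondCountableTopology E] [MeasurableSpace E] [BorelSpace E]
    {f : (Rest m → ℤ) → ℂ → E} (hf : ∀ t, Measurable (f t)) (σ : ℝ) :
    AEStronglyMeasurable (fun ω : (Rest m → ℤ) × ℝ => f ω.1 (σ + ω.2 * Complex.I))
      ((Measure.count : Measure (Rest m → ℤ)).prod volume) := by
  refine Measurable.aestronglyMeasurable ?_
  refine measurable_from_prod_countable_right fun t => ?_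
  exact (hf t).comp (by fun_prop)

lemma integrable_bound (hd : 0 < d) (C : ℝ) :
    Integrable (fun ω : (Rest m → ℤ) × ℝ => C * (Real.exp (-∑ k, |(ω.1 k : ℝ)|) *
      Real.exp (-(Real.pi / (2 * d) * |ω.2|))))
      ((Measure.count : Measure (Rest m → ℤ)).prod volume) := by
  have hd' : (0 : ℝ) < d := by exact_mod_cast hd
  refine Integrable.const_mul (Integrable.mul_prod (f := fun t : Rest m → ℤ =>
    Real.exp (-∑ k, |(t k : ℝ)|)) (g := fun y : ℝ => Real.exp (-(Real.pi / (2 * d) * |y|))) ?_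
    (integrable_exp_neg_mul_abs (by positivity))) C
  rw [integrable_count_iff]
  have := (summable_pow_sum_natAbs (κ := Rest m) (θ := Real.exp (-1)) (Real.exp_pos _).le
    (Real.exp_lt_one_iff.2 (by norm_num)))
  refine this.congr fun t => ?_
  rw [Real.norm_of_nonneg (Real.exp_pos _).le, ← Real.exp_nat_mul, sum_natAbs_cast]
  ring_nf

lemma IsLarge.pos {T : ℝ} (hT : IsLarge d a T) : 0 < T := by
  have := hT.ratio
  have hd : (0 : ℝ) ≤ d := Nat.cast_nonneg d
  linarith

lemma IsLarge.line {T : ℝ} (hT : IsLarge d a T) (p : Fin m → ℤ) {ρ σ : ℝ}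
    (hσ : mbAbscissa n d p ρ ≤ σ) (hcos : Real.cos (Real.pi / d * (σ - p 0)) = 0) :
    ∃ C > 0, ∀ c : Fin n → ℂ, ‖c‖ ≤ ρ → ∀ τ : ℝ, |τ| ≤ T → ∀ ω : (Rest m → ℤ) × ℝ,
        ‖mbCoef d a c p ω.1 (σ + ω.2 * Complex.I)‖ *
          Real.exp ((pairing (mbExp d a c p ω.1 (σ + ω.2 * Complex.I)) (basePoint m n d T τ)).re +
          mbWidth n d * norm1 (mbExp d a c p ω.1 (σ + ω.2 * Complex.I))) ≤
        C * (Real.exp (-∑ k, |(ω.1 k : ℝ)|) * Real.exp (-(Real.pi / (2 * d) * |ω.2|))) := by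
  obtain ⟨C, hC, h⟩ := hT.domination p ρ σ
  refine ⟨C, hC, fun c hc τ hτ ω => ?_⟩
  have := h c hc ω.1 (σ + ω.2 * Complex.I) (by simpa using hσ) (by simp) (Or.inl (by simpa using hcos))
    τ hτ
  simpa using this

lemma analyticAt_mbIntegral (hd : 0 < d) {T : ℝ} (hT : IsLarge d a T) {c : Fin n → ℂ} {ρ σ τ : ℝ}
    (hσ : mbAbscissa n d p ρ ≤ σ) (hcos : Real.cos (Real.pi / d * (σ - p 0)) = 0) (hc : ‖c‖ ≤ ρ)
    (hτ : |τ| ≤ T) : AnalyticAt ℂ (mbIntegral d a c p σ) (basePoint m n d T τ) := by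
  obtain ⟨C, hC, h⟩ := hT.line p hσ hcos
  exact analyticAt_integral_exp (aestronglyMeasurable_line (measurable_mbCoef c) σ)
    (aestronglyMeasurable_line (fun t => (continuous_mbExp c t).measurable) σ) _ (mbWidth_pos hd)
    (h c hc τ hτ) (integrable_bound hd C)

lemma norm_mbKernel_le {δ B : ℝ} {c : Fin n → ℂ} {t : Rest m → ℤ} {s : ℂ}
    {x b : Fin m ⊕ Fin n → ℂ} (hx : ‖x - b‖ ≤ δ)
    (h : ‖mbCoef d a c p t s‖ * Real.exp ((pairing (mbExp d a c p t s) b).re +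
          δ * norm1 (mbExp d a c p t s)) ≤ B) : ‖mbKernel d a c p t x s‖ ≤ B := by
  rw [mbKernel, norm_mul, Complex.norm_exp]
  refine le_trans (mul_le_mul_of_nonneg_left (Real.exp_le_exp.2 ?_) (norm_nonneg _)) h
  refine (re_pairing_le _ x b).trans ?_
  have := mul_le_mul_of_nonneg_right hx (norm1_nonneg (mbExp d a c p t s))
  linarith

lemma integrable_mbKernel (hd : 0 < d) {T : ℝ} (hT : IsLarge d a T) {c : Fin n → ℂ} {ρ σ τ : ℝ}
    (hσ : mbAbscissa n d p ρ ≤ σ) (hcos : Real.cos (Real.pi / d * (σ - p 0)) = 0) (hc : ‖c‖ ≤ ρ)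
    (hτ : |τ| ≤ T) {x : Fin m ⊕ Fin n → ℂ} (hx : ‖x - basePoint m n d T τ‖ ≤ mbWidth n d) :
    Integrable (fun ω : (Rest m → ℤ) × ℝ => mbKernel d a c p ω.1 x (σ + ω.2 * Complex.I))
    ((Measure.count : Measure (Rest m → ℤ)).prod volume) := by
  obtain ⟨C, hC, h⟩ := hT.line p hσ hcos
  refine Integrable.mono' (integrable_bound hd C) ?_
    (Eventually.of_forall fun ω => norm_mbKernel_le hx (h c hc τ hτ ω))
  refine (aestronglyMeasurable_line (measurable_mbCoef c) σ).mul ?_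
  refine Complex.continuous_exp.comp_aestronglyMeasurable ?_
  refine aestronglyMeasurable_line (f := fun t s => pairing (mbExp d a c p t s) x) (fun t => ?_) σ
  exact (continuous_pairing.comp ((continuous_mbExp c t).prodMk continuous_const)).measurable

/-- The Mellin–Barnes integral is the sum over `t_2, …, t_m` of one dimensional integrals. -/
lemma hasSum_mbIntegral (hd : 0 < d) {T : ℝ} (hT : IsLarge d a T) {c : Fin n → ℂ} {ρ σ τ : ℝ}
    (hσ : mbAbscissa n d p ρ ≤ σ) (hcos : Real.cos (Real.pi / d * (σ - p 0)) = 0) (hc : ‖c‖ ≤ ρ)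
    (hτ : |τ| ≤ T) {x : Fin m ⊕ Fin n → ℂ} (hx : ‖x - basePoint m n d T τ‖ ≤ mbWidth n d) :
    HasSum (fun t => ∫ y : ℝ, mbKernel d a c p t x (σ + y * Complex.I))
      (mbIntegral d a c p σ x) := by
  have hi := integrable_mbKernel hd hT hσ hcos hc hτ hx
  have h1 := hi.integral_prod_left
  have hs := (integrable_count_iff.1 h1).of_norm
  have e : mbIntegral d a c p σ x = ∑' t, ∫ y : ℝ, mbKernel d a c p t x (σ + y * Complex.I) := by
    rw [mbIntegral, integral_prod _ hi, integral_countable h1]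
    simp [measureReal_def]
  rw [e]
  exact hs.hasSum

lemma continuousAt_mbCoef (hd : 0 < d) (ha : ∀ j, ∑ i, a i j = d) {c : Fin n → ℂ} {ρ : ℝ}
    (hc : ‖c‖ ≤ ρ) (t : Rest m → ℤ) {s : ℂ} (hs : mbAbscissa n d p ρ ≤ s.re) :
    ContinuousAt (fun c => mbCoef d a c p t s) c := by
  by_cases ht : ∀ k : Rest m, 0 ≤ t k + |p k|
  · unfold mbCoef mbGamma
    refine ContinuousAt.mul (ContinuousAt.mul continuousAt_const ?_) continuousAt_const
    refine tendsto_finsetProd _ fun j _ => ?_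
    have hu : Continuous fun p' : (Fin n → ℂ) × ℂ => uArg d a p'.1 p t j p'.2 := by
      unfold uArg; fun_prop
    have hu1 : ∀ s, Continuous fun c => uArg d a c p t j s := fun s =>
      hu.comp (continuous_id.prodMk continuous_const)
    change ContinuousAt (fun c => mbFactor d a c p t j s) c
    unfold mbFactor
    split_ifs with h0
    · exact (Complex.differentiable_one_div_Gamma.continuous.comp
        (continuous_const.sub (hu1 s))).continuousAt
    · refine ContinuousAt.mul ?_ ?_
      · exact ((Complex.continuous_sin.comp (continuous_const.mul (hu1 _))).div_const _).continuousAt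
      · refine ContinuousAt.comp (g := Complex.Gamma)
          (Complex.continuousAt_Gamma _ fun k hk => ?_) (hu1 s).continuousAt
        have := one_le_re_uArg hd ha hc ht h0 hs
        rw [hk] at this
        simp at this
        linarith [(Nat.cast_nonneg k : (0 : ℝ) ≤ k)]
  · push Not at ht
    obtain ⟨k, hk⟩ := ht
    simp only [mbCoef, mbGamma_eq_zero hd _ hk, zero_mul]
    exact continuousAt_const

lemma continuousAt_mbIntegral (hd : 0 < d) (ha : ∀ j, ∑ i, a i j = d) {T : ℝ} (hT : IsLarge d a T)
    {c : Fin n → ℂ} {ρ σ τ : ℝ} (hσ : mbAbscissa n d p ρ ≤ σ)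
    (hcos : Real.cos (Real.pi / d * (σ - p 0)) = 0) (hc : ‖c‖ < ρ)
    (hτ : |τ| ≤ T) {x : Fin m ⊕ Fin n → ℂ} (hx : ‖x - basePoint m n d T τ‖ < mbWidth n d) :
    ContinuousAt (fun q : (Fin n → ℂ) × (Fin m ⊕ Fin n → ℂ) => mbIntegral d a q.1 p σ q.2)
      (c, x) := by
  obtain ⟨C, hC, h⟩ := hT.line p hσ hcos
  have hl : ∀ (t : Rest m → ℤ) (s : ℂ), Continuous fun c => mbExp d a c p t s := by
    refine fun t s => continuous_pi fun j => ?_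
    rcases j with k | j
    · exact continuous_const
    · simp only [mbExp, Sum.elim_inr, uArg]; fun_prop
  have hb : ∀ᶠ c' in 𝓝 c, ‖c'‖ < ρ :=
    continuous_norm.continuousAt.eventually_lt continuousAt_const hc
  have key := continuousAt_integral_exp
    (μ := ((Measure.count : Measure (Rest m → ℤ)).prod volume))
    (k := fun c (ω : (Rest m → ℤ) × ℝ) => mbCoef d a c p ω.1 (σ + ω.2 * Complex.I))
    (l := fun c (ω : (Rest m → ℤ) × ℝ) => mbExp d a c p ω.1 (σ + ω.2 * Complex.I))
    (bound := fun ω : (Rest m → ℤ) × ℝ => C * (Real.exp (-∑ k, |(ω.1 k : ℝ)|) *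
      Real.exp (-(Real.pi / (2 * d) * |ω.2|)))) c
    (Eventually.of_forall fun c => aestronglyMeasurable_line (measurable_mbCoef c) σ)
    (Eventually.of_forall fun c =>
      aestronglyMeasurable_line (fun t => (continuous_mbExp c t).measurable) σ)
    (fun ω => continuousAt_mbCoef hd ha hc.le ω.1 (by simpa using hσ))
    (fun ω => (hl ω.1 _).continuousAt)
    (basePoint m n d T τ) (hb.mono fun c' hc' ω => h c' hc'.le τ hτ ω) (integrable_bound hd C) x hx
  unfold mbIntegral mbKernel
  exact key

/-! ### The terms of the initial series -/

/-- The sum of the terms of the series `φ(γ^c_p; z)` with fixed `t_1 = t₀`. -/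
noncomputable def ferSlice (d : ℕ) (a : Matrix (Fin n) (Fin m) ℕ) (c : Fin n → ℂ) (p : Fin m → ℤ)
    (t₀ : ℤ) (x : Fin m ⊕ Fin n → ℂ) : ℂ :=
  ∫ t : Rest m → ℤ, gammaTerm (expFer d a c p) x (latticeVec d a (cons0 t₀ t)) ∂Measure.count

lemma exists_ferSlice_bound (hd : 0 < d) (ha : ∀ j, ∑ i, a i j = d) {T : ℝ} (hT : IsLarge d a T)
    (p : Fin m → ℤ) (ρ τ : ℝ) (t₀ : ℤ) : ∃ C > 0, ∀ c : Fin n → ℂ, ‖c‖ ≤ ρ → ∀ t : Rest m → ℤ,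
      ‖∏ j, (Complex.Gamma (1 + (latticeVec d a (cons0 t₀ t) j : ℂ) + expFer d a c p j))⁻¹‖ *
        Real.exp ((pairing (fun j => (latticeVec d a (cons0 t₀ t) j : ℂ) + expFer d a c p j)
          (basePoint m n d T τ)).re +
          1 * norm1 fun j => (latticeVec d a (cons0 t₀ t) j : ℂ) + expFer d a c p j) ≤
      C * Real.exp (-∑ k, |(t k : ℝ)|) := by
  obtain ⟨C, hC, h⟩ := exists_norm_gammaTerm_le (ρ + ∑ k, |(p k : ℝ)|) (basePoint m n d T τ)
  set L := gammaRate (Fin m ⊕ Fin n) with hL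
  have hL0 : 0 ≤ L := gammaRate_nonneg
  have hd1 : (1 : ℝ) ≤ d := by exact_mod_cast hd
  have hT' : 2 * d * (L + 2) + 1 ≤ T := (rate_le_radiusBound hd).trans (by linarith [hT.radius])
  have hT0 := hT.pos.le
  refine ⟨C * Real.exp (2 * d * (L + 2) * |(t₀ : ℝ)| + t₀ * d * τ +
    ∑ k : Rest m, 2 * |((|p k| : ℤ) : ℝ)| * |d * -T|), by positivity, fun c hc t => ?_⟩
  by_cases hneg : ∃ k : Rest m, t k + |p k| < 0
  · obtain ⟨k, hk⟩ := hneg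
    have h0 : gammaTerm (expFer d a c p) 0 (latticeVec d a (cons0 t₀ t)) = 0 :=
      gammaTerm_latticeVec_eq_zero (k := (k : Fin m)) (g := p k) hd rfl (by simpa using hk)
    rw [gammaTerm_eq] at h0
    rw [(mul_eq_zero.1 h0).resolve_right (Complex.exp_ne_zero _), norm_zero, zero_mul]
    positivity
  · push Not at hneg
    rw [one_mul]
    refine (h _ (norm_expFer_le hd ha hc) _ (sum_latticeVec ha _)).trans ?_
    rw [mul_assoc, ← Real.exp_add]
    refine mul_le_mul_of_nonneg_left (Real.exp_le_exp.2 ?_) hC.le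
    refine (latticeVec_exponent_le ha _ (basePoint m n d T τ) (by simp) (by linarith)).trans ?_
    rw [sum_fin_eq_add (fun k => |((cons0 t₀ t k : ℤ) : ℝ)|),
      sum_fin_eq_add (fun k => ((cons0 t₀ t k : ℤ) : ℝ) * d * (basePoint m n d T τ (.inl k)).re)]
    simp only [cons0_zero, cons0_rest, basePoint_re_zero]
    have h1 : ∑ k : Rest m, (t k : ℝ) * d * (basePoint m n d T τ (.inl k)).re ≤
        ∑ k : Rest m, (-T * |(t k : ℝ)| + 2 * |((|p k| : ℤ) : ℝ)| * |d * -T|) := by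
      refine Finset.sum_le_sum fun k _ => ?_
      rw [mul_assoc, basePoint_inl k.2]
      simp only [Complex.neg_re, Complex.ofReal_re]
      refine int_mul_le_of_neg (hneg k) hT0 ?_
      nlinarith
    rw [Finset.sum_add_distrib, ← Finset.mul_sum] at h1
    have h6 : (0 : ℝ) ≤ ∑ k, |(t k : ℝ)| := Finset.sum_nonneg fun _ _ => abs_nonneg _
    nlinarith

lemma integrable_exp_neg_sum : Integrable (fun t : Rest m → ℤ => Real.exp (-∑ k, |(t k : ℝ)|))
    Measure.count := by
  rw [integrable_count_iff]
  have := (summable_pow_sum_natAbs (κ := Rest m) (θ := Real.exp (-1)) (Real.exp_pos _).le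
    (Real.exp_lt_one_iff.2 (by norm_num)))
  refine this.congr fun t => ?_
  rw [Real.norm_of_nonneg (Real.exp_pos _).le, ← Real.exp_nat_mul, sum_natAbs_cast]
  ring_nf

lemma analyticAt_ferSlice (hd : 0 < d) (ha : ∀ j, ∑ i, a i j = d) {T : ℝ} (hT : IsLarge d a T)
    (c : Fin n → ℂ) (t₀ : ℤ) (τ : ℝ) :
    AnalyticAt ℂ (ferSlice d a c p t₀) (basePoint m n d T τ) := by
  obtain ⟨C, hC, h⟩ := exists_ferSlice_bound hd ha hT p ‖c‖ τ t₀
  have := analyticAt_integral_exp (μ := (Measure.count : Measure (Rest m → ℤ)))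
    (k := fun t => ∏ j, (Complex.Gamma (1 + (latticeVec d a (cons0 t₀ t) j : ℂ) +
      expFer d a c p j))⁻¹)
    (l := fun t j => (latticeVec d a (cons0 t₀ t) j : ℂ) + expFer d a c p j)
    (Measurable.of_discrete).aestronglyMeasurable (Measurable.of_discrete).aestronglyMeasurable
    (basePoint m n d T τ) one_pos (h c le_rfl) (integrable_exp_neg_sum.const_mul C)
  refine this.congr (Eventually.of_forall fun x => ?_)
  simp only [ferSlice, gammaTerm_eq]

lemma continuousAt_ferSlice (hd : 0 < d) (ha : ∀ j, ∑ i, a i j = d) {T : ℝ} (hT : IsLarge d a T)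
    (c : Fin n → ℂ) (t₀ : ℤ) {τ : ℝ} {x : Fin m ⊕ Fin n → ℂ}
    (hx : ‖x - basePoint m n d T τ‖ < 1) :
    ContinuousAt (fun q : (Fin n → ℂ) × (Fin m ⊕ Fin n → ℂ) => ferSlice d a q.1 p t₀ q.2)
      (c, x) := by
  obtain ⟨C, hC, h⟩ := exists_ferSlice_bound hd ha hT p (‖c‖ + 1) τ t₀
  have he : ∀ j, Continuous fun c => expFer d a c p j := by
    rintro (k | j)
    · exact continuous_const
    · simp only [expFer, Sum.elim_inr]; fun_prop
  have := continuousAt_integral_exp (μ := (Measure.count : Measure (Rest m → ℤ)))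
    (k := fun c t => ∏ j, (Complex.Gamma (1 + (latticeVec d a (cons0 t₀ t) j : ℂ) +
      expFer d a c p j))⁻¹)
    (l := fun c t j => (latticeVec d a (cons0 t₀ t) j : ℂ) + expFer d a c p j) c
    (Eventually.of_forall fun c => (Measurable.of_discrete).aestronglyMeasurable)
    (Eventually.of_forall fun c => (Measurable.of_discrete).aestronglyMeasurable)
    (fun t => (continuous_finsetProd _ fun j _ =>
      Complex.differentiable_one_div_Gamma.continuous.comp
        (continuous_const.add (he j))).continuousAt)
    (fun t => (continuous_pi fun j => continuous_const.add (he j)).continuousAt)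
    (basePoint m n d T τ) (δ := 1) (bound := fun t => C * Real.exp (-∑ k, |(t k : ℝ)|))
    (by
      filter_upwards [continuous_norm.continuousAt.eventually_lt (continuousAt_const (y := ‖c‖ + 1))
        (lt_add_one ‖c‖)] with c' hc' t using h c' hc'.le t)
    (integrable_exp_neg_sum.const_mul C) x hx
  simpa only [ferSlice, gammaTerm_eq] using this

lemma hasSum_ferSlice {c : Fin n → ℂ} {x : Fin m ⊕ Fin n → ℂ} (hd : 0 < d)
    (ha : ∀ j, ∑ i, a i j = d) {T : ℝ} (hT : IsLarge d a T) (t₀ : ℤ) {τ : ℝ}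
    (hx : ‖x - basePoint m n d T τ‖ ≤ 1) :
    HasSum (fun t : Rest m → ℤ => gammaTerm (expFer d a c p) x (latticeVec d a (cons0 t₀ t)))
      (ferSlice d a c p t₀ x) := by
  obtain ⟨C, hC, h⟩ := exists_ferSlice_bound hd ha hT p ‖c‖ τ t₀
  have hs : Summable fun t : Rest m → ℤ =>
      gammaTerm (expFer d a c p) x (latticeVec d a (cons0 t₀ t)) := by
    refine summable_of_norm_le_exp (v := fun t => t) Function.injective_id (C := C) fun t => ?_
    refine le_trans ?_ (h c le_rfl t)
    rw [gammaTerm_eq, norm_mul, Complex.norm_exp]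
    refine mul_le_mul_of_nonneg_left (Real.exp_le_exp.2 ?_) (norm_nonneg _)
    refine (re_pairing_le _ x (basePoint m n d T τ)).trans ?_
    have := mul_le_mul_of_nonneg_right hx (norm1_nonneg
      (fun j => (latticeVec d a (cons0 t₀ t) j : ℂ) + expFer d a c p j))
    linarith
  have e : ferSlice d a c p t₀ x = ∑' t : Rest m → ℤ,
      gammaTerm (expFer d a c p) x (latticeVec d a (cons0 t₀ t)) := by
    rw [ferSlice, integral_countable (integrable_count_iff.2 hs.norm)]
    simp [measureReal_def]
  rw [e]
  exact hs.hasSum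

/-! ### The function continued along the path -/

/-- The abscissa of the line of integration, between the poles `p₀ + d (N - 1)` and `p₀ + d N` of
the trigonometric factor. -/
noncomputable def mbLine (d : ℕ) (p₀ : ℤ) (N : ℤ) : ℝ := p₀ + d * (N - 1 / 2)

lemma cos_mbLine (hd : 0 < d) (p₀ N : ℤ) : Real.cos (Real.pi / d * (mbLine d p₀ N - p₀)) = 0 := by
  have hd' : (d : ℝ) ≠ 0 := by exact_mod_cast hd.ne'
  have : Real.pi / d * (mbLine d p₀ N - p₀) = N * Real.pi - Real.pi / 2 := by
    unfold mbLine; field_simp; ring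
  rw [this, Real.cos_sub_pi_div_two, Real.sin_int_mul_pi]

/-- The analytic continuation of `φ(γ^c_p; z)`: finitely many slices of the series, and a
Mellin–Barnes integral for the remaining ones. -/
noncomputable def mbFun (d : ℕ) (a : Matrix (Fin n) (Fin m) ℕ) (c : Fin n → ℂ) (p : Fin m → ℤ)
    (N : ℤ) (x : Fin m ⊕ Fin n → ℂ) : ℂ :=
  ∑ t₀ ∈ Finset.Ico (-|p 0|) N, ferSlice d a c p t₀ x -
    (2 * Real.pi : ℂ)⁻¹ * mbIntegral d a c p (mbLine d (p 0) N) x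

lemma analyticAt_mbFun (hd : 0 < d) (ha : ∀ j, ∑ i, a i j = d) {T : ℝ} (hT : IsLarge d a T)
    {c : Fin n → ℂ} {ρ τ : ℝ} {N : ℤ} (hN : mbAbscissa n d p ρ ≤ mbLine d (p 0) N) (hc : ‖c‖ ≤ ρ)
    (hτ : |τ| ≤ T) : AnalyticAt ℂ (mbFun d a c p N) (basePoint m n d T τ) :=
  (Finset.analyticAt_fun_sum _ fun t₀ _ => analyticAt_ferSlice hd ha hT c t₀ τ).sub
    (analyticAt_const.mul (analyticAt_mbIntegral hd hT hN (cos_mbLine hd _ _) hc hτ))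

lemma mbWidth_le_one (hd : 0 < d) : mbWidth n d ≤ 1 := by
  have hd1 : (1 : ℝ) ≤ d := by exact_mod_cast hd
  have hn : (0 : ℝ) ≤ n := Nat.cast_nonneg _
  unfold mbWidth
  rw [div_le_one (by positivity)]
  have := Real.pi_le_four
  nlinarith

lemma continuousAt_mbFun (hd : 0 < d) (ha : ∀ j, ∑ i, a i j = d) {T : ℝ} (hT : IsLarge d a T)
    {c : Fin n → ℂ} {ρ τ : ℝ} {N : ℤ} (hN : mbAbscissa n d p ρ ≤ mbLine d (p 0) N) (hc : ‖c‖ < ρ)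
    (hτ : |τ| ≤ T) {x : Fin m ⊕ Fin n → ℂ} (hx : ‖x - basePoint m n d T τ‖ < mbWidth n d) :
    ContinuousAt (fun q : (Fin n → ℂ) × (Fin m ⊕ Fin n → ℂ) => mbFun d a q.1 p N q.2) (c, x) :=
  (tendsto_finsetSum _ fun t₀ _ =>
    continuousAt_ferSlice hd ha hT c t₀ (hx.trans_le (mbWidth_le_one hd))).sub
    (continuousAt_const.mul (continuousAt_mbIntegral hd ha hT hN (cos_mbLine hd _ _) hc hτ hx))

end Integral

/-! ### Translation of the line of integration by multiples of `d` -/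

section Shift

open MeasureTheory

lemma inv_Gamma_eq_prod_mul (z : ℂ) (k : ℕ) :
    (Complex.Gamma z)⁻¹ = (∏ i ∈ Finset.range k, (z + i)) * (Complex.Gamma (z + k))⁻¹ := by
  induction k with
  | zero => simp
  | succ k ih =>
    rw [ih, Finset.prod_range_succ, Complex.one_div_Gamma_eq_self_mul_one_div_Gamma_add_one,
      mul_assoc]
    push_cast
    rw [add_assoc]

lemma Gamma_add_natCast {z : ℂ} (hz : ∀ q : ℕ, z ≠ -q) (k : ℕ) :
    Complex.Gamma (z + k) = (∏ i ∈ Finset.range k, (z + i)) * Complex.Gamma z := by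
  have h1 := inv_Gamma_eq_prod_mul z k
  have h2 : Complex.Gamma z ≠ 0 := Complex.Gamma_ne_zero hz
  have h3 : Complex.Gamma (z + k) ≠ 0 := Complex.Gamma_ne_zero fun q hq => hz (q + k) (by
    rw [eq_sub_of_add_eq hq]; push_cast; ring)
  have h4 : ∏ i ∈ Finset.range k, (z + i) ≠ 0 := by
    intro h
    rw [h, zero_mul] at h1
    exact inv_ne_zero h2 h1
  field_simp at h1
  rw [h1]; ring

variable {m n : ℕ} [NeZero m] {d : ℕ} {a : Matrix (Fin n) (Fin m) ℕ} {p : Fin m → ℤ}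

/-- `s` is not a pole of the Gamma factors of the Mellin–Barnes kernel. -/
def MBRegular (d : ℕ) (a : Matrix (Fin n) (Fin m) ℕ) (c : Fin n → ℂ) (p : Fin m → ℤ)
    (t : Rest m → ℤ) (s : ℂ) : Prop :=
  ∀ j, a j 0 ≠ 0 → ∀ q : ℕ, uArg d a c p t j s ≠ -q

lemma uArg_add (hd : 0 < d) (c : Fin n → ℂ) (t : Rest m → ℤ) (j : Fin n) (s z : ℂ) :
    uArg d a c p t j (s + z) = uArg d a c p t j s + z * (a j 0 / d) := by
  rw [uArg_eq hd, uArg_eq hd]; ring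

lemma uArg_add_natCast (hd : 0 < d) (c : Fin n → ℂ) (t : Rest m → ℤ) (j : Fin n) (s : ℂ) :
    uArg d a c p t j (s + d) = uArg d a c p t j s + a j 0 := by
  have hd' : (d : ℂ) ≠ 0 := by exact_mod_cast hd.ne'
  rw [uArg_add hd]
  field_simp

lemma mbGamma_add (hd : 0 < d) {c : Fin n → ℂ} {t : Rest m → ℤ} {s : ℂ}
    (hs : MBRegular d a c p t s) :
    mbGamma d a c p t (s + d) * ∏ i ∈ Finset.range d, (1 + s + i) =
      (∏ j, ∏ i ∈ Finset.range (a j 0), (uArg d a c p t j s + i)) * mbGamma d a c p t s := by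
  have h1 : ∀ j, mbFactor d a c p t j (s + d) =
      (∏ i ∈ Finset.range (a j 0), (uArg d a c p t j s + i)) * mbFactor d a c p t j s := by
    intro j
    unfold mbFactor
    rw [uArg_add_natCast hd]
    split_ifs with h0
    · rw [h0]; simp
    · rw [Gamma_add_natCast (hs j h0)]; ring
  unfold mbGamma
  rw [Finset.prod_congr rfl fun j _ => h1 j, Finset.prod_mul_distrib,
    inv_Gamma_eq_prod_mul (1 + s) d, ← add_assoc]
  ring

lemma norm_mbTrig_add (hd : 0 < d) (p₀ : ℤ) (s : ℂ) : ‖mbTrig d p₀ (s + d)‖ = ‖mbTrig d p₀ s‖ := by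
  have hd' : (d : ℂ) ≠ 0 := by exact_mod_cast hd.ne'
  unfold mbTrig
  have e1 : (Real.pi / d * (s + d - p₀) : ℂ) = Real.pi / d * (s - p₀) + Real.pi := by
    field_simp; ring
  have e2 : (Real.pi * (d - 1) / d * (s + d - p₀) * Complex.I : ℂ) =
      Real.pi * (d - 1) / d * (s - p₀) * Complex.I + ((Real.pi * (d - 1) : ℝ) : ℂ) * Complex.I := by
    push_cast
    field_simp; ring
  rw [e1, e2, Complex.sin_add_pi, Complex.exp_add, norm_div, norm_div, norm_mul, norm_mul, norm_mul,
    Complex.norm_exp_ofReal_mul_I, norm_neg, mul_one]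

/-- The logarithm of the absolute value of `z_1 ^ d / ∏ z_{m+j} ^ a_{j1}`. -/
noncomputable def shiftRate (d : ℕ) (a : Matrix (Fin n) (Fin m) ℕ) (x : Fin m ⊕ Fin n → ℂ) : ℝ :=
  d * (x (.inl 0)).re - ∑ j, a j 0 * (x (.inr j)).re

lemma re_pairing_mbExp_add (hd : 0 < d) (c : Fin n → ℂ) (t : Rest m → ℤ) (s : ℂ)
    (x : Fin m ⊕ Fin n → ℂ) : (pairing (mbExp d a c p t (s + d)) x).re =
      (pairing (mbExp d a c p t s) x).re + shiftRate d a x := by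
  unfold pairing shiftRate
  rw [Fintype.sum_sum_type, Fintype.sum_sum_type,
    sum_fin_eq_add fun k => mbExp d a c p t (s + d) (.inl k) * x (.inl k),
    sum_fin_eq_add fun k => mbExp d a c p t s (.inl k) * x (.inl k)]
  simp only [mbExp, Sum.elim_inl, Sum.elim_inr, dif_pos, uArg_add_natCast hd]
  have h1 : ∀ k : Rest m, (if h : (k : Fin m) = 0 then s + d else (p k : ℂ) + t ⟨k, h⟩ * d) =
      if h : (k : Fin m) = 0 then s else (p k : ℂ) + t ⟨k, h⟩ * d := fun k => by
    rw [dif_neg k.2, dif_neg k.2]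
  simp only [h1, neg_add, add_mul, Finset.sum_add_distrib, Complex.add_re]
  have h2 : (∑ j, -(a j 0 : ℂ) * x (.inr j)).re = -∑ j, a j 0 * (x (.inr j)).re := by
    rw [Complex.re_sum, ← Finset.sum_neg_distrib]
    exact Finset.sum_congr rfl fun j _ => by simp
  rw [h2]
  have h3 : ((d : ℂ) * x (.inl 0)).re = d * (x (.inl 0)).re := by simp
  rw [h3]; ring

lemma norm_mbKernel_add (hd : 0 < d) {c : Fin n → ℂ} {t : Rest m → ℤ} {s : ℂ}
    (hs : MBRegular d a c p t s) (x : Fin m ⊕ Fin n → ℂ) :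
    ‖mbKernel d a c p t x (s + d)‖ * ∏ i ∈ Finset.range d, ‖1 + s + i‖ =
      Real.exp (shiftRate d a x) * (∏ j, ∏ i ∈ Finset.range (a j 0), ‖uArg d a c p t j s + i‖) *
        ‖mbKernel d a c p t x s‖ := by
  have h := congrArg norm (mbGamma_add hd hs)
  simp only [norm_mul, norm_prod] at h
  unfold mbKernel mbCoef
  simp only [norm_mul, Complex.norm_exp]
  rw [norm_mbTrig_add hd, re_pairing_mbExp_add hd, Real.exp_add]
  linear_combination (‖mbTrig d (p 0) s‖ * Real.exp (pairing (mbExp d a c p t s) x).re *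
    Real.exp (shiftRate d a x)) * h

/-- Far from the origin, the ratio of the integrands at `s + d` and `s` is comparable to
`|z_1 ^ d / ∏ z_{m+j} ^ a_{j1}|`. -/
lemma exists_norm_mbKernel_ratio (hd : 0 < d) (ha : ∀ j, ∑ i, a i j = d) (c : Fin n → ℂ)
    (p : Fin m → ℤ) (t : Rest m → ℤ) : ∃ R > 0,
      (∀ s : ℂ, R ≤ |s.im| → MBRegular d a c p t s) ∧
      ∀ x s, R ≤ ‖s‖ → MBRegular d a c p t s →
        ‖mbKernel d a c p t x (s + d)‖ ≤
          Real.exp (shiftRate d a x) * 4 ^ d * ‖mbKernel d a c p t x s‖ ∧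
        ‖mbKernel d a c p t x s‖ ≤
          Real.exp (-shiftRate d a x) * (4 * d) ^ d * ‖mbKernel d a c p t x (s + d)‖ := by
  have hd' : (0 : ℝ) < d := by exact_mod_cast hd
  have hd1 : (1 : ℝ) ≤ d := by exact_mod_cast hd
  set K : ℝ := ∑ j, ‖uBase d a c p j + uInt a t j‖ + d with hK
  have hK0 : 0 < K := by positivity
  have hKj : ∀ j, ‖uBase d a c p j + uInt a t j‖ + d ≤ K := fun j => by
    have := Finset.single_le_sum (f := fun j => ‖uBase d a c p j + uInt a t j‖)
      (fun _ _ => norm_nonneg _) (Finset.mem_univ j)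
    linarith
  refine ⟨2 * d * K + 2 * d + 2, by positivity, fun s hs j hj q hq => ?_, fun x s hs hreg => ?_⟩
  · have hj1 : (1 : ℝ) ≤ a j 0 := by exact_mod_cast Nat.one_le_iff_ne_zero.2 hj
    rw [uArg_eq hd] at hq
    have e : (a j 0 : ℂ) / d = ((a j 0 / d : ℝ) : ℂ) := by push_cast; rfl
    have h1 := congrArg Complex.im hq
    rw [e, Complex.add_im, Complex.im_mul_ofReal] at h1
    simp only [Complex.neg_im, Complex.natCast_im, neg_zero] at h1
    have h2 : |s.im * (a j 0 / d)| ≤ K := by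
      rw [eq_neg_of_add_eq_zero_right h1, abs_neg]
      exact (Complex.abs_im_le_norm _).trans (by linarith [hKj j])
    rw [abs_mul, abs_of_nonneg (by positivity : (0 : ℝ) ≤ a j 0 / d), mul_div_assoc',
      div_le_iff₀ hd'] at h2
    have h3 : |s.im| * 1 ≤ |s.im| * a j 0 := mul_le_mul_of_nonneg_left hj1 (abs_nonneg _)
    nlinarith
  · have hs0 : 0 < ‖s‖ := lt_of_lt_of_le (by positivity) hs
    have hdK : 0 < d * K := by positivity
    have b1 : ∀ i ∈ Finset.range d, ‖s‖ / 2 ≤ ‖1 + s + i‖ ∧ ‖1 + s + i‖ ≤ 2 * ‖s‖ := by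
      intro i hi
      have hi' : (i : ℝ) + 1 ≤ d := by exact_mod_cast Finset.mem_range.1 hi
      have e1 : ‖(1 + i : ℂ)‖ ≤ d := by
        refine (norm_add_le _ _).trans ?_
        rw [norm_one, Complex.norm_natCast]; linarith
      have e2 : 1 + s + i = s + (1 + i) := by ring
      rw [e2]
      have e3 := norm_sub_le_norm_add s (1 + (i : ℂ))
      have e4 := norm_add_le s (1 + (i : ℂ))
      constructor <;> linarith
    have b2 : ∀ j, ∀ i ∈ Finset.range (a j 0), ‖s‖ / (2 * d) ≤ ‖uArg d a c p t j s + i‖ ∧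
        ‖uArg d a c p t j s + i‖ ≤ 2 * ‖s‖ := by
      intro j i hi
      have hi0 : i < a j 0 := Finset.mem_range.1 hi
      have had := le_of_sum_eq ha j 0
      have hj1 : (1 : ℝ) ≤ a j 0 := by exact_mod_cast (Nat.one_le_of_lt hi0)
      have hid : (i : ℝ) ≤ d := by exact_mod_cast (hi0.le.trans had)
      have e2 : uArg d a c p t j s + i = s * (a j 0 / d) + (uBase d a c p j + uInt a t j + i) := by
        rw [uArg_eq hd]; ring
      have e1 : ‖uBase d a c p j + uInt a t j + i‖ ≤ K := by
        refine (norm_add_le _ _).trans ?_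
        rw [Complex.norm_natCast]
        linarith [hKj j]
      have e5 : ‖s * ((a j 0 : ℂ) / d)‖ = ‖s‖ * (a j 0 / d) := by
        rw [norm_mul, norm_div, Complex.norm_natCast, Complex.norm_natCast]
      have e6 : (a j 0 / d : ℝ) ≤ 1 := (div_le_one hd').2 (by exact_mod_cast had)
      have e7 : 1 / d ≤ (a j 0 / d : ℝ) := by gcongr
      rw [e2]
      have e3 := norm_sub_le_norm_add (s * ((a j 0 : ℂ) / d)) (uBase d a c p j + uInt a t j + i)
      have e4 := norm_add_le (s * ((a j 0 : ℂ) / d)) (uBase d a c p j + uInt a t j + i)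
      rw [e5] at e3 e4
      have e8 := mul_le_mul_of_nonneg_left e6 hs0.le
      have e9 := mul_le_mul_of_nonneg_left e7 hs0.le
      have e10 : ‖s‖ / (2 * d) = ‖s‖ * (1 / d) - ‖s‖ / (2 * d) := by field_simp; ring
      have e11 : K ≤ ‖s‖ / (2 * d) := by
        rw [le_div_iff₀ (by positivity)]; linarith
      have e12 : K ≤ d * K := le_mul_of_one_le_left hK0.le hd1
      constructor <;> linarith
    have hpow : ∀ z : ℝ, ∏ j, z ^ (a j 0) = z ^ d := fun z => by
      rw [Finset.prod_pow_eq_pow_sum, ha 0]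
    set P1 := ∏ i ∈ Finset.range d, ‖1 + s + i‖ with hP1
    set P2 := ∏ j, ∏ i ∈ Finset.range (a j 0), ‖uArg d a c p t j s + i‖ with hP2
    have c1 : (‖s‖ / 2) ^ d ≤ P1 := by
      have := Finset.prod_le_prod (s := Finset.range d) (f := fun _ => ‖s‖ / 2)
        (fun _ _ => by positivity) fun i hi => (b1 i hi).1
      rwa [Finset.prod_const, Finset.card_range] at this
    have c2 : P1 ≤ (2 * ‖s‖) ^ d := by
      have := Finset.prod_le_prod (s := Finset.range d) (g := fun _ => 2 * ‖s‖)
        (fun _ _ => norm_nonneg _) fun i hi => (b1 i hi).2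
      rwa [Finset.prod_const, Finset.card_range] at this
    have c3 : (‖s‖ / (2 * d)) ^ d ≤ P2 := by
      rw [← hpow]
      refine Finset.prod_le_prod (fun _ _ => by positivity) fun j _ => ?_
      have := Finset.prod_le_prod (s := Finset.range (a j 0)) (f := fun _ => ‖s‖ / (2 * d))
        (fun _ _ => by positivity) fun i hi => (b2 j i hi).1
      rwa [Finset.prod_const, Finset.card_range] at this
    have c4 : P2 ≤ (2 * ‖s‖) ^ d := by
      rw [← hpow]
      refine Finset.prod_le_prod (fun _ _ => Finset.prod_nonneg fun _ _ => norm_nonneg _)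
        fun j _ => ?_
      have := Finset.prod_le_prod (s := Finset.range (a j 0)) (g := fun _ => 2 * ‖s‖)
        (fun _ _ => norm_nonneg _) fun i hi => (b2 j i hi).2
      rwa [Finset.prod_const, Finset.card_range] at this
    have hrec := norm_mbKernel_add hd hreg x
    rw [← hP1, ← hP2] at hrec
    have hH0 := norm_nonneg (mbKernel d a c p t x s)
    have hH1 := norm_nonneg (mbKernel d a c p t x (s + d))
    have hE := Real.exp_pos (shiftRate d a x)
    constructor
    · have hp : 0 < (‖s‖ / 2) ^ d := by positivity
      have e : (2 * ‖s‖) ^ d = 4 ^ d * (‖s‖ / 2) ^ d := by rw [← mul_pow]; congr 1; ring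
      refine le_of_mul_le_mul_right ?_ hp
      calc _ ≤ ‖mbKernel d a c p t x (s + d)‖ * P1 := by gcongr
        _ = Real.exp (shiftRate d a x) * P2 * ‖mbKernel d a c p t x s‖ := hrec
        _ ≤ Real.exp (shiftRate d a x) * (2 * ‖s‖) ^ d * ‖mbKernel d a c p t x s‖ := by gcongr
        _ = _ := by rw [e]; ring
    · have hp : 0 < (‖s‖ / (2 * d)) ^ d := by positivity
      have e : (2 * ‖s‖) ^ d = (4 * d) ^ d * (‖s‖ / (2 * d)) ^ d := by
        rw [← mul_pow]; congr 1; field_simp; ring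
      refine le_of_mul_le_mul_right ?_ hp
      calc _ ≤ ‖mbKernel d a c p t x s‖ * P2 := by gcongr
        _ = Real.exp (-shiftRate d a x) *
            (Real.exp (shiftRate d a x) * P2 * ‖mbKernel d a c p t x s‖) := by
            have : Real.exp (-shiftRate d a x) * Real.exp (shiftRate d a x) = 1 := by
              rw [← Real.exp_add]; simp
            linear_combination -(P2 * ‖mbKernel d a c p t x s‖) * this
        _ = Real.exp (-shiftRate d a x) * (‖mbKernel d a c p t x (s + d)‖ * P1) := by rw [hrec]
        _ ≤ Real.exp (-shiftRate d a x) * (‖mbKernel d a c p t x (s + d)‖ * (2 * ‖s‖) ^ d) := by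
            gcongr
        _ = _ := by rw [e]; ring

/-- The Mellin–Barnes integrand decreases exponentially on vertical strips. -/
lemma exists_norm_mbKernel_strip (hd : 0 < d) (ha : ∀ j, ∑ i, a i j = d) {T : ℝ}
    (hT : IsLarge d a T) (c : Fin n → ℂ) (p : Fin m → ℤ) (t : Rest m → ℤ) {τ : ℝ} (hτ : |τ| ≤ T)
    {x : Fin m ⊕ Fin n → ℂ} (hx : ‖x - basePoint m n d T τ‖ ≤ mbWidth n d) (α β : ℝ) :
    ∃ C T₀, ∀ s : ℂ, α ≤ s.re → s.re ≤ β → T₀ ≤ |s.im| →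
      ‖mbKernel d a c p t x s‖ ≤ C * Real.exp (-(Real.pi / (2 * d) * |s.im|)) := by
  have hd1 : (1 : ℝ) ≤ d := by exact_mod_cast hd
  obtain ⟨R, hR, hreg, hratio⟩ := exists_norm_mbKernel_ratio hd ha c p t
  set M : ℕ := ⌈mbAbscissa n d p ‖c‖ - α⌉₊ with hM
  have hMα : mbAbscissa n d p ‖c‖ ≤ α + d * M := by
    have h1 := Nat.le_ceil (mbAbscissa n d p ‖c‖ - α)
    have h2 : (M : ℝ) ≤ d * M := le_mul_of_one_le_left (Nat.cast_nonneg _) hd1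
    rw [← hM] at h1
    linarith
  obtain ⟨C, hC, h⟩ := hT.domination p ‖c‖ (β + d * M)
  set K := Real.exp (-shiftRate d a x) * (4 * d) ^ d with hK
  have hK0 : 0 < K := by positivity
  refine ⟨K ^ M * (C * Real.exp (-∑ k, |(t k : ℝ)|)), max R 1, fun s h1 h2 h3 => ?_⟩
  have hiter : ∀ l : ℕ, ‖mbKernel d a c p t x s‖ ≤ K ^ l * ‖mbKernel d a c p t x (s + d * l)‖ := by
    intro l
    induction l with
    | zero => simp
    | succ l ih =>
      have him : (s + d * l).im = s.im := by simp
      have := (hratio x (s + d * l) ?_ (hreg _ (by rw [him]; exact (le_max_left _ _).trans h3))).2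
      · refine ih.trans ?_
        rw [pow_succ, mul_assoc]
        refine mul_le_mul_of_nonneg_left ?_ (by positivity)
        have e : s + d * ((l + 1 : ℕ) : ℂ) = s + d * l + d := by push_cast; ring
        rw [e]; exact this
      · refine ((le_max_left _ _).trans h3).trans ?_
        rw [← him]; exact Complex.abs_im_le_norm _
  have him : (s + d * M).im = s.im := by simp
  have hre : (s + d * M).re = s.re + d * M := by simp
  have hk := norm_mbKernel_le hx (h c le_rfl t (s + d * M) (by rw [hre]; linarith)
    (by rw [hre]; linarith) (Or.inr (by rw [him]; exact (le_max_right _ _).trans h3)) τ hτ)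
  rw [him] at hk
  refine (hiter M).trans ?_
  rw [mul_assoc, mul_assoc]
  exact mul_le_mul_of_nonneg_left hk (by positivity)

/-- Integrals of functions decreasing geometrically. -/
lemma tendsto_integral_zero {g : ℕ → ℝ → ℂ} {k₀ : ℕ} (hi : Integrable (g k₀))
    (h : ∀ k ≥ k₀, ∀ y, ‖g (k + 1) y‖ ≤ 1 / 2 * ‖g k y‖) :
    Tendsto (fun k => ∫ y, g k y) atTop (𝓝 0) := by
  have h1 : ∀ l y, ‖g (l + k₀) y‖ ≤ (1 / 2) ^ l * ‖g k₀ y‖ := by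
    intro l y
    induction l with
    | zero => simp
    | succ l ih =>
      have e : l + 1 + k₀ = l + k₀ + 1 := by ring
      rw [e, pow_succ']
      refine (h (l + k₀) (by omega) y).trans ?_
      rw [mul_assoc]
      exact mul_le_mul_of_nonneg_left ih (by norm_num)
  rw [← tendsto_add_atTop_iff_nat k₀]
  refine squeeze_zero_norm (a := fun l : ℕ => (1 / 2 : ℝ) ^ l * ∫ y, ‖g k₀ y‖) (fun l => ?_) ?_
  · refine (norm_integral_le_of_norm_le (hi.norm.const_mul _)
      (Eventually.of_forall (h1 l))).trans_eq ?_
    rw [integral_const_mul]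
  · have := (tendsto_pow_atTop_nhds_zero_of_lt_one (r := (1 / 2 : ℝ)) (by norm_num)
      (by norm_num)).mul_const (∫ y, ‖g k₀ y‖)
    simpa using this

lemma differentiable_mbExp (c : Fin n → ℂ) (t : Rest m → ℤ) (j : Fin m ⊕ Fin n) :
    Differentiable ℂ fun s => mbExp d a c p t s j := by
  rcases j with k | j
  · by_cases hk : k = 0
    · simp only [mbExp, Sum.elim_inl, hk, dif_pos]; exact differentiable_id
    · simp only [mbExp, Sum.elim_inl, hk, dif_neg, not_false_eq_true]
      exact differentiable_const _
  · simp only [mbExp, Sum.elim_inr, uArg]; fun_prop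

lemma differentiable_pairing_mbExp (c : Fin n → ℂ) (t : Rest m → ℤ) (x : Fin m ⊕ Fin n → ℂ) :
    Differentiable ℂ fun s => pairing (mbExp d a c p t s) x := by
  unfold pairing
  exact Differentiable.fun_sum fun j _ => (differentiable_mbExp c t j).mul_const _

lemma differentiable_uArg (c : Fin n → ℂ) (t : Rest m → ℤ) (j : Fin n) :
    Differentiable ℂ (uArg d a c p t j) := by unfold uArg; fun_prop

lemma differentiableAt_mbFactor {c : Fin n → ℂ} {t : Rest m → ℤ} {s : ℂ} {j : Fin n}
    (hs : a j 0 ≠ 0 → ∀ q : ℕ, uArg d a c p t j s ≠ -q) :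
    DifferentiableAt ℂ (mbFactor d a c p t j) s := by
  unfold mbFactor
  split_ifs with h0
  · exact (Complex.differentiable_one_div_Gamma.comp
      ((differentiable_const 1).sub (differentiable_uArg c t j))).differentiableAt
  · exact ((Complex.differentiableAt_Gamma _ (hs h0)).comp s
      (differentiable_uArg c t j).differentiableAt).const_mul _

lemma differentiableAt_mbGamma {c : Fin n → ℂ} {t : Rest m → ℤ} {s : ℂ}
    (hs : MBRegular d a c p t s) : DifferentiableAt ℂ (mbGamma d a c p t) s := by
  unfold mbGamma
  refine DifferentiableAt.mul (DifferentiableAt.const_mul ?_ _) ?_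
  · exact (Complex.differentiable_one_div_Gamma.comp
      ((differentiable_const 1).add differentiable_id)).differentiableAt
  · exact DifferentiableAt.fun_finsetProd fun j _ => differentiableAt_mbFactor (hs j)

lemma differentiableAt_mbTrig {p₀ : ℤ} {s : ℂ} (hs : Complex.sin (Real.pi / d * (s - p₀)) ≠ 0) :
    DifferentiableAt ℂ (mbTrig d p₀) s := by
  unfold mbTrig
  fun_prop (disch := exact hs)

lemma differentiableAt_mbKernel {c : Fin n → ℂ} {t : Rest m → ℤ} {s : ℂ}
    (hs : MBRegular d a c p t s) (hs' : Complex.sin (Real.pi / d * (s - p 0)) ≠ 0)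
    (x : Fin m ⊕ Fin n → ℂ) : DifferentiableAt ℂ (mbKernel d a c p t x) s := by
  unfold mbKernel mbCoef
  exact ((differentiableAt_mbGamma hs).mul (differentiableAt_mbTrig hs')).mul
    (differentiable_pairing_mbExp c t x).differentiableAt.cexp

end Shift

/-! ### Closing the contour to the right -/

section Right

open MeasureTheory

lemma tendsto_sub_div_sin {f : ℂ → ℂ} {f' s₀ : ℂ} (hf : HasDerivAt f f' s₀)
    (h0 : Complex.sin (f s₀) = 0) (hf' : f' ≠ 0) :
    Tendsto (fun s => (s - s₀) / Complex.sin (f s)) (𝓝[≠] s₀)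
      (𝓝 (Complex.cos (f s₀) * f')⁻¹) := by
  have hc : Complex.cos (f s₀) ≠ 0 := fun h => by
    have := Complex.sin_sq_add_cos_sq (f s₀)
    rw [h0, h] at this
    simp at this
  have h1 := (hasDerivAt_iff_tendsto_slope.1 hf.csin).inv₀ (mul_ne_zero hc hf')
  refine h1.congr fun s => ?_
  rw [slope_def_field, h0, sub_zero, inv_div]

lemma cos_int_mul_pi (k : ℤ) : Complex.cos (k * Real.pi) = (-1) ^ k := by
  have := congrArg (Complex.ofReal) (Real.cos_int_mul_pi k)
  push_cast at this
  exact this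

lemma sin_add_int_mul_pi (z : ℂ) (k : ℤ) :
    Complex.sin (z + k * Real.pi) = (-1) ^ k * Complex.sin z := by
  rw [Complex.sin_add, Complex.sin_int_mul_pi, cos_int_mul_pi]; ring

lemma inv_Gamma_one_sub {z : ℂ} (hz : ∀ q : ℕ, z ≠ -q) :
    (Complex.Gamma (1 - z))⁻¹ = Complex.sin (Real.pi * z) / Real.pi * Complex.Gamma z := by
  have h := Complex.Gamma_mul_Gamma_one_sub z
  have hz' := Complex.Gamma_ne_zero hz
  have hπ : (Real.pi : ℂ) ≠ 0 := by exact_mod_cast Real.pi_ne_zero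
  by_cases hs : Complex.sin (Real.pi * z) = 0
  · rw [hs, div_zero] at h
    rw [(mul_eq_zero.1 h).resolve_left hz', hs]; simp
  · have : Complex.Gamma (1 - z) = Real.pi / Complex.sin (Real.pi * z) / Complex.Gamma z := by
      rw [← h]; field_simp
    rw [this]
    field_simp

variable {m n : ℕ} [NeZero m] {d : ℕ} {a : Matrix (Fin n) (Fin m) ℕ} {p : Fin m → ℤ}

/-- At the points of `p_1 + d ℤ`, the exponents of the integrand are those of the series
`φ(γ^c_p; z)`. -/
lemma mbExp_eq (hd : 0 < d) (c : Fin n → ℂ) (t : Rest m → ℤ) (t₀ : ℤ) :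
    mbExp d a c p t (p 0 + d * t₀) =
      fun j => (latticeVec d a (cons0 t₀ t) j : ℂ) + expFer d a c p j := by
  have hd' : (d : ℂ) ≠ 0 := by exact_mod_cast hd.ne'
  funext j
  rcases j with k | j
  · by_cases hk : k = 0
    · subst hk
      simp [mbExp, expFer]; ring
    · have := cons0_rest t₀ t ⟨k, hk⟩
      simp only at this
      simp [mbExp, expFer, hk, this]; ring
  · simp only [mbExp, Sum.elim_inr, expFer, latticeVec_inr, uArg_eq hd, uBase, uInt]
    rw [sum_fin_eq_add (fun k => cons0 t₀ t k * (a j k : ℤ)),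
      sum_fin_eq_add (fun k => (p k : ℂ) * a j k)]
    simp only [cons0_zero, cons0_rest]
    push_cast
    field_simp
    ring

lemma mbGamma_eq (hd : 0 < d) (ha : ∀ j, ∑ i, a i j = d) {c : Fin n → ℂ} {t : Rest m → ℤ} {t₀ : ℤ}
    (hs : MBRegular d a c p t (p 0 + d * t₀)) :
    mbGamma d a c p t (p 0 + d * t₀) = ((-1) ^ t₀) ^ d *
      ∏ j, (Complex.Gamma (1 + (latticeVec d a (cons0 t₀ t) j : ℂ) + expFer d a c p j))⁻¹ := by
  have hd' : (d : ℂ) ≠ 0 := by exact_mod_cast hd.ne'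
  have hfac : ∀ j, mbFactor d a c p t j (p 0 + d * t₀) = ((-1) ^ t₀) ^ (a j 0) *
      (Complex.Gamma (1 - uArg d a c p t j (p 0 + d * t₀)))⁻¹ := by
    intro j
    unfold mbFactor
    split_ifs with h0
    · rw [h0]; simp
    · rw [inv_Gamma_one_sub (hs j h0), uArg_add hd]
      have e : (Real.pi * (uArg d a c p t j (p 0) + d * t₀ * (a j 0 / d)) : ℂ) =
          Real.pi * uArg d a c p t j (p 0) + ((t₀ * a j 0 : ℤ) : ℂ) * Real.pi := by
        push_cast; field_simp
      rw [e, sin_add_int_mul_pi]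
      have e2 : ((-1 : ℂ) ^ t₀) ^ (a j 0) = (-1) ^ (t₀ * (a j 0 : ℤ)) := by
        rw [zpow_mul, zpow_natCast]
      have e3 : ((-1 : ℂ) ^ (t₀ * (a j 0 : ℤ))) * (-1) ^ (t₀ * (a j 0 : ℤ)) = 1 := by
        rw [← mul_zpow]; simp
      rw [e2]
      linear_combination -(Complex.sin (Real.pi * uArg d a c p t j (p 0)) / Real.pi *
        Complex.Gamma (uArg d a c p t j (p 0) + d * t₀ * (a j 0 / d))) * e3
  have hexp := mbExp_eq (a := a) (p := p) hd c t t₀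
  unfold mbGamma
  rw [Finset.prod_congr rfl fun j _ => hfac j, Finset.prod_mul_distrib, Finset.prod_pow_eq_pow_sum,
    ha 0, Fintype.prod_sum_type, Fintype.prod_eq_mul_prod_subtype_ne _ (0 : Fin m)]
  have e0 : (1 : ℂ) + (latticeVec d a (cons0 t₀ t) (.inl 0) : ℂ) + expFer d a c p (.inl 0) =
      1 + (p 0 + d * t₀) := by
    simp [expFer]; ring
  have ek : ∀ k : Rest m, (1 : ℂ) + (latticeVec d a (cons0 t₀ t) (.inl k) : ℂ) +
      expFer d a c p (.inl k) = 1 + ((t k * d : ℤ) : ℂ) + p k := fun k => by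
    simp [expFer]
  have ej : ∀ j, (1 : ℂ) + (latticeVec d a (cons0 t₀ t) (.inr j) : ℂ) +
      expFer d a c p (.inr j) = 1 - uArg d a c p t j (p 0 + d * t₀) := fun j => by
    have := congrFun hexp (.inr j)
    simp only [mbExp, Sum.elim_inr] at this
    rw [add_assoc, ← this]; ring
  simp only [e0, ek, ej]
  ring

/-- The residue of the Mellin–Barnes integrand at a pole of the trigonometric factor is a term of
the series `φ(γ^c_p; z)`. -/
lemma tendsto_residue_fer (hd : 0 < d) (ha : ∀ j, ∑ i, a i j = d) {c : Fin n → ℂ} {t : Rest m → ℤ}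
    {t₀ : ℤ} (hs : MBRegular d a c p t (p 0 + d * t₀)) (x : Fin m ⊕ Fin n → ℂ) :
    Tendsto (fun s => (s - (p 0 + d * t₀)) * mbKernel d a c p t x s) (𝓝[≠] (p 0 + d * t₀ : ℂ))
      (𝓝 (gammaTerm (expFer d a c p) x (latticeVec d a (cons0 t₀ t)))) := by
  have hd' : (d : ℂ) ≠ 0 := by exact_mod_cast hd.ne'
  have hπ : (Real.pi : ℂ) ≠ 0 := by exact_mod_cast Real.pi_ne_zero
  set s₀ : ℂ := p 0 + d * t₀ with hs₀
  have hz : (Real.pi / d * (s₀ - p 0) : ℂ) = t₀ * Real.pi := by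
    rw [hs₀]; field_simp; ring
  have hsin := tendsto_sub_div_sin (f := fun s : ℂ => Real.pi / d * (s - p 0)) (f' := Real.pi / d)
    (s₀ := s₀) (by simpa using ((hasDerivAt_id s₀).sub_const (p 0 : ℂ)).const_mul (Real.pi / d : ℂ))
    (by rw [hz, Complex.sin_int_mul_pi]) (div_ne_zero hπ hd')
  simp only [hz, cos_int_mul_pi] at hsin
  have hG : Tendsto (mbGamma d a c p t) (𝓝[≠] s₀) (𝓝 (mbGamma d a c p t s₀)) :=
    (differentiableAt_mbGamma hs).continuousAt.tendsto.mono_left nhdsWithin_le_nhds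
  have hE : Tendsto (fun s => Complex.exp (pairing (mbExp d a c p t s) x)) (𝓝[≠] s₀)
      (𝓝 (Complex.exp (pairing (mbExp d a c p t s₀) x))) :=
    (differentiable_pairing_mbExp c t x).differentiableAt.cexp.continuousAt.tendsto.mono_left
      nhdsWithin_le_nhds
  have hX : Tendsto (fun s : ℂ => (Real.pi / d * Complex.exp (Real.pi * (d - 1) / d * (s - p 0) *
      Complex.I) : ℂ)) (𝓝[≠] s₀)
      (𝓝 (Real.pi / d * Complex.exp (Real.pi * (d - 1) / d * (s₀ - p 0) * Complex.I))) := by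
    have : Continuous fun s : ℂ => (Real.pi / d * Complex.exp (Real.pi * (d - 1) / d * (s - p 0) *
      Complex.I) : ℂ) := by fun_prop
    exact this.continuousAt.tendsto.mono_left nhdsWithin_le_nhds
  have key := (hG.mul (hX.mul hsin)).mul hE
  have hval : mbGamma d a c p t s₀ * (Real.pi / d * Complex.exp (Real.pi * (d - 1) / d *
      (s₀ - p 0) * Complex.I) * ((-1 : ℂ) ^ t₀ * (Real.pi / d : ℂ))⁻¹) *
      Complex.exp (pairing (mbExp d a c p t s₀) x) =
      gammaTerm (expFer d a c p) x (latticeVec d a (cons0 t₀ t)) := by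
    have e1 : Complex.exp (Real.pi * (d - 1) / d * (s₀ - p 0) * Complex.I) =
        ((-1) ^ t₀) ^ d * ((-1) ^ t₀)⁻¹ := by
      have e2 : (Real.pi * (d - 1) / d * (s₀ - p 0) * Complex.I : ℂ) =
          d * (t₀ * (Real.pi * Complex.I)) + -(t₀ * (Real.pi * Complex.I)) := by
        rw [hs₀]; field_simp; ring
      rw [e2, Complex.exp_add, Complex.exp_neg, Complex.exp_nat_mul, Complex.exp_int_mul,
        Complex.exp_pi_mul_I]
    have e4 : ((-1 : ℂ) ^ t₀) * (-1) ^ t₀ = 1 := by rw [← mul_zpow]; simp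
    have e3 : ((-1 : ℂ) ^ t₀)⁻¹ = (-1) ^ t₀ := inv_eq_of_mul_eq_one_left e4
    rw [gammaTerm_eq, ← mbExp_eq hd, mbGamma_eq hd ha hs, e1, mul_inv, e3]
    have e5 : (((-1 : ℂ) ^ t₀) ^ d) * ((-1) ^ t₀) ^ d = 1 := by rw [← mul_pow, e4, one_pow]
    have e6 : (Real.pi / d : ℂ) * (Real.pi / d : ℂ)⁻¹ = 1 := mul_inv_cancel₀ (div_ne_zero hπ hd')
    set W := ∏ j, (Complex.Gamma (1 + (latticeVec d a (cons0 t₀ t) j : ℂ) + expFer d a c p j))⁻¹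
    set ε : ℂ := (-1) ^ t₀
    set X := Complex.exp (pairing (mbExp d a c p t s₀) x)
    calc _ = (ε ^ d * ε ^ d) * (ε * ε) * (Real.pi / d * (Real.pi / d : ℂ)⁻¹) * (W * X) := by ring
      _ = _ := by rw [e4, e5, e6]; ring
  rw [hval] at key
  refine key.congr fun s => ?_
  simp only [mbKernel, mbCoef, mbTrig]
  ring

lemma sin_ne_zero_of_ne (hd : 0 < d) {p₀ : ℤ} {s : ℂ} (h : ∀ k : ℤ, s ≠ p₀ + d * k) :
    Complex.sin (Real.pi / d * (s - p₀)) ≠ 0 := by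
  have hd' : (d : ℂ) ≠ 0 := by exact_mod_cast hd.ne'
  have hπ : (Real.pi : ℂ) ≠ 0 := by exact_mod_cast Real.pi_ne_zero
  intro h0
  obtain ⟨k, hk⟩ := Complex.sin_eq_zero_iff.1 h0
  refine h k ?_
  field_simp at hk
  linear_combination hk

lemma mbRegular_of_le (hd : 0 < d) (ha : ∀ j, ∑ i, a i j = d) {c : Fin n → ℂ} {ρ : ℝ}
    (hc : ‖c‖ ≤ ρ) {t : Rest m → ℤ} (ht : ∀ k : Rest m, 0 ≤ t k + |p k|) {s : ℂ}
    (hs : mbAbscissa n d p ρ ≤ s.re) : MBRegular d a c p t s := fun j hj q hq => by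
  have := one_le_re_uArg hd ha hc ht hj hs
  rw [hq] at this
  simp at this
  linarith [(Nat.cast_nonneg q : (0 : ℝ) ≤ q)]

lemma integrable_mbKernel_line (hd : 0 < d) (ha : ∀ j, ∑ i, a i j = d) {T : ℝ}
    (hT : IsLarge d a T) (c : Fin n → ℂ) (p : Fin m → ℤ) (t : Rest m → ℤ) {τ : ℝ} (hτ : |τ| ≤ T)
    {x : Fin m ⊕ Fin n → ℂ} (hx : ‖x - basePoint m n d T τ‖ ≤ mbWidth n d) {σ : ℝ}
    (hreg : ∀ s : ℂ, s.re = σ → MBRegular d a c p t s)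
    (hsin : ∀ s : ℂ, s.re = σ → ∀ k : ℤ, s ≠ p 0 + d * k) :
    Integrable fun y : ℝ => mbKernel d a c p t x (σ + y * Complex.I) := by
  have hd' : (0 : ℝ) < d := by exact_mod_cast hd
  obtain ⟨C, T₀, h⟩ := exists_norm_mbKernel_strip hd ha hT c p t hτ hx σ σ
  refine integrable_of_norm_le_exp (δ := Real.pi / (2 * d)) (C := C) (T := T₀) ?_
    (by positivity) fun y hy => ?_
  · refine continuous_iff_continuousAt.2 fun y => ?_
    have hre : (σ + y * Complex.I : ℂ).re = σ := by simp
    have := (differentiableAt_mbKernel (hreg _ hre) (sin_ne_zero_of_ne hd (hsin _ hre))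
      x).continuousAt
    exact ContinuousAt.comp (f := fun y : ℝ => (σ + y * Complex.I : ℂ)) this (by fun_prop)
  · have := h (σ + y * Complex.I) (by simp) (by simp) (by simpa using hy)
    simpa using this

lemma ne_of_re_eq_mbLine (hd : 0 < d) {p₀ N : ℤ} {s : ℂ} (hs : s.re = mbLine d p₀ N) (k : ℤ) :
    s ≠ p₀ + d * k := by
  have hd' : (0 : ℝ) < d := by exact_mod_cast hd
  rintro rfl
  simp only [mbLine, Complex.add_re, Complex.intCast_re, Complex.mul_re, Complex.natCast_re,
    Complex.natCast_im, Complex.intCast_im, mul_zero, sub_zero, add_right_inj] at hs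
  have h1 : (k : ℝ) = N - 1 / 2 := mul_left_cancel₀ hd'.ne' hs
  have h2 : (2 * k : ℤ) = 2 * N - 1 := by
    have : (2 * k : ℝ) = 2 * N - 1 := by linarith
    exact_mod_cast this
  omega

lemma mbLine_add_one (p₀ N : ℤ) : mbLine d p₀ (N + 1) = mbLine d p₀ N + d := by
  unfold mbLine; push_cast; ring

lemma integral_mbLine_add_one (hd : 0 < d) (ha : ∀ j, ∑ i, a i j = d) {T : ℝ}
    (hT : IsLarge d a T) {c : Fin n → ℂ} {ρ : ℝ} (hc : ‖c‖ ≤ ρ) {t : Rest m → ℤ}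
    (ht : ∀ k : Rest m, 0 ≤ t k + |p k|) {τ : ℝ} (hτ : |τ| ≤ T)
    {x : Fin m ⊕ Fin n → ℂ} (hx : ‖x - basePoint m n d T τ‖ ≤ mbWidth n d) {N : ℤ}
    (hN : mbAbscissa n d p ρ ≤ mbLine d (p 0) N) :
    (∫ y : ℝ, mbKernel d a c p t x (mbLine d (p 0) (N + 1) + y * Complex.I)) -
      ∫ y : ℝ, mbKernel d a c p t x (mbLine d (p 0) N + y * Complex.I) =
      2 * Real.pi * gammaTerm (expFer d a c p) x (latticeVec d a (cons0 N t)) := by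
  have hd' : (0 : ℝ) < d := by exact_mod_cast hd
  obtain ⟨C, T₀, h⟩ := exists_norm_mbKernel_strip hd ha hT c p t hτ hx (mbLine d (p 0) N)
    (mbLine d (p 0) (N + 1))
  have hlt : mbLine d (p 0) N < mbLine d (p 0) (N + 1) := by rw [mbLine_add_one]; linarith
  have hre : (p 0 + d * N : ℂ).re = p 0 + d * N := by simp
  have h1 : mbLine d (p 0) N < p 0 + d * N := by unfold mbLine; linarith
  have h2 : p 0 + d * N < mbLine d (p 0) (N + 1) := by unfold mbLine; push_cast; linarith
  have := integral_line_sub_integral_line hlt {(p 0 + d * N : ℂ)}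
    (fun _ => gammaTerm (expFer d a c p) x (latticeVec d a (cons0 N t)))
    (fun s hs => by rw [Finset.mem_singleton.1 hs, hre]; exact ⟨h1, h2⟩) (fun s hs1 hs2 hs => ?_)
    (fun s hs => by
      rw [Finset.mem_singleton.1 hs]
      exact tendsto_residue_fer hd ha (mbRegular_of_le hd ha hc ht (by rw [hre]; linarith)) x)
    (by positivity : 0 < Real.pi / (2 * d)) h
  · rw [this, Finset.sum_singleton]
  · refine differentiableAt_mbKernel (mbRegular_of_le hd ha hc ht (hN.trans hs1))
      (sin_ne_zero_of_ne hd fun k hk => hs ?_) x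
    rw [hk] at hs1 hs2
    simp only [mbLine, Complex.add_re, Complex.intCast_re, Complex.mul_re, Complex.natCast_re,
      Complex.natCast_im, Complex.intCast_im, mul_zero, sub_zero, add_le_add_iff_left,
      mul_le_mul_iff_right₀ hd'] at hs1 hs2
    push_cast at hs2
    have e1 : N ≤ k := by
      have : (N : ℝ) < k + 1 := by linarith
      exact Int.lt_add_one_iff.1 (by exact_mod_cast this)
    have e2 : k ≤ N := by
      have : (k : ℝ) < N + 1 := by linarith
      exact Int.lt_add_one_iff.1 (by exact_mod_cast this)
    rw [hk, le_antisymm e2 e1]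
    exact Finset.mem_singleton_self _

/-- The integral is minus the sum of the residues to the right of the line of integration. -/
lemma hasSum_right (hd : 0 < d) (ha : ∀ j, ∑ i, a i j = d) {T : ℝ}
    (hT : IsLarge d a T) {c : Fin n → ℂ} {ρ : ℝ} (hc : ‖c‖ ≤ ρ) {t : Rest m → ℤ}
    {τ : ℝ} (hτ : |τ| ≤ T)
    {x : Fin m ⊕ Fin n → ℂ} (hx : ‖x - basePoint m n d T τ‖ ≤ mbWidth n d)
    (hE : Real.exp (shiftRate d a x) * 4 ^ d ≤ 1 / 2) {N : ℤ}
    (hN : mbAbscissa n d p ρ ≤ mbLine d (p 0) N)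
    (hs : Summable fun t₀ : ℤ => gammaTerm (expFer d a c p) x (latticeVec d a (cons0 t₀ t))) :
    HasSum (fun t₀ : ℤ => gammaTerm (expFer d a c p) x (latticeVec d a (cons0 t₀ t)))
      (∑ t₀ ∈ Finset.Ico (-|p 0|) N, gammaTerm (expFer d a c p) x (latticeVec d a (cons0 t₀ t)) -
        (2 * Real.pi : ℂ)⁻¹ * ∫ y : ℝ, mbKernel d a c p t x (mbLine d (p 0) N + y * Complex.I)) := by
  have hπ : (Real.pi : ℂ) ≠ 0 := by exact_mod_cast Real.pi_ne_zero
  have hd' : (0 : ℝ) < d := by exact_mod_cast hd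
  by_cases ht : ∀ k : Rest m, 0 ≤ t k + |p k|
  swap
  · push Not at ht
    obtain ⟨k, hk⟩ := ht
    have h1 : ∀ t₀, gammaTerm (expFer d a c p) x (latticeVec d a (cons0 t₀ t)) = 0 := fun t₀ =>
      gammaTerm_latticeVec_eq_zero (k := (k : Fin m)) (g := p k) hd rfl (by simpa using hk)
    have h2 : ∀ s, mbKernel d a c p t x s = 0 := fun s => by
      rw [mbKernel, mbCoef, mbGamma_eq_zero hd c hk, zero_mul, zero_mul]
    simp only [h1, h2, Finset.sum_const_zero, integral_zero, mul_zero, sub_zero]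
    exact hasSum_zero
  set f : ℤ → ℂ := fun t₀ => gammaTerm (expFer d a c p) x (latticeVec d a (cons0 t₀ t)) with hf
  set G : ℕ → ℂ := fun k =>
    ∫ y : ℝ, mbKernel d a c p t x (mbLine d (p 0) (N + k) + y * Complex.I) with hG
  have hNk : ∀ k : ℕ, mbAbscissa n d p ρ ≤ mbLine d (p 0) (N + k) := fun k => by
    refine hN.trans ?_
    unfold mbLine
    push_cast
    have : (0 : ℝ) ≤ d * k := by positivity
    linarith
  have hG0 : Tendsto G atTop (𝓝 0) := by
    obtain ⟨R, hR, hreg, hratio⟩ := exists_norm_mbKernel_ratio hd ha c p t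
    obtain ⟨k₀, hk₀⟩ := exists_nat_ge ((R - mbLine d (p 0) N) / d)
    refine tendsto_integral_zero (g := fun k y =>
      mbKernel d a c p t x (mbLine d (p 0) (N + k) + y * Complex.I)) (k₀ := k₀) ?_ ?_
    · refine integrable_mbKernel_line hd ha hT c p t hτ hx (fun s hs => ?_) (fun s hs => ?_)
      · exact mbRegular_of_le hd ha hc ht ((hNk k₀).trans_eq hs.symm)
      · exact ne_of_re_eq_mbLine hd hs
    · intro k hk y
      have hre : (mbLine d (p 0) (N + k) + y * Complex.I : ℂ).re = mbLine d (p 0) (N + k) := by simp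
      have := (hratio x (mbLine d (p 0) (N + k) + y * Complex.I) ?_
        (mbRegular_of_le hd ha hc ht ((hNk k).trans_eq hre.symm))).1
      · have e : ((mbLine d (p 0) (N + (k + 1 : ℕ)) : ℂ) + y * Complex.I) =
            mbLine d (p 0) (N + k) + y * Complex.I + d := by
          have := mbLine_add_one (d := d) (p 0) (N + k)
          push_cast
          rw [← add_assoc, this]; push_cast; ring
        rw [e]
        exact this.trans (mul_le_mul_of_nonneg_right hE (norm_nonneg _))
      · refine le_trans ?_ (Complex.re_le_norm _)
        rw [hre]
        rw [div_le_iff₀ hd'] at hk₀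
        have : (k₀ : ℝ) * d ≤ k * d := by gcongr
        have e : mbLine d (p 0) (N + k) = mbLine d (p 0) N + k * d := by
          unfold mbLine; push_cast; ring
        rw [e]; linarith
  have hstep : ∀ k : ℕ, G k - G 0 = 2 * Real.pi * ∑ l ∈ Finset.range k, f (N + l) := by
    intro k
    induction k with
    | zero => simp
    | succ k ih =>
      have := integral_mbLine_add_one hd ha hT hc ht hτ hx (hNk k)
      rw [Finset.sum_range_succ, mul_add, ← ih]
      have e : G (k + 1) - G k = 2 * Real.pi * f (N + k) := by
        rw [← this]
        simp only [hG]
        push_cast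
        rw [← add_assoc]
      rw [← e]; ring
  have hlim : Tendsto (fun k => ∑ l ∈ Finset.range k, f (N + l)) atTop
      (𝓝 (-((2 * Real.pi : ℂ)⁻¹ * G 0))) := by
    have h1 : ∀ k, ∑ l ∈ Finset.range k, f (N + l) = (2 * Real.pi : ℂ)⁻¹ * (G k - G 0) := fun k => by
      rw [hstep]; field_simp
    simp only [h1]
    have := (hG0.sub_const (G 0)).const_mul (2 * Real.pi : ℂ)⁻¹
    simpa using this
  have hsN : Summable fun l : ℕ => f (N + l) := hs.comp_injective fun l l' h => by
    simpa using h
  have hN1 : HasSum (fun l : ℕ => f (N + l)) (-((2 * Real.pi : ℂ)⁻¹ * G 0)) := by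
    have := hsN.hasSum.tendsto_sum_nat
    rw [← tendsto_nhds_unique this hlim]
    exact hsN.hasSum
  -- the terms with `t₀ < -|p_1|` vanish
  have hz : ∀ t₀ < -|p 0|, f t₀ = 0 := fun t₀ h =>
    gammaTerm_latticeVec_eq_zero (k := (0 : Fin m)) (g := p 0) hd rfl (by simp; linarith)
  have hI : HasSum (fun t₀ : ℤ => if N ≤ t₀ then f t₀ else 0) (-((2 * Real.pi : ℂ)⁻¹ * G 0)) := by
    have hinj : Function.Injective fun l : ℕ => N + (l : ℤ) := fun l l' h => by simpa using h
    rw [← hinj.hasSum_iff (fun t₀ h => ?_)]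
    · have e : (fun t₀ : ℤ => if N ≤ t₀ then f t₀ else 0) ∘ (fun l : ℕ => N + (l : ℤ)) =
          fun l : ℕ => f (N + l) := by funext l; simp
      rw [e]
      exact hN1
    · refine if_neg fun h' => h ⟨(t₀ - N).toNat, ?_⟩
      simp only
      omega
  have hF : HasSum (fun t₀ : ℤ => if t₀ ∈ Finset.Ico (-|p 0|) N then f t₀ else 0)
      (∑ t₀ ∈ Finset.Ico (-|p 0|) N, f t₀) := by
    rw [← Finset.sum_congr rfl fun b hb => if_pos hb]
    exact hasSum_sum_of_ne_finset_zero fun b hb => if_neg hb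
  have := hF.add hI
  rw [← sub_eq_add_neg] at this
  have hG00 : G 0 = ∫ y : ℝ, mbKernel d a c p t x (mbLine d (p 0) N + y * Complex.I) := by
    simp [hG]
  rw [hG00] at this
  have e : (fun t₀ : ℤ => (if t₀ ∈ Finset.Ico (-|p 0|) N then f t₀ else 0) +
      if N ≤ t₀ then f t₀ else 0) = f := by
    funext t₀
    by_cases h1 : N ≤ t₀
    · rw [if_neg (by simp [h1]), if_pos h1, zero_add]
    · by_cases h2 : -|p 0| ≤ t₀
      · rw [if_pos (by simp [h2, not_le.1 h1]), if_neg h1, add_zero]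
      · rw [if_neg (by simp [h2]), if_neg h1, add_zero, hz t₀ (not_le.1 h2)]
  rwa [e] at this

/-- The decomposition `t = (t_1, (t_2, …, t_m))`. -/
def cons0Equiv (m : ℕ) [NeZero m] : (Rest m → ℤ) × ℤ ≃ (Fin m → ℤ) where
  toFun q := cons0 q.2 q.1
  invFun t := (fun k => t k, t 0)
  left_inv q := by ext k <;> simp
  right_inv t := by
    funext k
    by_cases hk : k = 0
    · subst hk; simp
    · exact cons0_rest _ _ ⟨k, hk⟩

/-- Near the start of the path, the function `mbFun` is the Gamma series. -/
lemma mbFun_eq_gammaSeries (hd : 0 < d) (ha : ∀ j, ∑ i, a i j = d)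
    (hB : Submodule.span ℤ (Set.range (fermatB d a)) = lattice (fermatA d a)) {T : ℝ}
    (hT : IsLarge d a T) {c : Fin n → ℂ} {ρ : ℝ} (hc : ‖c‖ ≤ ρ) {x : Fin m ⊕ Fin n → ℂ}
    (hx : ‖x - basePoint m n d T (-T)‖ < mbWidth n d) {N : ℤ}
    (hN : mbAbscissa n d p ρ ≤ mbLine d (p 0) N) :
    mbFun d a c p N x = gammaSeries (fermatA d a) (expFer d a c p) x := by
  have hd' : (0 : ℝ) < d := by exact_mod_cast hd
  have hτ : |(-T)| ≤ T := by rw [abs_neg, abs_of_pos hT.pos]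
  have hx1 : ‖x - basePoint m n d T (-T)‖ < 1 := hx.trans_le (mbWidth_le_one hd)
  obtain ⟨g1, g2⟩ := near_start (m := m) (n := n) (d := d) (T := T) (x := x) fun j => by
    rw [← Complex.sub_re]
    exact ((Complex.abs_re_le_norm _).trans (norm_le_pi_norm (x - basePoint m n d T (-T)) j)).trans_lt hx1
  have hE : Real.exp (shiftRate d a x) * 4 ^ d ≤ 1 / 2 := by
    have h1 : shiftRate d a x ≤ d * (-6 : ℝ) := by
      have h2 : -∑ j, a j 0 * (x (.inr j)).re ≤ d := by
        have e : ((∑ j, a j 0 : ℕ) : ℝ) = d := by exact_mod_cast ha 0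
        rw [← e, ← Finset.sum_neg_distrib]
        push_cast
        refine Finset.sum_le_sum fun j _ => ?_
        have := (abs_le.1 (g2 j)).1
        have h0 : (0 : ℝ) ≤ a j 0 := Nat.cast_nonneg _
        nlinarith
      have h3 := hT.ratio
      have hd1 : (1 : ℝ) ≤ d := by exact_mod_cast hd
      have h4 : d * (x (.inl 0)).re ≤ d * (-7 : ℝ) :=
        mul_le_mul_of_nonneg_left (by linarith [g1 0]) hd'.le
      unfold shiftRate
      linarith
    have h5 : Real.exp (-6) ≤ 1 / 8 := by
      rw [Real.exp_neg, one_div]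
      refine inv_anti₀ (by norm_num) ?_
      have := Real.quadratic_le_exp_of_nonneg (x := 6) (by norm_num)
      linarith
    calc _ ≤ Real.exp (d * (-6)) * 4 ^ d := by gcongr
      _ = (Real.exp (-6) * 4) ^ d := by rw [Real.exp_nat_mul, mul_pow]
      _ ≤ (1 / 2) ^ d := by gcongr; linarith
      _ ≤ (1 / 2) ^ 1 := pow_le_pow_of_le_one (by norm_num) (by norm_num) hd
      _ = _ := pow_one _
  have hs : Summable fun t => gammaTerm (expFer d a c p) x (latticeVec d a t) :=
    summable_gammaTerm_fer hd ha (T := T - 1) (by linarith [hT.radius]) (g := p) (fun k => rfl) g1 g2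
  have hs2 := ((cons0Equiv m).hasSum_iff.2 hs.hasSum).prod_fiberwise fun t =>
    hasSum_right hd ha hT hc (t := t) hτ hx.le hE hN
      (hs.comp_injective (i := fun t₀ : ℤ => cons0 t₀ t) fun t₀ t₁ h => by
        have := congrFun h 0
        simpa using this)
  rw [gammaSeries_eq_tsum hd hB]
  refine HasSum.unique ?_ hs2
  exact (hasSum_sum fun t₀ _ => hasSum_ferSlice hd ha hT t₀ hx1.le).sub
    ((hasSum_mbIntegral hd hT hN (cos_mbLine hd _ _) hc hτ hx.le).mul_left _)

end Right

/-! ### The residues at the poles of the Gamma factors -/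

section Residue

/-- The multiplication formula of the sine. -/
lemma two_pow_mul_prod_sin {d : ℕ} (hd : 0 < d) (x : ℂ) :
    2 ^ (d - 1) * (∏ j ∈ Finset.Icc 1 (d - 1), Complex.sin (Real.pi / d * (x + j))) *
      Complex.sin (Real.pi / d * x) = Complex.sin (Real.pi * x) := by
  have hd' : (d : ℂ) ≠ 0 := by exact_mod_cast hd.ne'
  have hπ : (Real.pi : ℂ) ≠ 0 := by exact_mod_cast Real.pi_ne_zero
  have hrange : (∏ j ∈ Finset.Icc 1 (d - 1), Complex.sin (Real.pi / d * (x + j))) *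
      Complex.sin (Real.pi / d * x) = ∏ j ∈ Finset.range d, Complex.sin (Real.pi / d * (x + j)) := by
    obtain ⟨e, rfl⟩ : ∃ e, d = e + 1 := ⟨d - 1, by omega⟩
    rw [Finset.prod_range_succ', Nat.add_sub_cancel, Finset.range_eq_Ico,
      Finset.prod_Ico_add' (fun j : ℕ => Complex.sin (Real.pi / (e + 1 : ℕ) * (x + j))) 0 e 1]
    simp only [Nat.cast_zero, add_zero, zero_add]
    rfl
  rw [mul_assoc, hrange]
  set w : ℂ := Complex.exp (Real.pi / d * x * Complex.I) with hw
  set ζ : ℂ := Complex.exp (2 * Real.pi * Complex.I / d) with hζ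
  have hζp : IsPrimitiveRoot ζ d := Complex.isPrimitiveRoot_exp d hd.ne'
  have hprod := congrArg (Polynomial.eval 1) (X_pow_sub_C_eq_prod hζp hd (rfl : (w ^ 2) ^ d = _))
  simp only [Polynomial.eval_sub, Polynomial.eval_pow, Polynomial.eval_X, Polynomial.eval_C,
    Polynomial.eval_prod, one_pow] at hprod
  have hsin : ∀ j : ℕ, Complex.sin (Real.pi / d * (x + j)) =
      (1 - ζ ^ j * w ^ 2) * (Complex.exp (-(Real.pi / d * (x + j)) * Complex.I) *
        (Complex.I / 2)) := by
    intro j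
    have e : ζ ^ j * w ^ 2 * Complex.exp (-(Real.pi / d * (x + j)) * Complex.I) =
        Complex.exp (Real.pi / d * (x + j) * Complex.I) := by
      rw [hζ, hw, ← Complex.exp_nat_mul, ← Complex.exp_nat_mul, ← Complex.exp_add,
        ← Complex.exp_add]
      congr 1
      push_cast
      field_simp
      ring
    rw [Complex.sin, ← e]
    ring
  simp only [hsin]
  rw [Finset.prod_mul_distrib, ← hprod, Finset.prod_mul_distrib, Finset.prod_const,
    Finset.card_range, ← Complex.exp_sum]
  have hsum : ∑ j ∈ Finset.range d, -(Real.pi / d * (x + j)) * Complex.I =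
      -(Real.pi * x) * Complex.I + -(((d - 1 : ℕ) : ℂ) * (Real.pi / 2 * Complex.I)) := by
    have h2 : (∑ j ∈ Finset.range d, (j : ℂ)) * 2 = d * ((d - 1 : ℕ) : ℂ) := by
      have := congrArg (Nat.cast : ℕ → ℂ) (Finset.sum_range_id_mul_two d)
      rw [Nat.cast_mul, Nat.cast_sum, Nat.cast_mul] at this
      exact_mod_cast this
    rw [← Finset.sum_mul, Finset.sum_neg_distrib, ← Finset.mul_sum, Finset.sum_add_distrib,
      Finset.sum_const, Finset.card_range, nsmul_eq_mul]
    have h3 : (∑ j ∈ Finset.range d, (j : ℂ)) = d * ((d - 1 : ℕ) : ℂ) / 2 := by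
      rw [← h2]; ring
    rw [h3]
    field_simp
    ring
  rw [hsum, Complex.exp_add, Complex.exp_neg (_ * _), Complex.exp_nat_mul,
    Complex.exp_pi_div_two_mul_I]
  have hwd : (w ^ 2) ^ d = Complex.exp (Real.pi * x * Complex.I) ^ 2 := by
    rw [← pow_mul, mul_comm 2 d, pow_mul, hw, ← Complex.exp_nat_mul]
    congr 2
    field_simp
  rw [hwd, Complex.sin]
  have hI : Complex.I ≠ 0 := Complex.I_ne_zero
  have e1 : (2 : ℂ) ^ (d - 1) * (Complex.I ^ (d - 1))⁻¹ * (Complex.I / 2) ^ d = Complex.I / 2 := by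
    obtain ⟨e, rfl⟩ : ∃ e, d = e + 1 := ⟨d - 1, by omega⟩
    rw [Nat.add_sub_cancel, pow_succ, div_pow]
    field_simp
  have e2 : Complex.exp (-(Real.pi * x) * Complex.I) * Complex.exp (Real.pi * x * Complex.I) = 1 := by
    rw [← Complex.exp_add]; simp
  set A := Complex.exp (-(Real.pi * x) * Complex.I)
  set B := Complex.exp (Real.pi * x * Complex.I)
  calc _ = (2 : ℂ) ^ (d - 1) * (Complex.I ^ (d - 1))⁻¹ * (Complex.I / 2) ^ d *
        (A - A * B * B) := by ring
    _ = _ := by rw [e1, e2]; ring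

variable {m n : ℕ} [NeZero m] {d : ℕ} {a : Matrix (Fin n) (Fin m) ℕ} {p : Fin m → ℤ}

lemma sum_filter_ne_zero {M : Type*} [AddCommMonoid M] (f : Fin m → M) :
    ∑ k with k ≠ 0, f k = ∑ k : Rest m, f k :=
  Finset.sum_subtype _ (by simp) f

/-- The coordinates of `γ^c_q(𝐚_1, i)` other than those prescribed are not integers, if `c` is very
generic. -/
lemma veryGeneric_expDwork {c : Fin n → ℂ} (hd : 0 < d)
    (hc : VeryGeneric (fermatA d a) (cellsDwork a) c) {i : Fin n} (hi : a i 0 ≠ 0) (q : Fin m → ℤ) :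
    (∀ k : ℤ, expDwork d a c q i (.inl 0) ≠ k) ∧
      ∀ j ≠ i, ∀ k : ℤ, expDwork d a c q i (.inr j) ≠ k := by
  have hd' : (d : ℂ) ≠ 0 := by exact_mod_cast hd.ne'
  have hi' : (a i 0 : ℂ) ≠ 0 := by exact_mod_cast hi
  have h := hc _ ⟨i, hi, rfl⟩ (expDwork d a c q i) (fun j => ?_) (fun j hj => ?_)
  · exact ⟨h _ (by simp), fun j hj => h _ (by simp [hj])⟩
  · rw [Fintype.sum_sum_type, sum_fin_eq_add, Finset.sum_eq_single j]
    · simp only [fermatA_inl, fermatA_inr, expDwork, Sum.elim_inl, Sum.elim_inr, if_true]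
      have e1 : ∑ k : Rest m, (((a j k : ℕ) : ℤ) : ℂ) *
          (if (k : Fin m) = 0 then -numDwork d a c q i / a i 0 else (q k : ℂ)) =
          ∑ k : Rest m, (q k : ℂ) * a j k :=
        Finset.sum_congr rfl fun k _ => by rw [if_neg k.2]; push_cast; ring
      rw [e1]
      by_cases hj : j = i
      · subst hj
        simp only [numDwork, sum_filter_ne_zero, if_true]
        push_cast
        field_simp
        ring
      · simp only [sum_filter_ne_zero, if_neg hj]
        push_cast
        field_simp
        ring
    · intro k _ hk
      simp [fermatA_inr, hk.symm]
    · simp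
  · rcases j with k | j
    · simp only [Finset.mem_insert, Sum.inl.injEq, Finset.mem_image, Finset.mem_erase,
        reduceCtorEq, and_false, exists_false, or_false] at hj
      exact ⟨q k, by simp [expDwork, hj]⟩
    · have : j = i := by
        by_contra h
        exact hj (by simp [h])
      exact ⟨q 0, by simp [expDwork, this]⟩

/-- The pole of the `i`-th Gamma factor at which `u_i = -q`. -/
noncomputable def mbPole (d : ℕ) (a : Matrix (Fin n) (Fin m) ℕ) (c : Fin n → ℂ) (p : Fin m → ℤ)
    (t : Rest m → ℤ) (i : Fin n) (q : ℤ) : ℂ :=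
  expDwork d a c (qVec d p (cons0 q t)) i (.inl 0)

lemma mbPole_eq (c : Fin n → ℂ) (t : Rest m → ℤ) (i : Fin n) (q : ℤ) :
    mbPole d a c p t i q =
      -(c i + q * d + ∑ k : Rest m, ((p k : ℂ) + t k * d) * a i k) / a i 0 := by
  simp only [mbPole, expDwork, Sum.elim_inl, if_true, numDwork, sum_filter_ne_zero, qVec,
    cons0_zero]
  congr 3
  refine Finset.sum_congr rfl fun k _ => ?_
  rw [if_neg k.2, cons0_rest]
  push_cast; ring

lemma uArg_eq_neg_iff (hd : 0 < d) (c : Fin n → ℂ) (t : Rest m → ℤ) {i : Fin n} (hi : a i 0 ≠ 0)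
    (q : ℤ) (s : ℂ) : uArg d a c p t i s = -q ↔ s = mbPole d a c p t i q := by
  have hd' : (d : ℂ) ≠ 0 := by exact_mod_cast hd.ne'
  have hi' : (a i 0 : ℂ) ≠ 0 := by exact_mod_cast hi
  rw [mbPole_eq, uArg, div_eq_iff hd', eq_div_iff hi']
  constructor <;> intro h <;> linear_combination h

lemma mbExp_mbPole (hd : 0 < d) (c : Fin n → ℂ) (t : Rest m → ℤ) {i : Fin n} (hi : a i 0 ≠ 0)
    (q : ℤ) : mbExp d a c p t (mbPole d a c p t i q) =
      expDwork d a c (qVec d p (cons0 q t)) i := by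
  have hd' : (d : ℂ) ≠ 0 := by exact_mod_cast hd.ne'
  have hi' : (a i 0 : ℂ) ≠ 0 := by exact_mod_cast hi
  have hk : ∀ k : Rest m, (qVec d p (cons0 q t) k : ℂ) = (p k : ℂ) + t k * d := fun k => by
    simp [qVec, k.2]
  funext j
  rcases j with k | j
  · by_cases h : k = 0
    · subst h; simp [mbExp, mbPole]
    · have := hk ⟨k, h⟩
      simp only at this
      simp [mbExp, expDwork, h, this]
  · simp only [mbExp, Sum.elim_inr]
    by_cases hj : j = i
    · subst hj
      rw [(uArg_eq_neg_iff hd c t hi q _).2 rfl]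
      simp [expDwork, qVec]
    · simp only [expDwork, Sum.elim_inr, if_neg hj, numDwork, sum_filter_ne_zero, uArg, mbPole_eq,
        hk]
      simp only [qVec, if_true, cons0_zero]
      field_simp
      ring

lemma prod_neg_one_zpow {κ : Type*} (S : Finset κ) (f : κ → ℤ) :
    ∏ j ∈ S, (-1 : ℂ) ^ f j = (-1) ^ ∑ j ∈ S, f j := by
  classical
  induction S using Finset.induction_on with
  | empty => simp
  | insert j S hj ih => rw [Finset.prod_insert hj, Finset.sum_insert hj, zpow_add₀ (by norm_num), ih]

/-- A term of the expression `(*)`, indexed by the exponents `(t_1, p_2 + t_2 d, …, p_m + t_m d)`. -/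
noncomputable def dworkTerm (d : ℕ) (a : Matrix (Fin n) (Fin m) ℕ) (c : Fin n → ℂ) (p : Fin m → ℤ)
    (x : Fin m ⊕ Fin n → ℂ) (i : Fin n) (t : Fin m → ℤ) : ℂ :=
  coeffDwork d a i p (qVec d p t) c * gammaTerm (expDwork d a c (qVec d p t) i) x 0

lemma neg_one_zpow_mul_self (k : ℤ) : (-1 : ℂ) ^ k * (-1) ^ k = 1 := by
  rw [← mul_zpow]; simp

lemma residue_algebra {K G0 ε Pe Se Ge si εq π α δ Gi E r P S0 X εp εd Ps : ℂ} (hα : α ≠ 0)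
    (hπ : π ≠ 0) (hδ : δ ≠ 0) (h1 : si * Pe = εd * Ps)
    (h2 : εp * εp = 1) :
    K * G0 * (ε * (Pe / Se) * Ge) * (si * (εq * (π * (α / δ))⁻¹ * Gi)) *
      (π / δ * E * (r * P) / S0) * X =
    -(εp * r / α * Ps * (-ε * (εq * εp * εd) / (S0 * Se)) * (P * E) *
      (G0 * K * (Gi * Ge) * X)) := by
  have e0 : (π * (α / δ))⁻¹ * (π / δ) = α⁻¹ := by field_simp
  calc _ = K * G0 * Ge * Gi * X * ε * εq * r * P * E * (si * Pe) * Se⁻¹ * S0⁻¹ *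
        ((π * (α / δ))⁻¹ * (π / δ)) := by ring
    _ = K * G0 * Ge * Gi * X * ε * εq * r * P * E * ((εp * εp) * (εd * Ps)) * Se⁻¹ * S0⁻¹ * α⁻¹ := by
        rw [e0, h1, h2, one_mul]
    _ = _ := by ring

set_option maxHeartbeats 1000000 in
/-- The residue of the Mellin–Barnes integrand at a pole of a Gamma factor. -/
lemma tendsto_residue_dwork (hd : 0 < d) (ha : ∀ j, ∑ i, a i j = d) {c : Fin n → ℂ}
    (hc : VeryGeneric (fermatA d a) (cellsDwork a) c) (t : Rest m → ℤ) {i : Fin n} (hi : a i 0 ≠ 0)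
    (q : ℕ) (x : Fin m ⊕ Fin n → ℂ) :
    Tendsto (fun s => (s - mbPole d a c p t i q) * mbKernel d a c p t x s)
      (𝓝[≠] (mbPole d a c p t i q)) (𝓝 (-dworkTerm d a c p x i (cons0 q t))) := by
  have hd' : (d : ℂ) ≠ 0 := by exact_mod_cast hd.ne'
  have hi' : (a i 0 : ℂ) ≠ 0 := by exact_mod_cast hi
  have hπ : (Real.pi : ℂ) ≠ 0 := by exact_mod_cast Real.pi_ne_zero
  set s₀ := mbPole d a c p t i q with hs₀
  set Q := qVec d p (cons0 (q : ℤ) t) with hQ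
  set γ := expDwork d a c Q i with hγ
  obtain ⟨hg0, hgj⟩ := veryGeneric_expDwork hd hc hi Q
  rw [← hγ] at hg0 hgj
  have hsinne : ∀ z : ℂ, (∀ k : ℤ, z ≠ k) → Complex.sin (Real.pi * z) ≠ 0 := fun z hz h => by
    obtain ⟨k, hk⟩ := Complex.sin_eq_zero_iff.1 h
    refine hz k ?_
    rw [mul_comm] at hk
    exact mul_right_cancel₀ hπ hk
  have hexp : mbExp d a c p t s₀ = γ := mbExp_mbPole hd c t hi q
  have hγ0 : γ (.inl 0) = s₀ := rfl
  have hu : ∀ j, uArg d a c p t j s₀ = -γ (.inr j) := fun j => by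
    rw [← hexp]; simp [mbExp]
  have hγi : γ (.inr i) = q := by
    have := (uArg_eq_neg_iff hd c t hi (q : ℤ) s₀).2 rfl
    rw [hu, neg_inj] at this
    rw [this]; norm_num
  -- of the factors of the kernel, only `Γ(u_i)` has a pole at `s₀`
  have hui : HasDerivAt (fun s => (Real.pi : ℂ) * uArg d a c p t i s) (Real.pi * (a i 0 / d)) s₀ := by
    have : (fun s => (Real.pi : ℂ) * uArg d a c p t i s) = fun s => Real.pi *
        (uBase d a c p i + uInt a t i + s * (a i 0 / d)) := by
      funext s; rw [uArg_eq hd]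
    rw [this]
    have := (((hasDerivAt_id s₀).mul_const (a i 0 / d : ℂ)).const_add
      (uBase d a c p i + uInt a t i)).const_mul (Real.pi : ℂ)
    simpa using this
  have hval : (Real.pi : ℂ) * uArg d a c p t i s₀ = ((-q : ℤ) : ℂ) * Real.pi := by
    rw [hu, hγi]; push_cast; ring
  have hsing := tendsto_sub_div_sin hui (by rw [hval, Complex.sin_int_mul_pi])
    (mul_ne_zero hπ (div_ne_zero hi' hd'))
  rw [hval, cos_int_mul_pi] at hsing
  have hcont : ∀ {f : ℂ → ℂ}, ContinuousAt f s₀ → Tendsto f (𝓝[≠] s₀) (𝓝 (f s₀)) := fun h =>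
    h.tendsto.mono_left nhdsWithin_le_nhds
  have hG1 : Tendsto (fun s => (Complex.Gamma (1 - uArg d a c p t i s))⁻¹) (𝓝[≠] s₀)
      (𝓝 (Complex.Gamma (1 - uArg d a c p t i s₀))⁻¹) :=
    hcont (f := fun s => (Complex.Gamma (1 - uArg d a c p t i s))⁻¹)
    (Complex.differentiable_one_div_Gamma.continuous.comp
      (continuous_const.sub (differentiable_uArg c t i).continuous)).continuousAt
  have hfi : Tendsto (fun s => (s - s₀) * mbFactor d a c p t i s) (𝓝[≠] s₀)
      (𝓝 (Complex.sin (Real.pi * uArg d a c p t i (p 0)) *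
        (((-1 : ℂ) ^ (-q : ℤ) * (Real.pi * (a i 0 / d)))⁻¹ *
        (Complex.Gamma (1 - uArg d a c p t i s₀))⁻¹))) := by
    have hne : (Complex.Gamma (1 - uArg d a c p t i s₀))⁻¹ ≠ 0 := by
      refine inv_ne_zero (Complex.Gamma_ne_zero_of_re_pos ?_)
      rw [hu, hγi]
      simp
      positivity
    refine ((hsing.mul hG1).const_mul _).congr' ?_
    filter_upwards [hG1.eventually_ne hne] with s h1
    rw [mbFactor, if_neg hi]
    have hΓ : Complex.Gamma (uArg d a c p t i s) = Real.pi *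
        ((Complex.sin (Real.pi * uArg d a c p t i s))⁻¹ *
          (Complex.Gamma (1 - uArg d a c p t i s))⁻¹) := by
      rw [← mul_assoc, ← div_eq_mul_inv, ← div_eq_mul_inv,
        ← Complex.Gamma_mul_Gamma_one_sub (uArg d a c p t i s),
        mul_div_cancel_right₀ _ fun h0 => h1 (by rw [h0, inv_zero])]
    rw [hΓ]
    field_simp
  have hfj : ∀ j ≠ i, Tendsto (mbFactor d a c p t j) (𝓝[≠] s₀) (𝓝 (mbFactor d a c p t j s₀)) := by
    intro j hj
    refine hcont (differentiableAt_mbFactor fun hj0 k hk => ?_).continuousAt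
    rw [hu, neg_inj] at hk
    exact hgj j hj k (by rw [hk]; norm_num)
  have hfjv : ∀ j ≠ i, mbFactor d a c p t j s₀ = -(Complex.sin (Real.pi * uArg d a c p t j (p 0)) /
      Complex.sin (Real.pi * γ (.inr j))) * (Complex.Gamma (1 + γ (.inr j)))⁻¹ := by
    intro j hj
    have hs := hsinne _ (hgj j hj)
    have e1 : 1 - uArg d a c p t j s₀ = 1 + γ (.inr j) := by rw [hu]; ring
    unfold mbFactor
    split_ifs with h0
    · have e2 : uArg d a c p t j (p 0) = -γ (.inr j) := by
        rw [← hu, uArg_eq hd, uArg_eq hd, h0]; simp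
      rw [e1, e2, mul_neg, Complex.sin_neg, neg_div, div_self hs]; simp
    · have h := inv_Gamma_one_sub (z := uArg d a c p t j s₀) fun k hk => by
        rw [hu, neg_inj] at hk
        exact hgj j hj k (by rw [hk]; norm_num)
      rw [e1, hu, mul_neg, Complex.sin_neg] at h
      rw [h, hu]
      field_simp
  have hΓ0 : Tendsto (fun s => (Complex.Gamma (1 + s))⁻¹) (𝓝[≠] s₀)
      (𝓝 (Complex.Gamma (1 + s₀))⁻¹) :=
    hcont (f := fun s => (Complex.Gamma (1 + s))⁻¹)
      (Complex.differentiable_one_div_Gamma.continuous.comp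
      (continuous_const.add continuous_id)).continuousAt
  have hsd : Complex.sin (Real.pi * (s₀ - p 0)) ≠ 0 := hsinne _ fun k hk => hg0 (k + p 0) (by
    rw [hγ0, sub_eq_iff_eq_add.1 hk]; push_cast; rfl)
  have hmult := two_pow_mul_prod_sin hd (s₀ - p 0)
  have hsd' : Complex.sin (Real.pi / d * (s₀ - p 0)) ≠ 0 := fun h => by
    rw [h, mul_zero] at hmult; exact hsd hmult.symm
  have hTr := hcont (differentiableAt_mbTrig hsd').continuousAt
  have hE := hcont (differentiable_pairing_mbExp (p := p) (d := d) (a := a) c t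
    x).differentiableAt.cexp.continuousAt
  have hprod := tendsto_finsetProd (Finset.univ.erase i) fun j hj => hfj j (Finset.ne_of_mem_erase hj)
  have key := ((((hΓ0.const_mul (∏ k : Rest m, (Complex.Gamma (1 + ((t k * d : ℤ) : ℂ) +
    p k))⁻¹)).mul hprod).mul hfi).mul hTr).mul hE
  have hfun : ∀ s, (∏ k : Rest m, (Complex.Gamma (1 + ((t k * d : ℤ) : ℂ) + p k))⁻¹) *
      (Complex.Gamma (1 + s))⁻¹ * (∏ j ∈ Finset.univ.erase i, mbFactor d a c p t j s) *
      ((s - s₀) * mbFactor d a c p t i s) * mbTrig d (p 0) s *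
      Complex.exp (pairing (mbExp d a c p t s) x) = (s - s₀) * mbKernel d a c p t x s := by
    intro s
    rw [mbKernel, mbCoef, mbGamma, ← Finset.mul_prod_erase Finset.univ _ (Finset.mem_univ i)]
    ring
  -- the sines at `s = p_1` are those in the coefficient, up to signs
  have hS1 : Complex.sin (Real.pi * uArg d a c p t i (p 0)) *
      ∏ j ∈ Finset.univ.erase i, Complex.sin (Real.pi * uArg d a c p t j (p 0)) =
      (-1) ^ (d * ∑ k, t k : ℤ) *
        ∏ j, Complex.sin (Real.pi / d * (c j + ∑ k, (p k : ℂ) * a j k)) := by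
    rw [Finset.mul_prod_erase Finset.univ (fun j => Complex.sin (Real.pi * uArg d a c p t j (p 0)))
      (Finset.mem_univ i)]
    have e1 : ∀ j, Complex.sin (Real.pi * uArg d a c p t j (p 0)) = (-1) ^ uInt a t j *
        Complex.sin (Real.pi / d * (c j + ∑ k, (p k : ℂ) * a j k)) := by
      intro j
      rw [← sin_add_int_mul_pi]
      congr 1
      rw [uArg_eq hd, uBase, sum_fin_eq_add (fun k => (p k : ℂ) * a j k)]
      field_simp
      ring
    have e2 : ∑ j, uInt a t j = d * ∑ k, t k := by
      unfold uInt
      rw [Finset.sum_comm, Finset.mul_sum]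
      refine Finset.sum_congr rfl fun k _ => ?_
      rw [← Finset.mul_sum, mul_comm]
      congr 1
      exact_mod_cast ha k
    rw [Finset.prod_congr rfl fun j _ => e1 j, Finset.prod_mul_distrib, prod_neg_one_zpow, e2]
  have hQsum : (-1 : ℂ) ^ (∑ k, Q k) =
      (-1) ^ q * (-1) ^ (∑ k : Rest m, p k) * (-1) ^ (d * ∑ k, t k : ℤ) := by
    have : ∑ k, Q k = q + ∑ k : Rest m, p k + d * ∑ k, t k := by
      rw [sum_fin_eq_add, Finset.mul_sum, add_assoc, ← Finset.sum_add_distrib]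
      have h0 : Q 0 = q := by simp [hQ, qVec]
      rw [h0]
      congr 1
      refine Finset.sum_congr rfl fun k _ => ?_
      simp [hQ, qVec, k.2, mul_comm]
    rw [this, zpow_add₀ (by norm_num), zpow_add₀ (by norm_num), zpow_natCast]
  have hTrv : mbTrig d (p 0) s₀ = Real.pi / d *
      Complex.exp (((d - 1) * s₀ + p 0) * Real.pi * Complex.I / d) *
      (2 ^ (d - 1) * ∏ j ∈ Finset.Icc 1 (d - 1), Complex.sin (Real.pi / d * (s₀ - p 0 + j))) /
      Complex.sin (Real.pi * s₀) := by
    have e1 : Complex.sin (Real.pi * (s₀ - p 0)) = (-1) ^ (-p 0) * Complex.sin (Real.pi * s₀) := by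
      rw [← sin_add_int_mul_pi]
      congr 1
      push_cast; ring
    have e2 : Complex.exp (Real.pi * (d - 1) / d * (s₀ - p 0) * Complex.I) =
        Complex.exp (((d - 1) * s₀ + p 0) * Real.pi * Complex.I / d) * (-1) ^ (-p 0) := by
      rw [← Complex.exp_pi_mul_I, ← Complex.exp_int_mul, ← Complex.exp_add]
      congr 1
      push_cast
      field_simp
      ring
    rw [e1] at hmult
    have e3 := neg_one_zpow_mul_self (-p 0)
    have e4 := hsinne s₀ hg0
    rw [mbTrig, e2, div_eq_div_iff hsd' e4]
    linear_combination (-(Real.pi / d * Complex.exp (((d - 1) * s₀ + p 0) * Real.pi * Complex.I / d))) *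
      hmult
  have hcoefP : ∏ j ∈ Finset.univ.erase i, mbFactor d a c p t j s₀ = (-1) ^ (n - 1) *
      ((∏ j ∈ Finset.univ.erase i, Complex.sin (Real.pi * uArg d a c p t j (p 0))) /
        ∏ j ∈ Finset.univ.erase i, Complex.sin (Real.pi * γ (.inr j))) *
      ∏ j ∈ Finset.univ.erase i, (Complex.Gamma (1 + γ (.inr j)))⁻¹ := by
    rw [Finset.prod_congr rfl fun j hj => hfjv j (Finset.ne_of_mem_erase hj),
      Finset.prod_mul_distrib, ← Finset.prod_div_distrib, Finset.prod_neg,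
      Finset.card_erase_of_mem (Finset.mem_univ i), Finset.card_univ, Fintype.card_fin]
  have hn : (-1 : ℂ) ^ n = -(-1) ^ (n - 1) := by
    have : n = n - 1 + 1 := by have := i.pos; omega
    conv_lhs => rw [this, pow_succ]
    ring
  have hgt : gammaTerm γ x 0 = (Complex.Gamma (1 + s₀))⁻¹ *
      (∏ k : Rest m, (Complex.Gamma (1 + ((t k * d : ℤ) : ℂ) + p k))⁻¹) *
      ((Complex.Gamma (1 - uArg d a c p t i s₀))⁻¹ *
        ∏ j ∈ Finset.univ.erase i, (Complex.Gamma (1 + γ (.inr j)))⁻¹) *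
      Complex.exp (pairing (mbExp d a c p t s₀) x) := by
    rw [gammaTerm_eq, Fintype.prod_sum_type, Fintype.prod_eq_mul_prod_subtype_ne _ (0 : Fin m),
      ← Finset.mul_prod_erase Finset.univ _ (Finset.mem_univ i), hexp, hu]
    simp only [Pi.zero_apply, Int.cast_zero, add_zero, zero_add, hγ0, sub_neg_eq_add]
    congr 3
    refine Finset.prod_congr rfl fun k _ => ?_
    congr 2
    simp [hγ, expDwork, hQ, qVec, k.2]
    ring
  have hinv : ((-1 : ℂ) ^ (-(q : ℤ)))⁻¹ = (-1) ^ q := by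
    rw [zpow_neg, inv_inv, zpow_natCast]
  have hlim : (∏ k : Rest m, (Complex.Gamma (1 + ((t k * d : ℤ) : ℂ) + p k))⁻¹) *
      (Complex.Gamma (1 + s₀))⁻¹ * (∏ j ∈ Finset.univ.erase i, mbFactor d a c p t j s₀) *
      (Complex.sin (Real.pi * uArg d a c p t i (p 0)) *
        (((-1 : ℂ) ^ (-q : ℤ) * (Real.pi * (a i 0 / d)))⁻¹ *
        (Complex.Gamma (1 - uArg d a c p t i s₀))⁻¹)) * mbTrig d (p 0) s₀ *
      Complex.exp (pairing (mbExp d a c p t s₀) x) = -dworkTerm d a c p x i (cons0 q t) := by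
    rw [dworkTerm, coeffDwork, ← hQ, ← hγ, hgt, hcoefP, hTrv, hQsum, sum_filter_ne_zero, hn, hγ0,
      Finset.filter_ne', mul_inv, hinv]
    have e3 := neg_one_zpow_mul_self (∑ k : Rest m, p k)
    exact residue_algebra hi' hπ hd' hS1 e3
  rw [← hlim]
  exact key.congr hfun

end Residue

/-! ### Closing the contour to the left -/

section Left

open MeasureTheory

variable {m n : ℕ} [NeZero m] {d : ℕ} {a : Matrix (Fin n) (Fin m) ℕ} {p : Fin m → ℤ}

/-- The poles of the Mellin–Barnes integrand to the left of the line `Re s = mbLine d p₁ N`: those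
of the trigonometric factor, and those of the Gamma factors. -/
abbrev PoleIndex (a : Matrix (Fin n) (Fin m) ℕ) (N : ℤ) : Type :=
  {t₀ : ℤ // t₀ < N} ⊕ {i : Fin n // a i 0 ≠ 0} × ℕ

/-- The position of a pole. -/
noncomputable def polePos (d : ℕ) (a : Matrix (Fin n) (Fin m) ℕ) (c : Fin n → ℂ) (p : Fin m → ℤ)
    (t : Rest m → ℤ) (N : ℤ) : PoleIndex a N → ℂ :=
  Sum.elim (fun t₀ => p 0 + d * (t₀ : ℤ)) fun iq => mbPole d a c p t iq.1 (iq.2 : ℤ)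

/-- The residue at a pole. -/
noncomputable def poleRes (d : ℕ) (a : Matrix (Fin n) (Fin m) ℕ) (c : Fin n → ℂ) (p : Fin m → ℤ)
    (t : Rest m → ℤ) (x : Fin m ⊕ Fin n → ℂ) (N : ℤ) : PoleIndex a N → ℂ :=
  Sum.elim (fun t₀ => gammaTerm (expFer d a c p) x (latticeVec d a (cons0 t₀ t)))
    fun iq => -dworkTerm d a c p x iq.1 (cons0 iq.2 t)

lemma mbPole_ne_int {c : Fin n → ℂ} (hd : 0 < d)
    (hc : VeryGeneric (fermatA d a) (cellsDwork a) c) (t : Rest m → ℤ) {i : Fin n} (hi : a i 0 ≠ 0)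
    (q k : ℤ) : mbPole d a c p t i q ≠ k :=
  (veryGeneric_expDwork hd hc hi _).1 k

lemma mbRegular_int {c : Fin n → ℂ} (hd : 0 < d)
    (hc : VeryGeneric (fermatA d a) (cellsDwork a) c) (t : Rest m → ℤ) (t₀ : ℤ) :
    MBRegular d a c p t (p 0 + d * t₀) := fun j hj q hq => by
  have hq' : uArg d a c p t j (p 0 + d * t₀) = -((q : ℤ) : ℂ) := by rw [hq]; norm_num
  refine mbPole_ne_int (p := p) hd hc t hj q (p 0 + d * t₀) ?_
  rw [← (uArg_eq_neg_iff hd c t hj (q : ℤ) _).1 hq']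
  push_cast; rfl

lemma polePos_injective {c : Fin n → ℂ} (hd : 0 < d)
    (hc : VeryGeneric (fermatA d a) (cellsDwork a) c) (t : Rest m → ℤ) (N : ℤ) :
    Function.Injective (polePos d a c p t N) := by
  have hd' : (d : ℂ) ≠ 0 := by exact_mod_cast hd.ne'
  have key : ∀ (t₀ : ℤ) (i : {i : Fin n // a i 0 ≠ 0}) (q : ℕ),
      mbPole d a c p t i (q : ℤ) ≠ p 0 + d * t₀ := fun t₀ i q h =>
    mbPole_ne_int (p := p) hd hc t i.2 q (p 0 + d * t₀) (by rw [h]; push_cast; rfl)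
  rintro (t₀ | ⟨i, q⟩) (t₁ | ⟨i', q'⟩) h
  · simp only [polePos, Sum.elim_inl, add_right_inj, mul_eq_mul_left_iff, hd', or_false,
      Int.cast_inj] at h
    rw [Subtype.ext h]
  · exact absurd h.symm (key _ _ _)
  · exact absurd h (key _ _ _)
  · simp only [polePos, Sum.elim_inr] at h
    have h1 := (uArg_eq_neg_iff (p := p) hd c t i.2 (q : ℤ) _).2 rfl
    have h2 := (uArg_eq_neg_iff (p := p) hd c t i'.2 (q' : ℤ) _).2 rfl
    have hii : (i' : Fin n) = i := by
      by_contra hne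
      have h3 := (veryGeneric_expDwork hd hc i.2 (qVec d p (cons0 (q : ℤ) t))).2 i' hne q'
      rw [← mbExp_mbPole hd c t i.2 (q : ℤ), h] at h3
      simp only [mbExp, Sum.elim_inr] at h3
      rw [h2, neg_neg] at h3
      exact h3 rfl
    have hi2 : i' = i := Subtype.ext hii
    subst hi2
    rw [h, h2, neg_inj] at h1
    have : q' = q := by exact_mod_cast h1
    rw [this]

lemma tendsto_residue_pole (hd : 0 < d) (ha : ∀ j, ∑ i, a i j = d) {c : Fin n → ℂ}
    (hc : VeryGeneric (fermatA d a) (cellsDwork a) c) (t : Rest m → ℤ) (N : ℤ)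
    (x : Fin m ⊕ Fin n → ℂ) (w : PoleIndex a N) :
    Tendsto (fun s => (s - polePos d a c p t N w) * mbKernel d a c p t x s)
      (𝓝[≠] (polePos d a c p t N w)) (𝓝 (poleRes d a c p t x N w)) := by
  rcases w with t₀ | ⟨i, q⟩
  · exact tendsto_residue_fer hd ha (mbRegular_int hd hc t t₀) x
  · exact tendsto_residue_dwork hd ha hc t i.2 q x

lemma polePos_re_lt (hd : 0 < d) (ha : ∀ j, ∑ i, a i j = d) {c : Fin n → ℂ} {ρ : ℝ}
    (hρ : ‖c‖ ≤ ρ) {t : Rest m → ℤ} (ht : ∀ k : Rest m, 0 ≤ t k + |p k|) {N : ℤ}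
    (hN : mbAbscissa n d p ρ ≤ mbLine d (p 0) N) (w : PoleIndex a N) :
    (polePos d a c p t N w).re < mbLine d (p 0) N := by
  have hd' : (0 : ℝ) < d := by exact_mod_cast hd
  rcases w with ⟨t₀, h⟩ | ⟨i, q⟩
  · have h1 : (t₀ : ℝ) + 1 ≤ N := by exact_mod_cast h
    simp only [polePos, Sum.elim_inl, mbLine, Complex.add_re, Complex.intCast_re, Complex.mul_re,
      Complex.natCast_re, Complex.natCast_im, Complex.intCast_im, mul_zero, sub_zero]
    have : (d : ℝ) * t₀ < d * (N - 1 / 2) := mul_lt_mul_of_pos_left (by linarith) hd'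
    linarith
  · by_contra h
    have := mbRegular_of_le hd ha hρ ht (hN.trans (not_lt.1 h)) i i.2 q
    refine this ?_
    simp only [polePos, Sum.elim_inr]
    rw [(uArg_eq_neg_iff hd c t i.2 (q : ℤ) _).2 rfl]
    norm_num

lemma mbPole_re_le (ha : ∀ j, ∑ i, a i j = d) (c : Fin n → ℂ) (t : Rest m → ℤ)
    {i : Fin n} (hi : a i 0 ≠ 0) (q : ℕ) :
    (mbPole d a c p t i q).re ≤ ∑ j, ‖mbPole d a c p t j 0‖ - q := by
  have hi' : (0 : ℝ) < a i 0 := by exact_mod_cast Nat.pos_of_ne_zero hi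
  have e : mbPole d a c p t i q = mbPole d a c p t i 0 - ((q * (d / a i 0) : ℝ) : ℂ) := by
    rw [mbPole_eq, mbPole_eq]
    push_cast
    ring
  have h1 : (mbPole d a c p t i 0).re ≤ ∑ j, ‖mbPole d a c p t j 0‖ :=
    (Complex.re_le_norm _).trans (Finset.single_le_sum (f := fun j => ‖mbPole d a c p t j 0‖)
      (fun _ _ => norm_nonneg _) (Finset.mem_univ i))
  have h2 : (1 : ℝ) ≤ d / a i 0 := by
    rw [le_div_iff₀ hi', one_mul]
    exact_mod_cast le_of_sum_eq ha i 0
  have h3 : (q : ℝ) ≤ q * (d / a i 0) := le_mul_of_one_le_right (Nat.cast_nonneg _) h2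
  rw [e, Complex.sub_re, Complex.ofReal_re]
  linarith

lemma finite_polePos (hd : 0 < d) (ha : ∀ j, ∑ i, a i j = d) (c : Fin n → ℂ) (t : Rest m → ℤ)
    (N : ℤ) (σ : ℝ) : {w | σ < (polePos d a c p t N w).re}.Finite := by
  have hd' : (0 : ℝ) < d := by exact_mod_cast hd
  obtain ⟨K, hK⟩ := exists_nat_ge (∑ j, ‖mbPole d a c p t j 0‖ - σ)
  have h1 : {t₀ : {t₀ : ℤ // t₀ < N} | ⌊(σ - p 0) / d⌋ ≤ t₀.1}.Finite := by
    refine Set.Finite.of_injOn (f := Subtype.val) (t := Set.Icc ⌊(σ - p 0) / d⌋ N)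
      (fun t₀ h => ⟨h, t₀.2.le⟩) Subtype.val_injective.injOn (Set.finite_Icc _ _)
  have h2 : (Set.univ ×ˢ Set.Iic K : Set ({i : Fin n // a i 0 ≠ 0} × ℕ)).Finite :=
    Set.finite_univ.prod (Set.finite_Iic K)
  refine ((h1.image Sum.inl).union (h2.image Sum.inr)).subset ?_
  rintro (t₀ | ⟨i, q⟩) hw
  · refine Or.inl ⟨t₀, ?_, rfl⟩
    have hw' : σ < (polePos d a c p t N (.inl t₀)).re := hw
    simp only [polePos, Sum.elim_inl, Complex.add_re, Complex.intCast_re, Complex.mul_re,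
      Complex.natCast_re, Complex.natCast_im, Complex.intCast_im, mul_zero, sub_zero] at hw'
    have h3 : (σ - p 0) / d < (t₀ : ℤ) := by
      rw [div_lt_iff₀ hd']; linarith
    have h4 : (⌊(σ - p 0) / d⌋ : ℝ) < (t₀ : ℤ) := (Int.floor_le _).trans_lt h3
    exact (Int.cast_lt.1 h4).le
  · refine Or.inr ⟨(i, q), ⟨Set.mem_univ _, ?_⟩, rfl⟩
    have hw' : σ < (mbPole d a c p t i q).re := hw
    have := mbPole_re_le (p := p) ha c t i.2 q
    have h3 : (q : ℝ) < K := by linarith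
    exact (Nat.cast_lt.1 h3).le

/-- There is a line slightly to the left of a given one whose translates by multiples of `d`
avoid all poles. -/
lemma exists_line (hd : 0 < d) (c : Fin n → ℂ) (p : Fin m → ℤ) (t : Rest m → ℤ) (N : ℤ) :
    ∃ σ < mbLine d (p 0) N, ∀ (M : ℕ) (s : ℂ), s.re = σ - d * M →
      MBRegular d a c p t s ∧ ∀ k : ℤ, s ≠ p 0 + d * k := by
  set bad : Set ℝ := (Set.range fun w : (Fin n × ℕ) × ℕ =>
    (mbPole d a c p t w.1.1 (w.1.2 : ℤ)).re + d * w.2) ∪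
    Set.range fun w : ℤ × ℕ => ((p 0 + d * w.1 : ℂ)).re + d * w.2 with hbad
  have hcount : bad.Countable := (Set.countable_range _).union (Set.countable_range _)
  obtain ⟨σ, h1, h2⟩ := (hcount.dense_compl ℝ).exists_between
    (show mbLine d (p 0) N - 1 < mbLine d (p 0) N by linarith)
  refine ⟨σ, h2.2, fun M s hs => ⟨fun j hj q hq => h1 (Or.inl ⟨((j, q), M), ?_⟩),
    fun k hk => h1 (Or.inr ⟨(k, M), ?_⟩)⟩⟩
  · have hq' : uArg d a c p t j s = -((q : ℤ) : ℂ) := by rw [hq]; norm_num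
    simp only
    rw [← (uArg_eq_neg_iff hd c t hj (q : ℤ) s).1 hq', hs]; ring
  · simp only
    rw [← hk, hs]; ring

/-- The integral is the sum of the residues to the left of the line of integration. -/
lemma hasSum_left (hd : 0 < d) (ha : ∀ j, ∑ i, a i j = d) {T : ℝ}
    (hT : IsLarge d a T) {c : Fin n → ℂ} {ρ : ℝ} (hρ : ‖c‖ ≤ ρ)
    (hc : VeryGeneric (fermatA d a) (cellsDwork a) c) {t : Rest m → ℤ} {τ : ℝ} (hτ : |τ| ≤ T)
    {x : Fin m ⊕ Fin n → ℂ} (hx : ‖x - basePoint m n d T τ‖ ≤ mbWidth n d)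
    (hE : Real.exp (-shiftRate d a x) * (4 * d) ^ d ≤ 1 / 2) {N : ℤ}
    (hN : mbAbscissa n d p ρ ≤ mbLine d (p 0) N)
    (hs : Summable fun iq : {i : Fin n // a i 0 ≠ 0} × ℕ =>
      dworkTerm d a c p x iq.1 (cons0 iq.2 t)) :
    HasSum (fun iq : {i : Fin n // a i 0 ≠ 0} × ℕ => dworkTerm d a c p x iq.1 (cons0 iq.2 t))
      (∑ t₀ ∈ Finset.Ico (-|p 0|) N, gammaTerm (expFer d a c p) x (latticeVec d a (cons0 t₀ t)) -
        (2 * Real.pi : ℂ)⁻¹ * ∫ y : ℝ, mbKernel d a c p t x (mbLine d (p 0) N + y * Complex.I)) := by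
  have hπ : (Real.pi : ℂ) ≠ 0 := by exact_mod_cast Real.pi_ne_zero
  have hd' : (0 : ℝ) < d := by exact_mod_cast hd
  by_cases ht : ∀ k : Rest m, 0 ≤ t k + |p k|
  swap
  · push Not at ht
    obtain ⟨k, hk⟩ := ht
    have h1 : ∀ t₀, gammaTerm (expFer d a c p) x (latticeVec d a (cons0 t₀ t)) = 0 := fun t₀ =>
      gammaTerm_latticeVec_eq_zero (k := (k : Fin m)) (g := p k) hd rfl (by simpa using hk)
    have h2 : ∀ s, mbKernel d a c p t x s = 0 := fun s => by
      rw [mbKernel, mbCoef, mbGamma_eq_zero hd c hk, zero_mul, zero_mul]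
    have h3 : ∀ (i : Fin n) (q : ℤ), dworkTerm d a c p x i (cons0 q t) = 0 := fun i q => by
      rw [dworkTerm, gammaTerm_eq_zero (j := .inl k) (g := p k + t k * d), mul_zero]
      · simp [expDwork, k.2, qVec]
      · have h1 : (1 : ℤ) ≤ d := by exact_mod_cast hd
        have h2 := le_abs_self (p k)
        have h3 := abs_nonneg (p k)
        simp only [Pi.zero_apply, zero_add]
        nlinarith
    simp only [h1, h2, h3, Finset.sum_const_zero, integral_zero, mul_zero, sub_zero]
    exact hasSum_zero
  obtain ⟨σ, hσ, hline⟩ := exists_line (a := a) hd c p t N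
  set G : ℕ → ℂ := fun k =>
    ∫ y : ℝ, mbKernel d a c p t x ((σ - d * k : ℝ) + y * Complex.I) with hG
  have hG0 : Tendsto G atTop (𝓝 0) := by
    obtain ⟨R, hR, hreg, hratio⟩ := exists_norm_mbKernel_ratio hd ha c p t
    obtain ⟨k₀, hk₀⟩ := exists_nat_ge ((R + σ) / d)
    refine tendsto_integral_zero (g := fun k y =>
      mbKernel d a c p t x ((σ - d * k : ℝ) + y * Complex.I)) (k₀ := k₀) ?_ ?_
    · exact integrable_mbKernel_line hd ha hT c p t hτ hx (fun s hs => (hline k₀ s hs).1)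
        (fun s hs => (hline k₀ s hs).2)
    · intro k hk y
      set s : ℂ := (σ - d * (k + 1 : ℕ) : ℝ) + y * Complex.I with hs
      have hre : s.re = σ - d * (k + 1 : ℕ) := by simp [hs]
      have := (hratio x s ?_ (hline (k + 1) s hre).1).2
      · have e : (((σ - d * k : ℝ) : ℂ) + y * Complex.I) = s + d := by
          rw [hs]; push_cast; ring
        rw [e]
        exact this.trans (mul_le_mul_of_nonneg_right hE (norm_nonneg _))
      · refine le_trans ?_ (Complex.abs_re_le_norm s)
        rw [hre]
        refine le_trans ?_ (neg_le_abs _)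
        rw [div_le_iff₀ hd'] at hk₀
        have : (k₀ : ℝ) * d ≤ k * d := by gcongr
        push_cast
        linarith
  -- `S k` is the set of the poles between the `k`-th line and the given one
  have hinj := polePos_injective (p := p) hd hc t N
  set S : ℕ → Finset (PoleIndex a N) := fun k => (finite_polePos (p := p) hd ha c t N (σ - d * k)).toFinset
    with hS
  have hmem : ∀ k w, w ∈ S k ↔ σ - d * k < (polePos d a c p t N w).re := fun k w => by
    simp [hS]
  have hstep : ∀ k : ℕ, (∫ y : ℝ, mbKernel d a c p t x (mbLine d (p 0) N + y * Complex.I)) - G k =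
      2 * Real.pi * ∑ w ∈ S k, poleRes d a c p t x N w := by
    intro k
    have hk0 : (0 : ℝ) ≤ d * k := by positivity
    obtain ⟨C, T₀, hdec⟩ := exists_norm_mbKernel_strip hd ha hT c p t hτ hx (σ - d * k)
      (mbLine d (p 0) N)
    have hpole : ∀ (s : ℂ), σ - d * k ≤ s.re → ∀ w, polePos d a c p t N w = s →
        s ∉ (S k).map ⟨_, hinj⟩ → s.re = σ - d * k := by
      intro s hs1 w hw hs
      by_contra hne
      refine hs (Finset.mem_map.2 ⟨w, (hmem k w).2 ?_, hw⟩)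
      rw [hw]
      exact lt_of_le_of_ne hs1 (Ne.symm hne)
    have := integral_line_sub_integral_line (h := mbKernel d a c p t x) (σ₁ := σ - d * k)
      (σ₂ := mbLine d (p 0) N) (by linarith) ((S k).map ⟨_, hinj⟩)
      (Function.extend (polePos d a c p t N) (poleRes d a c p t x N) 0) ?_ ?_ ?_
      (by positivity : 0 < Real.pi / (2 * d)) hdec
    · rw [Finset.sum_map] at this
      rw [this]
      congr 1
      exact Finset.sum_congr rfl fun w _ => hinj.extend_apply _ _ w
    · intro s hs
      obtain ⟨w, hw, rfl⟩ := Finset.mem_map.1 hs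
      exact ⟨(hmem k w).1 hw, polePos_re_lt hd ha hρ ht hN w⟩
    · intro s hs1 hs2 hs
      refine differentiableAt_mbKernel (fun j hj q hq => ?_) (sin_ne_zero_of_ne hd fun t₀ h0 => ?_) x
      · have hq' : uArg d a c p t j s = -((q : ℤ) : ℂ) := by rw [hq]; norm_num
        have hse := (uArg_eq_neg_iff hd c t hj (q : ℤ) s).1 hq'
        exact (hline k s (hpole s hs1 (.inr (⟨j, hj⟩, q)) hse.symm hs)).1 j hj q hq
      · have hlt : t₀ < N := by
          by_contra hge
          have h1 : (N : ℝ) ≤ t₀ := by exact_mod_cast not_lt.1 hge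
          rw [h0] at hs2
          simp only [mbLine, Complex.add_re, Complex.intCast_re, Complex.mul_re,
            Complex.natCast_re, Complex.natCast_im, Complex.intCast_im, mul_zero, sub_zero,
            add_le_add_iff_left, mul_le_mul_iff_right₀ hd'] at hs2
          linarith
        exact (hline k s (hpole s hs1 (.inl ⟨t₀, hlt⟩) h0.symm hs)).2 t₀ h0
    · intro s hs
      obtain ⟨w, hw, rfl⟩ := Finset.mem_map.1 hs
      simp only [Function.Embedding.coeFn_mk]
      rw [hinj.extend_apply]
      exact tendsto_residue_pole hd ha hc t N x w
  have hStop : Tendsto S atTop atTop := by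
    refine tendsto_atTop_finset_of_monotone (fun k l hkl w hw => ?_) fun w => ?_
    · rw [hmem] at hw ⊢
      have : (d : ℝ) * k ≤ d * l := by gcongr
      linarith
    · obtain ⟨k, hk⟩ := exists_nat_gt (σ - (polePos d a c p t N w).re)
      refine ⟨k, (hmem k w).2 ?_⟩
      have hd1 : (1 : ℝ) ≤ d := by exact_mod_cast hd
      have : (k : ℝ) ≤ d * k := le_mul_of_one_le_left (Nat.cast_nonneg _) hd1
      linarith
  -- the residues are summable, so that their sum is the limit of the sums over `S k`; those at
  -- `p_1 + d t_1` give a finite sum because the terms with `t_1 < -|p_1|` vanish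
  have hF : HasSum (fun t₀ : {t₀ : ℤ // t₀ < N} =>
      gammaTerm (expFer d a c p) x (latticeVec d a (cons0 t₀ t)))
      (∑ t₀ ∈ Finset.Ico (-|p 0|) N, gammaTerm (expFer d a c p) x (latticeVec d a (cons0 t₀ t))) := by
    set f : ℤ → ℂ := fun t₀ => gammaTerm (expFer d a c p) x (latticeVec d a (cons0 t₀ t)) with hf
    have hz : ∀ t₀ < -|p 0|, f t₀ = 0 := fun t₀ h =>
      gammaTerm_latticeVec_eq_zero (k := (0 : Fin m)) (g := p 0) hd rfl (by simp; linarith)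
    have h1 : HasSum (fun t₀ : ℤ => if t₀ ∈ Finset.Ico (-|p 0|) N then f t₀ else 0)
        (∑ t₀ ∈ Finset.Ico (-|p 0|) N, f t₀) := by
      rw [← Finset.sum_congr rfl fun b hb => if_pos hb]
      exact hasSum_sum_of_ne_finset_zero fun b hb => if_neg hb
    have hinj' : Function.Injective fun t₀ : {t₀ : ℤ // t₀ < N} => (t₀ : ℤ) :=
      Subtype.val_injective
    rw [← hinj'.hasSum_iff fun t₀ h => if_neg fun h' =>
      h ⟨⟨t₀, (Finset.mem_Ico.1 h').2⟩, rfl⟩] at h1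
    convert h1 using 1
    funext t₀
    simp only [Function.comp]
    split_ifs with h
    · rfl
    · exact hz _ (by
        by_contra h'
        exact h (Finset.mem_Ico.2 ⟨not_lt.1 h', t₀.2⟩))
  have hall : HasSum (poleRes d a c p t x N)
      (∑ t₀ ∈ Finset.Ico (-|p 0|) N, gammaTerm (expFer d a c p) x (latticeVec d a (cons0 t₀ t)) +
        -∑' iq : {i : Fin n // a i 0 ≠ 0} × ℕ, dworkTerm d a c p x iq.1 (cons0 iq.2 t)) :=
    HasSum.sum hF hs.hasSum.neg
  have hlim1 := (hall.comp hStop).const_mul (2 * Real.pi : ℂ)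
  have hlim2 := hG0.const_sub
    (∫ y : ℝ, mbKernel d a c p t x (mbLine d (p 0) N + y * Complex.I))
  have := tendsto_nhds_unique (hlim1.congr fun k => (hstep k).symm) hlim2
  rw [sub_zero] at this
  rw [← this, ← mul_assoc, inv_mul_cancel₀ (mul_ne_zero two_ne_zero hπ), one_mul, sub_add_eq_sub_sub,
    sub_self, zero_sub, neg_neg]
  exact hs.hasSum

end Left

/-! ### The cosets of the lattice and the continued series -/

section Cosets

variable {m n : ℕ} [NeZero m] {d : ℕ} {a : Matrix (Fin n) (Fin m) ℕ} {p : Fin m → ℤ}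

lemma sum_dworkCoord (a : Matrix (Fin n) (Fin m) ℕ) (i : Fin n) (v : Fin m → ℤ) :
    ∑ l, v l * (a i l : ℤ) = v 0 * a i 0 + ∑ k : Rest m, v k * (a i k : ℤ) :=
  sum_fin_eq_add fun l => v l * (a i l : ℤ)

lemma qVec_add_zero (i : Fin n) (t v : Fin m → ℤ) :
    qVec d p (t + dworkCoord a i v) 0 = qVec d p t 0 - ∑ l, v l * a i l := by
  simp [qVec, dworkCoord, sub_eq_add_neg]

lemma qVec_add_rest (i : Fin n) (t v : Fin m → ℤ) (k : Rest m) :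
    qVec d p (t + dworkCoord a i v) k = qVec d p t k + v k * d := by
  simp [qVec, dworkCoord, k.2, add_mul, add_assoc]

lemma numDwork_add (c : Fin n → ℂ) (i : Fin n) (t v : Fin m → ℤ) :
    numDwork d a c (qVec d p (t + dworkCoord a i v)) i =
      numDwork d a c (qVec d p t) i - v 0 * d * a i 0 := by
  simp only [numDwork, sum_filter_ne_zero, qVec_add_zero, qVec_add_rest, sum_dworkCoord]
  push_cast
  simp only [add_mul, Finset.sum_add_distrib]
  have : ∑ k : Rest m, (v k : ℂ) * d * a i k = d * ∑ k : Rest m, (v k : ℂ) * a i k := by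
    rw [Finset.mul_sum]
    exact Finset.sum_congr rfl fun k _ => by ring
  rw [this]
  ring

/-- A change of the index by an element of the lattice in the coordinates `dworkCoord` translates
the exponent by this element. -/
lemma expDwork_add (hd : 0 < d) (c : Fin n → ℂ) {i : Fin n} (hi : a i 0 ≠ 0) (t v : Fin m → ℤ)
    (j : Fin m ⊕ Fin n) : expDwork d a c (qVec d p (t + dworkCoord a i v)) i j =
      latticeVec d a v j + expDwork d a c (qVec d p t) i j := by
  have hd' : (d : ℂ) ≠ 0 := by exact_mod_cast hd.ne'
  have hi' : (a i 0 : ℂ) ≠ 0 := by exact_mod_cast hi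
  rcases j with k | j
  · by_cases hk : k = 0
    · subst hk
      simp only [expDwork, Sum.elim_inl, if_true, numDwork_add, latticeVec_inl]
      push_cast
      field_simp
      ring
    · have := qVec_add_rest (d := d) (p := p) (a := a) i t v ⟨k, hk⟩
      simp only at this
      simp only [expDwork, Sum.elim_inl, if_neg hk, latticeVec_inl, this]
      push_cast
      ring
  · by_cases hj : j = i
    · subst hj
      simp only [expDwork, Sum.elim_inr, if_true, latticeVec_inr, qVec_add_zero]
      push_cast
      ring
    · simp only [expDwork, Sum.elim_inr, if_neg hj, latticeVec_inr, numDwork_add,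
        sum_filter_ne_zero, qVec_add_rest, sum_dworkCoord]
      push_cast
      simp only [add_mul, Finset.sum_add_distrib]
      have : ∑ k : Rest m, (v k : ℂ) * d * a j k = d * ∑ k : Rest m, (v k : ℂ) * a j k := by
        rw [Finset.mul_sum]
        exact Finset.sum_congr rfl fun k _ => by ring
      rw [this]
      field_simp
      ring

lemma gammaTerm_eq_gammaTerm_zero {J : Type*} [Fintype J] (x : J → ℂ) {γ γ' : J → ℂ} {u : J → ℤ}
    (h : ∀ j, γ' j = u j + γ j) : gammaTerm γ x u = gammaTerm γ' x 0 := by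
  unfold gammaTerm
  refine Finset.prod_congr rfl fun j _ => ?_
  rw [h]
  simp [add_assoc]

/-- The coefficient `C(𝐚_1, i, p, q, c)` depends only on the coset of the exponent. -/
lemma coeffDwork_add (hd : 0 < d) (ha : ∀ j, ∑ i, a i j = d) (c : Fin n → ℂ) {i : Fin n}
    (hi : a i 0 ≠ 0) (t v : Fin m → ℤ) :
    coeffDwork d a i p (qVec d p (t + dworkCoord a i v)) c = coeffDwork d a i p (qVec d p t) c := by
  have hd' : (d : ℂ) ≠ 0 := by exact_mod_cast hd.ne'
  have hπ : (Real.pi : ℂ) ≠ 0 := by exact_mod_cast Real.pi_ne_zero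
  have hq : ∑ k, qVec d p (t + dworkCoord a i v) k =
      ∑ k, qVec d p t k + (d * ∑ k : Rest m, v k - ∑ l, v l * a i l) := by
    rw [sum_fin_eq_add (qVec d p (t + dworkCoord a i v)), sum_fin_eq_add (qVec d p t),
      qVec_add_zero]
    simp only [qVec_add_rest, Finset.sum_add_distrib, ← Finset.sum_mul]
    ring
  have hs : ∀ j, Complex.sin (Real.pi * expDwork d a c (qVec d p (t + dworkCoord a i v)) i j) =
      (-1) ^ latticeVec d a v j * Complex.sin (Real.pi * expDwork d a c (qVec d p t) i j) := by
    intro j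
    rw [expDwork_add hd c hi, ← sin_add_int_mul_pi]
    congr 1
    ring
  have hsd : ∀ j : ℕ, Complex.sin (Real.pi / d *
      (expDwork d a c (qVec d p (t + dworkCoord a i v)) i (.inl 0) - p 0 + j)) = (-1) ^ v 0 *
      Complex.sin (Real.pi / d * (expDwork d a c (qVec d p t) i (.inl 0) - p 0 + j)) := by
    intro j
    rw [expDwork_add hd c hi, ← sin_add_int_mul_pi]
    congr 1
    rw [latticeVec_inl]
    push_cast
    field_simp
    ring
  have hd1 : ((d - 1 : ℕ) : ℂ) = d - 1 := by
    rw [Nat.cast_sub hd, Nat.cast_one]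
  have hexp : Complex.exp (((d - 1) * expDwork d a c (qVec d p (t + dworkCoord a i v)) i (.inl 0) +
      p 0) * Real.pi * Complex.I / d) = ((-1) ^ v 0) ^ (d - 1) *
      Complex.exp (((d - 1) * expDwork d a c (qVec d p t) i (.inl 0) + p 0) * Real.pi *
        Complex.I / d) := by
    rw [← Complex.exp_pi_mul_I, ← Complex.exp_int_mul, ← Complex.exp_nat_mul, ← Complex.exp_add,
      expDwork_add hd c hi, hd1, latticeVec_inl]
    congr 1
    push_cast
    field_simp
    ring
  have hprod : ∏ j with j ≠ i,
      Complex.sin (Real.pi * expDwork d a c (qVec d p (t + dworkCoord a i v)) i (.inr j)) =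
      (-1) ^ (∑ j with j ≠ i, latticeVec d a v (.inr j)) *
        ∏ j with j ≠ i, Complex.sin (Real.pi * expDwork d a c (qVec d p t) i (.inr j)) := by
    rw [Finset.prod_congr rfl fun j _ => hs (.inr j), Finset.prod_mul_distrib, prod_neg_one_zpow]
  have hsum : ∑ j with j ≠ i, latticeVec d a v (.inr j) =
      ∑ l, v l * a i l - d * ∑ k, v k := by
    have h1 := sum_latticeVec ha v
    rw [Fintype.sum_sum_type, ← Finset.add_sum_erase Finset.univ _ (Finset.mem_univ i)] at h1
    simp only [latticeVec_inl, ← Finset.sum_mul] at h1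
    rw [Finset.filter_ne']
    rw [latticeVec_inr] at h1
    linarith
  have hsign : (-1 : ℂ) ^ (d * ∑ k : Rest m, v k - ∑ l, v l * a i l) =
      (-1) ^ (latticeVec d a v (.inl 0)) * (-1) ^ (∑ j with j ≠ i, latticeVec d a v (.inr j)) := by
    rw [← zpow_add₀ (by norm_num), hsum, latticeVec_inl, sum_fin_eq_add v]
    have e : (d * ∑ k : Rest m, v k - ∑ l, v l * a i l : ℤ) =
        v 0 * d + (∑ l, v l * a i l - d * (v 0 + ∑ k : Rest m, v k)) +
          2 * (d * ∑ k : Rest m, v k - ∑ l, v l * a i l) := by ring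
    rw [e, zpow_add₀ (by norm_num), (even_two_mul _).neg_one_zpow, mul_one]
  have e1 : ((-1 : ℂ) ^ v 0) ^ (d - 1) * ((-1) ^ v 0) ^ (d - 1) = 1 := by
    rw [← mul_pow, neg_one_zpow_mul_self, one_pow]
  have hne : ∀ k : ℤ, (-1 : ℂ) ^ k ≠ 0 := fun k => zpow_ne_zero _ (by norm_num)
  unfold coeffDwork
  rw [hq, zpow_add₀ (by norm_num), hsign, hs, hprod, hexp]
  simp only [hsd, Finset.prod_mul_distrib, Finset.prod_const, Nat.card_Icc]
  rw [show d - 1 + 1 - 1 = d - 1 by omega]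
  set A := Complex.sin (Real.pi * expDwork d a c (qVec d p t) i (.inl 0))
  set B := ∏ j with j ≠ i, Complex.sin (Real.pi * expDwork d a c (qVec d p t) i (.inr j))
  have e2 : ∀ (y z ε η : ℂ), ε ≠ 0 → η ≠ 0 →
      y * (z * (ε * η)) / (ε * A * (η * B)) = y * z / (A * B) := by
    intro y z ε η hε hη
    rw [show y * (z * (ε * η)) = (ε * η) * (y * z) by ring,
      show ε * A * (η * B) = (ε * η) * (A * B) by ring,
      mul_div_mul_left _ _ (mul_ne_zero hε hη)]
  rw [e2 _ _ _ _ (hne _) (hne _)]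
  congr 1
  rw [mul_mul_mul_comm, e1, one_mul]

/-- A term of a Gamma series in `(*)`, up to the coefficient. -/
lemma coeffDwork_mul_gammaTerm (hd : 0 < d) (ha : ∀ j, ∑ i, a i j = d) (c : Fin n → ℂ) {i : Fin n}
    (hi : a i 0 ≠ 0) (x : Fin m ⊕ Fin n → ℂ) (t v : Fin m → ℤ) :
    coeffDwork d a i p (qVec d p t) c *
      gammaTerm (expDwork d a c (qVec d p t) i) x (latticeVec d a v) =
      dworkTerm d a c p x i (t + dworkCoord a i v) := by
  rw [dworkTerm, coeffDwork_add hd ha c hi,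
    gammaTerm_eq_gammaTerm_zero x (expDwork_add hd c hi t v)]

/-- Two indices are in the same fibre of `h` if and only if they differ by an element of the
lattice. -/
lemma mapH_eq_iff (hd : 0 < d)
    (hB : Submodule.span ℤ (Set.range (fermatB d a)) = lattice (fermatA d a)) {i : Fin n}
    (hi : a i 0 ≠ 0) (t t' : Fin m → ℤ) :
    mapH d a p i t = mapH d a p i t' ↔ ∃ v, t' = t + dworkCoord a i v := by
  have hd' : (d : ℤ) ≠ 0 := by exact_mod_cast hd.ne'
  have key : mapH d a p i t = mapH d a p i t' ↔ ∃ z : ℤ, ∀ j,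
      ((if j = i then 0 else d : ℕ) : ℤ) ∣ ((if j = i then (t' 0 - t 0) * d else 0) +
        d * ∑ k : Rest m, (t' k - t k) * (a j k : ℤ)) - z * a j 0 := by
    rw [mapH, mapH, QuotientAddGroup.eq, AddSubgroup.mem_zmultiples_iff]
    refine exists_congr fun z => ?_
    rw [funext_iff]
    refine forall_congr' fun j => ?_
    have e : (z • classM d i fun j => (a j 0 : ℤ)) j =
        ((z * a j 0 : ℤ) : ZMod (if j = i then 0 else d)) := by
      simp [classM]
    rw [e, Pi.add_apply, Pi.neg_apply, classM, classM, ← Int.cast_neg, ← Int.cast_add,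
      ZMod.intCast_eq_intCast_iff_dvd_sub]
    have e2 : -((if j = i then t 0 * d else 0) + ∑ k with k ≠ 0, (p k + t k * d) * (a j k : ℤ)) +
        ((if j = i then t' 0 * d else 0) + ∑ k with k ≠ 0, (p k + t' k * d) * (a j k : ℤ)) =
        (if j = i then (t' 0 - t 0) * d else 0) +
          d * ∑ k : Rest m, (t' k - t k) * (a j k : ℤ) := by
      have e3 : d * ∑ k : Rest m, (t' k - t k) * (a j k : ℤ) =
          ∑ k : Rest m, (p k + t' k * d) * (a j k : ℤ) -
            ∑ k : Rest m, (p k + t k * d) * (a j k : ℤ) := by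
        rw [Finset.mul_sum, ← Finset.sum_sub_distrib]
        exact Finset.sum_congr rfl fun k _ => by ring
      rw [sum_filter_ne_zero, sum_filter_ne_zero, e3]
      split_ifs <;> ring
    rw [e2]
  rw [key]
  constructor
  · rintro ⟨z, hz⟩
    have hzi := hz i
    simp only [if_true, Nat.cast_zero, zero_dvd_iff, sub_eq_zero] at hzi
    have hzd : ∀ j, (d : ℤ) ∣ z * a j 0 := by
      intro j
      by_cases hj : j = i
      · subst hj
        rw [← hzi]
        exact dvd_add (dvd_mul_left _ _) (dvd_mul_right _ _)
      · have := hz j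
        simp only [if_neg hj, zero_add] at this
        exact (dvd_sub_right (dvd_mul_right _ _)).1 this
    -- the vector `z 𝐞_1 - ∑ (z a_{j1} / d) 𝐞_{m+j}` lies in `L_A`, so that `d` divides `z`
    choose b hb using hzd
    have hmem : (Sum.elim (Pi.single 0 z) fun j => -b j : Fin m ⊕ Fin n → ℤ) ∈
        lattice (fermatA d a) := by
      rw [lattice, LinearMap.mem_ker]
      funext j
      rw [Matrix.mulVecLin_apply, Matrix.mulVec, dotProduct, Fintype.sum_sum_type]
      simp only [fermatA_inl, fermatA_inr, Sum.elim_inl, Sum.elim_inr, Pi.zero_apply]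
      rw [Finset.sum_eq_single 0 (by intro k _ hk; simp [hk]) (by simp),
        Finset.sum_eq_single j (by intro k _ hk; simp [hk.symm]) (by simp)]
      simp only [Pi.single_eq_same, if_true]
      linarith [hb j]
    obtain ⟨w, hw⟩ := (latticeEquiv hd hB).surjective ⟨_, hmem⟩
    have hw0 : w 0 * d = z := by
      have := congrFun (congrArg Subtype.val hw) (.inl 0)
      exact this.trans (by simp)
    refine ⟨fun k => if k = 0 then -w 0 else t' k - t k, ?_⟩
    funext k
    by_cases hk : k = 0
    · subst hk
      simp only [Pi.add_apply, dworkCoord, if_true]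
      rw [sum_fin_eq_add fun l => (if l = 0 then -w 0 else t' l - t l) * (a i l : ℤ)]
      have : ∑ k : Rest m, (if (k : Fin m) = 0 then -w 0 else t' k - t k) * (a i k : ℤ) =
          ∑ k : Rest m, (t' k - t k) * (a i k : ℤ) :=
        Finset.sum_congr rfl fun k _ => by rw [if_neg k.2]
      rw [this, if_pos rfl]
      rw [← hw0] at hzi
      refine mul_left_cancel₀ hd' ?_
      linarith
    · simp [dworkCoord, hk]
  · rintro ⟨v, rfl⟩
    refine ⟨-(v 0 * d), fun j => ?_⟩
    have e : ∑ k : Rest m, ((t + dworkCoord a i v) k - t k) * (a j k : ℤ) =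
        ∑ k : Rest m, v k * (a j k : ℤ) :=
      Finset.sum_congr rfl fun k _ => by simp [dworkCoord, k.2]
    rw [e]
    by_cases hj : j = i
    · subst hj
      simp only [if_true, Nat.cast_zero, zero_dvd_iff, Pi.add_apply, dworkCoord, sum_dworkCoord]
      ring
    · simp only [if_neg hj, zero_add]
      exact dvd_sub (dvd_mul_right _ _) ⟨-(v 0 * a j 0), by ring⟩

/-- The pairs of a representative and an element of the lattice enumerate `ℤ^m`. -/
lemma bijective_add_dworkCoord (hd : 0 < d)
    (hB : Submodule.span ℤ (Set.range (fermatB d a)) = lattice (fermatA d a))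
    {R : Fin n → Finset (Fin m → ℤ)} (hR : IsRepSystem d a p R) {i : Fin n} (hi : a i 0 ≠ 0) :
    Function.Bijective fun tv : R i × (Fin m → ℤ) => (tv.1 : Fin m → ℤ) + dworkCoord a i tv.2 := by
  obtain ⟨-, hinj, hsurj⟩ := hR i hi
  constructor
  · rintro ⟨t, v⟩ ⟨t', v'⟩ h
    simp only at h
    have h1 := (mapH_eq_iff (p := p) hd hB hi (t : Fin m → ℤ) _).2 ⟨v, rfl⟩
    have h2 := (mapH_eq_iff (p := p) hd hB hi (t' : Fin m → ℤ) _).2 ⟨v', rfl⟩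
    have h3 : t = t' := Subtype.ext (hinj t.2 t'.2 (by rw [h1, h2, h]))
    subst h3
    rw [dworkCoord_injective hi (add_left_cancel h)]
  · intro t
    obtain ⟨r, hr, hrt⟩ := hsurj ⟨t, rfl⟩
    obtain ⟨v, hv⟩ := (mapH_eq_iff hd hB hi r t).1 hrt
    exact ⟨(⟨r, hr⟩, v), hv.symm⟩

lemma hasSum_prod_of_finite {κ ι : Type*} [Fintype κ] {f : κ × ι → ℂ} {s : κ → ℂ}
    (h : ∀ k, HasSum (fun i => f (k, i)) (s k)) : HasSum f (∑ k, s k) := by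
  have hs : Summable f := Summable.of_norm <|
    (summable_prod_of_nonneg fun _ => norm_nonneg _).2
      ⟨fun k => (h k).summable.norm, (hasSum_fintype _).summable⟩
  rw [← (hs.hasSum.prod_fiberwise h).unique (hasSum_fintype s)]
  exact hs.hasSum

/-- The expression `(*)` as a sum over all indices. -/
lemma hasSum_dworkTerm (hd : 0 < d) (ha : ∀ j, ∑ i, a i j = d)
    (hB : Submodule.span ℤ (Set.range (fermatB d a)) = lattice (fermatA d a)) {T : ℝ}
    (hT : radiusBound m n d ≤ T) {R : Fin n → Finset (Fin m → ℤ)} (hR : IsRepSystem d a p R)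
    (c : Fin n → ℂ) {x : Fin m ⊕ Fin n → ℂ} (hx0 : T ≤ (x (.inl 0)).re)
    (hx1 : ∀ k, k ≠ 0 → (x (.inl k)).re ≤ -T) (hx2 : ∀ j, |(x (.inr j)).re| ≤ 1) :
    HasSum (fun it : {i : Fin n // a i 0 ≠ 0} × (Fin m → ℤ) => dworkTerm d a c p x it.1 it.2)
      (continuedSeries d a p R c x) := by
  have h : ∀ i : {i : Fin n // a i 0 ≠ 0}, HasSum (fun t => dworkTerm d a c p x i t)
      (∑ t ∈ R i, coeffDwork d a i p (qVec d p t) c *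
        gammaSeries (fermatA d a) (expDwork d a c (qVec d p t) i) x) := by
    intro i
    rw [← (Equiv.ofBijective _ (bijective_add_dworkCoord hd hB hR i.2)).hasSum_iff,
      ← Finset.sum_coe_sort]
    refine hasSum_prod_of_finite fun t => ?_
    simp only [Function.comp_apply, Equiv.ofBijective_apply, ← coeffDwork_mul_gammaTerm hd ha c i.2]
    rw [gammaSeries_eq_tsum hd hB]
    refine HasSum.mul_left _ (Summable.hasSum ?_)
    refine summable_gammaTerm_dwork hd ha hT i.2 (g := qVec d p t) (fun k hk => ?_) ?_ hx0 hx1 hx2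
    · simp [expDwork, hk]
    · simp [expDwork]
  rw [continuedSeries, ← Finset.sum_subtype_eq_sum_filter, Finset.subtype_univ]
  exact hasSum_prod_of_finite h

lemma dworkTerm_eq_zero (c : Fin n → ℂ) (x : Fin m ⊕ Fin n → ℂ) (i : Fin n) {t : Fin m → ℤ}
    (ht : t 0 < 0) : dworkTerm d a c p x i t = 0 := by
  rw [dworkTerm, gammaTerm_eq_zero (j := .inr i) (g := t 0), mul_zero]
  · simp [expDwork, qVec]
  · simpa using ht

/-- Near the end of the path, the function `mbFun` is the expression `(*)`. -/
lemma mbFun_eq_continuedSeries (hd : 0 < d) (ha : ∀ j, ∑ i, a i j = d)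
    (hB : Submodule.span ℤ (Set.range (fermatB d a)) = lattice (fermatA d a)) {T : ℝ}
    (hT : IsLarge d a T) {c : Fin n → ℂ} {ρ : ℝ} (hρ : ‖c‖ ≤ ρ)
    (hc : VeryGeneric (fermatA d a) (cellsDwork a) c) {x : Fin m ⊕ Fin n → ℂ}
    (hx : ‖x - basePoint m n d T T‖ < mbWidth n d) {N : ℤ}
    (hN : mbAbscissa n d p ρ ≤ mbLine d (p 0) N) {R : Fin n → Finset (Fin m → ℤ)}
    (hR : IsRepSystem d a p R) :
    mbFun d a c p N x = continuedSeries d a p R c x := by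
  have hd' : (0 : ℝ) < d := by exact_mod_cast hd
  have hd1 : (1 : ℝ) ≤ d := by exact_mod_cast hd
  have hτ : |T| ≤ T := by rw [abs_of_pos hT.pos]
  have hx1 : ‖x - basePoint m n d T T‖ < 1 := hx.trans_le (mbWidth_le_one hd)
  obtain ⟨g0, g1, g2⟩ := near_end (m := m) (n := n) (d := d) (T := T) (x := x) fun j => by
    rw [← Complex.sub_re]
    exact ((Complex.abs_re_le_norm _).trans (norm_le_pi_norm (x - basePoint m n d T T) j)).trans_lt hx1
  have hE : Real.exp (-shiftRate d a x) * (4 * d) ^ d ≤ 1 / 2 := by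
    have h1 : -shiftRate d a x ≤ d * (-(4 * d + 2) : ℝ) := by
      have h2 : ∑ j, a j 0 * (x (.inr j)).re ≤ d := by
        have e : ((∑ j, a j 0 : ℕ) : ℝ) = d := by exact_mod_cast ha 0
        rw [← e]
        push_cast
        refine Finset.sum_le_sum fun j _ => ?_
        exact mul_le_of_le_one_right (Nat.cast_nonneg _) (abs_le.1 (g2 j)).2
      have h3 := hT.ratio
      have h4 : d * (4 * d + 3 : ℝ) ≤ d * (x (.inl 0)).re :=
        mul_le_mul_of_nonneg_left (by linarith) hd'.le
      unfold shiftRate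
      linarith
    have h5 : Real.exp (-(4 * d + 2)) * (4 * d) ≤ 1 / 2 := by
      rw [Real.exp_neg, inv_mul_le_iff₀ (Real.exp_pos _)]
      have := Real.quadratic_le_exp_of_nonneg (x := 4 * d + 2) (by positivity)
      nlinarith
    calc _ ≤ Real.exp (d * (-(4 * d + 2))) * (4 * d) ^ d := by gcongr
      _ = (Real.exp (-(4 * d + 2)) * (4 * d)) ^ d := by rw [Real.exp_nat_mul, ← mul_pow]
      _ ≤ (1 / 2) ^ d := by gcongr
      _ ≤ (1 / 2) ^ 1 := pow_le_pow_of_le_one (by norm_num) (by norm_num) hd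
      _ = _ := pow_one _
  have hs := hasSum_dworkTerm (p := p) hd ha hB (T := T - 1) (by linarith [hT.radius]) hR c g0 g1 g2
  have hinj : Function.Injective fun w : (Rest m → ℤ) × ({i : Fin n // a i 0 ≠ 0} × ℕ) =>
      ((w.2.1, cons0 (w.2.2 : ℤ) w.1) : {i : Fin n // a i 0 ≠ 0} × (Fin m → ℤ)) := by
    rintro ⟨t, i, q⟩ ⟨t', i', q'⟩ h
    simp only [Prod.mk.injEq] at h
    obtain ⟨rfl, h⟩ := h
    have := (cons0Equiv m).injective (a₁ := (t, (q : ℤ))) (a₂ := (t', (q' : ℤ))) h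
    simp only [Prod.mk.injEq, Nat.cast_inj] at this
    rw [this.1, this.2]
  rw [← hinj.hasSum_iff] at hs
  · have hs2 := hs.prod_fiberwise fun t => hasSum_left (p := p) hd ha hT hρ hc (t := t) hτ hx.le hE hN
      (hs.summable.comp_injective (i := fun iq => (t, iq)) fun _ _ h => (Prod.mk.inj h).2)
    refine HasSum.unique ?_ hs2
    exact (hasSum_sum fun t₀ _ => hasSum_ferSlice hd ha hT t₀ hx1.le).sub
      ((hasSum_mbIntegral hd hT hN (cos_mbLine hd _ _) hρ hτ hx.le).mul_left _)
  · rintro ⟨i, t⟩ h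
    refine dworkTerm_eq_zero c x i (not_le.1 fun h0 => h ?_)
    refine ⟨(fun k => t k, (i, (t 0).toNat)), ?_⟩
    simp only [Prod.mk.injEq, true_and, Int.toNat_of_nonneg h0]
    exact (cons0Equiv m).right_inv t

end Cosets

/-! ### Continuation along the path and the limit in the parameter -/

section Limit

lemma tendstoUniformlyOn_of_continuousAt {E : Type*} [TopologicalSpace E] {K : Set E}
    (hK : IsCompact K) {g : ℂ → E → ℂ}
    (h : ∀ x ∈ K, ContinuousAt (fun q : ℂ × E => g q.1 q.2) (0, x)) :
    TendstoUniformlyOn g (g 0) (𝓝 0) K := by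
  rw [← tendstoLocallyUniformlyOn_iff_tendstoUniformlyOn_of_compact hK,
    Metric.tendstoLocallyUniformlyOn_iff]
  intro η hη x hx
  have h1 := Metric.continuousAt_iff'.1 (h x hx) (η / 2) (by linarith)
  rw [nhds_prod_eq] at h1
  obtain ⟨P, hP, Q, hQ, hPQ⟩ := eventually_prod_iff.1 h1
  refine ⟨{y | Q y}, mem_nhdsWithin_of_mem_nhds hQ, hP.mono fun ε hε y hy => ?_⟩
  have h2 := hPQ hε hy
  have h3 := hPQ hP.self_of_nhds hy
  simp only at h2 h3
  rw [dist_comm] at h2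
  linarith [dist_triangle (g 0 y) (g 0 x) (g ε y)]

variable {m n : ℕ} [NeZero m] {d : ℕ} {a : Matrix (Fin n) (Fin m) ℕ} {p : Fin m → ℤ}

lemma exists_mbAbscissa_le_mbLine (hd : 0 < d) (n : ℕ) (p : Fin m → ℤ) (ρ : ℝ) :
    ∃ N, mbAbscissa n d p ρ ≤ mbLine d (p 0) N := by
  have hd' : (0 : ℝ) < d := by exact_mod_cast hd
  obtain ⟨N, hN⟩ := exists_int_gt ((mbAbscissa n d p ρ - p 0) / d + 1 / 2)
  refine ⟨N, ?_⟩
  have h : (mbAbscissa n d p ρ - p 0) / d ≤ N - 1 / 2 := by linarith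
  rw [div_le_iff₀ hd'] at h
  unfold mbLine
  linarith

/-- The function `mbFun` is analytic on a neighbourhood of the whole path, so that it continues
the Gamma series along the path. -/
lemma continuesAlong_mbFun (hd : 0 < d) (ha : ∀ j, ∑ i, a i j = d)
    (hB : Submodule.span ℤ (Set.range (fermatB d a)) = lattice (fermatA d a)) {T : ℝ}
    (hT : IsLarge d a T) {c : Fin n → ℂ} {ρ : ℝ} (hc : ‖c‖ ≤ ρ) {N : ℤ}
    (hN : mbAbscissa n d p ρ ≤ mbLine d (p 0) N) {g : (Fin m ⊕ Fin n → ℂ) → ℂ}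
    (hg : mbFun d a c p N =ᶠ[𝓝 (dworkPath m n d T 1)] g) :
    ContinuesAlong (dworkPath m n d T) (gammaSeries (fermatA d a) (expFer d a c p)) g := by
  refine ⟨fun _ => mbFun d a c p N, fun t => ?_, fun t => .of_forall fun s => .rfl, ?_, hg⟩
  · rw [dworkPath_apply]
    refine analyticAt_mbFun hd ha hT hN hc ?_
    have h0 := t.2.1
    have h1 := t.2.2
    have := hT.pos
    rw [abs_le]
    constructor <;> nlinarith
  · rw [dworkPath_zero]
    filter_upwards [eventually_norm_sub_lt _ (mbWidth_pos (n := n) hd)] with x hx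
    exact mbFun_eq_gammaSeries hd ha hB hT hc hx hN

lemma analyticAt_expDwork (c c' : Fin n → ℂ) (q : Fin m → ℤ) (i : Fin n) (j : Fin m ⊕ Fin n) :
    AnalyticAt ℂ (fun ε : ℂ => expDwork d a (c + ε • c') q i j) 0 := by
  have h : AnalyticAt ℂ (fun ε : ℂ => numDwork d a (c + ε • c') q i) 0 := by
    simp only [numDwork, Pi.add_apply, Pi.smul_apply, smul_eq_mul]
    fun_prop
  rcases j with k | j
  · by_cases hk : k = 0
    · simp only [expDwork, Sum.elim_inl, hk, if_true]
      exact h.neg.div_const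
    · simp only [expDwork, Sum.elim_inl, hk, if_false]
      fun_prop
  · by_cases hj : j = i
    · simp only [expDwork, Sum.elim_inr, hj, if_true]
      fun_prop
    · simp only [expDwork, Sum.elim_inr, hj, if_false, Pi.add_apply, Pi.smul_apply, smul_eq_mul]
      exact (((analyticAt_const.mul h).sub (by fun_prop)).sub (by fun_prop)).div_const

/-- The coefficients are meromorphic along complex lines in the space of parameters. -/
lemma meromorphicAt_coeffDwork (c c' : Fin n → ℂ) (q : Fin m → ℤ) (i : Fin n) :
    MeromorphicAt (fun ε : ℂ => coeffDwork d a i p q (c + ε • c')) 0 := by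
  have h := analyticAt_expDwork (d := d) (a := a) c c' q i
  have hsin : ∀ {f : ℂ → ℂ}, AnalyticAt ℂ f 0 → AnalyticAt ℂ (fun ε => Complex.sin (f ε)) 0 :=
    fun hf => Complex.analyticAt_sin.comp hf
  have h1 : AnalyticAt ℂ (fun ε : ℂ => ∏ j, Complex.sin (Real.pi / d *
      ((c + ε • c') j + ∑ k, (p k : ℂ) * a j k))) 0 :=
    Finset.analyticAt_fun_prod _ fun j _ => hsin (by
      simp only [Pi.add_apply, Pi.smul_apply, smul_eq_mul]; fun_prop)
  have h2 : AnalyticAt ℂ (fun ε : ℂ => ∏ j with j ≠ i,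
      Complex.sin (Real.pi * expDwork d a (c + ε • c') q i (.inr j))) 0 :=
    Finset.analyticAt_fun_prod _ fun j _ => hsin (analyticAt_const.mul (h (.inr j)))
  have h3 : AnalyticAt ℂ (fun ε : ℂ => ∏ j ∈ Finset.Icc 1 (d - 1), Complex.sin (Real.pi / d *
      (expDwork d a (c + ε • c') q i (.inl 0) - p 0 + j))) 0 :=
    Finset.analyticAt_fun_prod _ fun j _ => hsin (analyticAt_const.mul
      (((h (.inl 0)).sub analyticAt_const).add analyticAt_const))
  have h4 : AnalyticAt ℂ (fun ε : ℂ => Complex.exp (((d - 1) *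
      expDwork d a (c + ε • c') q i (.inl 0) + p 0) * Real.pi * Complex.I / d)) 0 :=
    ((((analyticAt_const.mul (h (.inl 0))).add analyticAt_const).mul analyticAt_const).mul
      analyticAt_const).div_const.cexp
  unfold coeffDwork
  exact ((analyticAt_const.mul h1).meromorphicAt.mul (analyticAt_const.meromorphicAt.div
    ((hsin (analyticAt_const.mul (h (.inl 0)))).mul h2).meromorphicAt)).mul (h3.mul h4).meromorphicAt

end Limit

theorem theorem5p6 (m n d : ℕ) [NeZero m] (hd : 0 < d)
    (a : Matrix (Fin n) (Fin m) ℕ) (ha : ∀ j, ∑ i, a i j = d)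
    (hB : LinearIndependent ℤ (fermatB d a) ∧
      Submodule.span ℤ (Set.range (fermatB d a)) = lattice (fermatA d a))
    (w : Fin m ⊕ Fin n → ℝ) (hw : IsDworkPerturbation d a w) :
    maximalCells (fermatA d a) w = cellsDwork a ∧
    ∃ ℓ : C(unitInterval, Fin m ⊕ Fin n → ℂ),
      (fun j => Complex.exp (ℓ 0 j)) ∈ convergenceDomain (fermatA d a) (cellsFer m n) ∧
      (fun j => Complex.exp (ℓ 1 j)) ∈ convergenceDomain (fermatA d a) (cellsDwork a) ∧
      (∀ c : Fin n → ℂ, VeryGeneric (fermatA d a) (cellsDwork a) c →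
        ∀ (p : Fin m → ℤ) (R : Fin n → Finset (Fin m → ℤ)), IsRepSystem d a p R →
          ContinuesAlong ℓ (gammaSeries (fermatA d a) (expFer d a c p))
            (continuedSeries d a p R c)) ∧
      (∀ c c' : Fin n → ℂ,
        (∀ᶠ ε : ℂ in 𝓝[≠] 0, VeryGeneric (fermatA d a) (cellsDwork a) (c + ε • c')) →
        ∀ (p : Fin m → ℤ) (R : Fin n → Finset (Fin m → ℤ)), IsRepSystem d a p R →
          (∀ i, a i 0 ≠ 0 → ∀ t ∈ R i,
            MeromorphicAt (fun ε : ℂ => coeffDwork d a i p (qVec d p t) (c + ε • c')) 0) ∧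
          ∃ L : (Fin m ⊕ Fin n → ℂ) → ℂ,
            (∃ V ∈ 𝓝 (ℓ 1), TendstoUniformlyOn
              (fun (ε : ℂ) x => continuedSeries d a p R (c + ε • c') x) L (𝓝[≠] 0) V) ∧
            ContinuesAlong ℓ (gammaSeries (fermatA d a) (expFer d a c p)) L) := by
  refine ⟨maximalCells_eq_cellsDwork hd hw, ?_⟩
  obtain ⟨T, hT⟩ := exists_isLarge hd ha
  have hτ : |T| ≤ T := by rw [abs_of_pos hT.pos]
  refine ⟨dworkPath m n d T, start_mem_convergenceDomain hd ha hB.2 hT.radius,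
    end_mem_convergenceDomain hd ha hB.2 hT.radius, fun c hc p R hR => ?_,
    fun c c' hc p R hR => ⟨fun i _ t _ => meromorphicAt_coeffDwork c c' _ i, ?_⟩⟩
  · obtain ⟨N, hN⟩ := exists_mbAbscissa_le_mbLine hd n p ‖c‖
    refine continuesAlong_mbFun hd ha hB.2 hT le_rfl hN ?_
    rw [dworkPath_one]
    filter_upwards [eventually_norm_sub_lt _ (mbWidth_pos (n := n) hd)] with x hx
    exact mbFun_eq_continuedSeries hd ha hB.2 hT le_rfl hc hx hN hR
  · obtain ⟨N, hN⟩ := exists_mbAbscissa_le_mbLine hd n p (‖c‖ + 1)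
    have hw := mbWidth_pos (n := n) hd
    refine ⟨mbFun d a c p N, ⟨Metric.closedBall (dworkPath m n d T 1) (mbWidth n d / 2),
      Metric.closedBall_mem_nhds _ (by linarith), ?_⟩,
      continuesAlong_mbFun hd ha hB.2 hT (by linarith) hN .rfl⟩
    have hball : ∀ x ∈ Metric.closedBall (dworkPath m n d T 1) (mbWidth n d / 2),
        ‖x - basePoint m n d T T‖ < mbWidth n d := fun x hx => by
      rw [Metric.mem_closedBall, dworkPath_one, dist_eq_norm] at hx
      linarith
    have hcont : Continuous fun ε : ℂ => c + ε • c' := by fun_prop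
    -- `mbFun` is jointly continuous in the parameter and the variables
    have h := tendstoUniformlyOn_of_continuousAt
      (isCompact_closedBall (dworkPath m n d T 1) (mbWidth n d / 2))
      (g := fun ε x => mbFun d a (c + ε • c') p N x) fun x hx => by
        have h1 : ContinuousAt (fun q : (Fin n → ℂ) × (Fin m ⊕ Fin n → ℂ) => mbFun d a q.1 p N q.2)
            (c + (0 : ℂ) • c', x) :=
          continuousAt_mbFun hd ha hT hN (by simp) hτ (hball x hx)
        exact ContinuousAt.comp (x := ((0 : ℂ), x))
          (f := fun q : ℂ × (Fin m ⊕ Fin n → ℂ) => (c + q.1 • c', q.2)) h1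
          (by fun_prop)
    simp only [zero_smul, add_zero] at h
    have hnorm : ∀ᶠ ε : ℂ in 𝓝[≠] 0, ‖c + ε • c'‖ < ‖c‖ + 1 :=
      nhdsWithin_le_nhds (hcont.norm.continuousAt.eventually_lt continuousAt_const (by simp))
    refine TendstoUniformlyOn.congr (fun u hu => nhdsWithin_le_nhds (h u hu)) ?_
    filter_upwards [hc, hnorm] with ε hε1 hε2 x hx
    exact mbFun_eq_continuedSeries hd ha hB.2 hT hε2.le hε1 (hball x hx) hN hR
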